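/- Let $k,m\ge 0$ be integers, $N=k+m$, and let $a,b,c,d,t\in\mathbb C$ be nonzero with $t^j\neq 1$ for $1\le j\le k$ and $abcd\,t^{2m+j}\ne 1$ for $0\le j<k$. For $q\in\mathbb C\setminus\{0\}$ put $t_0=-q^{-1}ab$, $t_N=-cd$, fix square roots $t^{1/2},t_0^{1/2},t_N^{1/2}$, and put $(q^{-1}abcd)^{1/2}=t_0^{1/2}t_N^{1/2}$. **Non-symmetric Koornwinder polynomials.** On $\mathbb C[z_1^{\pm1},\dots,z_N^{\pm1}]$ let $\mathbf s_i$ ($1\le i\le N-1$) exchange $z_i$ and $z_{i+1}$, let $\mathbf s_0$ replace $z_1$ by $qz_1^{-1}$ and $\mathbf s_N$ replace $z_N$ by $z_N^{-1}$, and let $$\widehat T_i=t^{1/2}-(t^{1/2}z_i-t^{-1/2}z_{i+1})\frac{1-\mathbf s_i}{z_i-z_{i+1}}\quad(1\le i\le N-1),$$ $$\widehat T_0=t_0^{1/2}-t_0^{-1/2}\frac{(z_1-a)(z_1-b)}{z_1}\,\frac{1-\mathbf s_0}{z_1-qz_1^{-1}},\qquad \widehat T_N=t_N^{1/2}+t_N^{-1/2}\frac{(cz_N-1)(dz_N-1)}{z_N}\,\frac{1-\mathbf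 s_N}{z_N-z_N^{-1}},$$ $$Y_i=(\widehat T_i\cdots \widehat T_{N-1})(\widehat T_N\cdots \widehat T_0)(\widehat T_1^{-1}\cdots \widehat T_{i-1}^{-1})\quad(1\le i\le N).$$ For $\alpha\in\mathbb Z^N$ let $\alpha^+$ be the partition in the orbit of $\alpha$ under signed permutations, and $w_\alpha$ the shortest signed permutation with $w_\alpha\alpha^+=\alpha$. Write $\alpha\le\beta$ if $\sum_{i\le j}\alpha_i\le\sum_{i\le j}\beta_i$ for all $j$, and $\alpha\preceq\beta$ if either $\alpha^+<\beta^+$, or $\alpha^+=\beta^+$ and $\alpha\le\beta$. With $\rho=(1,\dots,N)$ let $$\omega_i(\alpha)=q^{\alpha_i}\Big((q^{-1}abcd)^{1/2}\,t^{N-|(w_\alpha\rho)_i|}\Big)^{\operatorname{sign}((w_\alpha\rho)_i)}.$$ A non-symmetric Koornwinder polynomial $E_\alpha$ is a Laurent polynomial of the form $E_\alpha=\mathbf z^\alpha+\sum_{\beta\prec\alpha}c_\beta\mathbf z^\beta$ with $Y_iE_\alpha=\omega_i(\alpha)E_\alpha$ for all $i$. Call the parameters generic for $\alpha$ if for every $\beta\prec\alpha$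 there is an $i$ with $\omega_i(\beta)\ne\omega_i(\alpha)$. **The series $H$.** Let $(x;t)_n=\prod_{i=0}^{n-1}(1-xt^i)$, and let $H(w;a,b,c,d)=\sum_{n\ge0}h_n(a,b,c,d)w^n$ be the formal power series with $$h_n(a,b,c,d)=\frac1{(abcd;t)_n}\sum_{\substack{i,j,l\ge0\\ i+j+l\le n}}\frac{(t;t)_n}{(t;t)_i(t;t)_j(t;t)_l(t;t)_{n-i-j-l}}\,t^{\binom i2+\binom j2}a^ib^j(-c)^{n-l}(-d)^{i+j+l}.$$ **Statement.** Let $\mu=\mu(k,m)=(\underbrace{-1,\dots,-1}_k,\underbrace{0,\dots,0}_m)$. 1. For every $q\neq0$ and every choice of the square roots, $$F=\oint_0\frac{dw}{2\pi i w}\,H(w;a,b,t^mc,t^md)\prod_{i=1}^k(w^{-1}+z_i^{-1})$$ (the formal integral, i.e. the coefficient of $w^0$) is a non-symmetric Koornwinder polynomial $E_\mu$. If the parameters are generic for $\mu$, it is the only one, so $E_{\mu}=F$. 2. In particular $E_\mu$ does not depend on $q$: for any two values of $q$ (and any choices of roots) for which the parameters are generic for $\mu$, the polynomials $E_\mu$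 coincide. 3. Put $c'=t^mc$, $d'=t^md$. The numbers $h_n=h_n(a,b,c',d')$, $0\le n\le k$, are the unique solution of $h_0=1$ and $$\big(t^{n-1}ab-c'^{-1}d'^{-1}\big)h_n+\big(t^{n-1}(a+b)-(c'^{-1}+d'^{-1})\big)h_{n-1}+(t^{n-1}-1)h_{n-2}=0,\qquad 1\le n\le k$$ (for $n=1$ the last term is absent). This is a recursion of Al-Salam–Chihara type: if $s^2=c'd'$, then $Q_n=(-1)^ns^{-n}(abc'd';t)_n\,h_n$ satisfies, for $0\le n<k$, $$Q_{n+1}+\big((A+B)t^n-2x\big)Q_n+(1-t^n)(1-ABt^{n-1})Q_{n-1}=0,\qquad A=sa,\ B=sb,\ x=\frac{c'+d'}{2s}$$ (for $n=0$ the last term is absent). -/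

import Mathlib

open Finset

noncomputable section

namespace Koornwinder

/-! ### Laurent polynomials, substitutions and divided differences -/

/-- The ring `ℂ[z₁^{±1}, …, z_N^{±1}]` of Laurent polynomials in `N` variables. The monomial
`z^α`, `α ∈ ℤ^N`, is `AddMonoidAlgebra.single α 1`, and `f.coeff α` is the coefficient of `z^α`.
Indices are 0-based: `l : Fin N` stands for the variable `z_{l+1}`. -/
abbrev Laurent (N : ℕ) : Type := AddMonoidAlgebra ℂ (Fin N → ℤ)

/-- The variable `z_l`, as an invertible Laurent polynomial. -/
def zvar {N : ℕ} (l : Fin N) : (Laurent N)ˣ where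
  val := AddMonoidAlgebra.single (Pi.single l 1) 1
  inv := AddMonoidAlgebra.single (-Pi.single l 1) 1
  val_inv := by
    rw [AddMonoidAlgebra.single_mul_single, AddMonoidAlgebra.one_def]; simp
  inv_val := by
    rw [AddMonoidAlgebra.single_mul_single, AddMonoidAlgebra.one_def]; simp

/-- The algebra endomorphism of `ℂ[z^{±1}]` that substitutes the unit `u l` for `z_l`. -/
def subst {N : ℕ} (u : Fin N → (Laurent N)ˣ) : Laurent N →ₐ[ℂ] Laurent N :=
  AddMonoidAlgebra.lift ℂ (Laurent N) (Fin N → ℤ)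
    { toFun := fun α => ((∏ l, u l ^ (Multiplicative.toAdd α l) : (Laurent N)ˣ) : Laurent N)
      map_one' := by simp
      map_mul' := fun α β => by
        rw [← Units.val_mul, ← Finset.prod_mul_distrib]
        simp [zpow_add] }

theorem subst_single {N : ℕ} (u : Fin N → (Laurent N)ˣ) (α : Fin N → ℤ) (r : ℂ) :
    subst u (AddMonoidAlgebra.single α r) =
      r • ((∏ l, u l ^ α l : (Laurent N)ˣ) : Laurent N) := by
  simp [subst]

/-- `z^α` as a product of powers of the variables. -/
theorem single_eq_prod {N : ℕ} (α : Fin N → ℤ) :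
    (AddMonoidAlgebra.single α 1 : Laurent N) =
      ((∏ l, zvar l ^ α l : (Laurent N)ˣ) : Laurent N) := by
  let φ : Multiplicative (Fin N → ℤ) →* (Laurent N)ˣ :=
    (AddMonoidAlgebra.of ℂ (Fin N → ℤ)).toHomUnits
  have hφ : ∀ β : Fin N → ℤ, ((φ (Multiplicative.ofAdd β) : (Laurent N)ˣ) : Laurent N) =
      AddMonoidAlgebra.single β 1 := fun β => rfl
  have hz : ∀ l : Fin N, φ (Multiplicative.ofAdd (Pi.single l 1)) = zvar l := by
    intro l
    ext1
    rfl
  have hα : Multiplicative.ofAdd α =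
      ∏ l, (Multiplicative.ofAdd (Pi.single l (1 : ℤ) : Fin N → ℤ)) ^ α l := by
    apply Multiplicative.toAdd.injective
    rw [toAdd_prod]
    ext i
    simp [Finset.sum_apply, Pi.single_apply]
  rw [← hφ, hα, map_prod]
  simp only [map_zpow, hz]

/-- If `d` divides `z_l - u_l` for every `l`, then `d` divides `f(z) - f(u)` for every `f`. -/
theorem dvd_sub_subst {N : ℕ} (u : Fin N → (Laurent N)ˣ) (d : Laurent N)
    (h : ∀ l, d ∣ (zvar l : Laurent N) - u l) (f : Laurent N) : d ∣ f - subst u f := by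
  have key : ∀ l, Units.map (Ideal.Quotient.mk (Ideal.span {d})).toMonoidHom (zvar l) =
      Units.map (Ideal.Quotient.mk (Ideal.span {d})).toMonoidHom (u l) := by
    intro l
    ext1
    exact Ideal.Quotient.eq.2 (Ideal.mem_span_singleton.2 (h l))
  have mono : ∀ α : Fin N → ℤ, d ∣ (AddMonoidAlgebra.single α 1 : Laurent N) -
      ((∏ l, u l ^ α l : (Laurent N)ˣ) : Laurent N) := by
    intro α
    rw [single_eq_prod, ← Ideal.mem_span_singleton, ← Ideal.Quotient.eq]
    have : Units.map (Ideal.Quotient.mk (Ideal.span {d})).toMonoidHom (∏ l, zvar l ^ α l) =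
        Units.map (Ideal.Quotient.mk (Ideal.span {d})).toMonoidHom (∏ l, u l ^ α l) := by
      simp only [map_prod, map_zpow, key]
    exact congrArg Units.val this
  induction f using AddMonoidAlgebra.induction_linear with
  | zero => simp
  | add f g hf hg =>
    rw [map_add, add_sub_add_comm]
    exact dvd_add hf hg
  | single α r =>
    have : (AddMonoidAlgebra.single α r : Laurent N) = r • AddMonoidAlgebra.single α 1 := by
      simp
    rw [subst_single, this, ← smul_sub, Algebra.smul_def]
    exact Dvd.dvd.mul_left (mono α) _

/-- The divided difference operator `f ↦ (f(z) - f(u)) / d` on Laurent polynomials,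
for a nonzero `d` that divides all the differences `z_l - u_l`. -/
def divDiff {N : ℕ} (u : Fin N → (Laurent N)ˣ) (d : Laurent N) (hd : d ≠ 0)
    (h : ∀ l, d ∣ (zvar l : Laurent N) - u l) : Laurent N →ₗ[ℂ] Laurent N where
  toFun f := (dvd_sub_subst u d h f).choose
  map_add' f g := by
    apply mul_left_cancel₀ hd
    rw [mul_add, ← (dvd_sub_subst u d h (f + g)).choose_spec,
      ← (dvd_sub_subst u d h f).choose_spec, ← (dvd_sub_subst u d h g).choose_spec, map_add]
    ring
  map_smul' r f := by
    apply mul_left_cancel₀ hd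
    rw [RingHom.id_apply, mul_smul_comm, ← (dvd_sub_subst u d h (r • f)).choose_spec,
      ← (dvd_sub_subst u d h f).choose_spec, map_smul, smul_sub]

theorem mul_divDiff {N : ℕ} (u : Fin N → (Laurent N)ˣ) (d : Laurent N) (hd : d ≠ 0)
    (h : ∀ l, d ∣ (zvar l : Laurent N) - u l) (f : Laurent N) :
    d * divDiff u d hd h f = f - subst u f :=
  ((dvd_sub_subst u d h f).choose_spec).symm

/-! ### The Noumi representation -/

/-- For fixed `a, b, c, d, t`: the parameter `q ≠ 0`, together with a choice of the square roots
`t^{1/2}`, `t₀^{1/2}`, `t_N^{1/2}` of `t`, `t₀ = -q⁻¹ab` and `t_N = -cd`. -/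
structure NoumiParams (a b c d t : ℂ) where
  q : ℂ
  q_ne_zero : q ≠ 0
  sqrtT : ℂ
  sqrtT_sq : sqrtT ^ 2 = t
  sqrtT0 : ℂ
  sqrtT0_sq : sqrtT0 ^ 2 = -(q⁻¹ * a * b)
  sqrtTN : ℂ
  sqrtTN_sq : sqrtTN ^ 2 = -(c * d)

/-- The constant `r` as a Laurent polynomial. -/
abbrev const (N : ℕ) (r : ℂ) : Laurent N := algebraMap ℂ (Laurent N) r

theorem zvar_sub_zvar_ne_zero {N : ℕ} {i j : Fin N} (hij : i ≠ j) :
    (zvar i : Laurent N) - zvar j ≠ 0 := by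
  intro h
  have h2 := congrArg (fun f : Laurent N => f.coeff (Pi.single i 1)) (sub_eq_zero.1 h)
  have h3 : (Pi.single j 1 : Fin N → ℤ) ≠ Pi.single i 1 := by
    intro h; have := congrFun h i; simp [hij] at this
  simp [zvar, h3] at h2

theorem zvar_sub_inv_ne_zero {N : ℕ} (i : Fin N) (r : ℂ) :
    (zvar i : Laurent N) - const N r * ((zvar i)⁻¹ : (Laurent N)ˣ) ≠ 0 := by
  intro h
  have h2 := congrArg (fun f : Laurent N => f.coeff (Pi.single i 1)) (sub_eq_zero.1 h)
  have h3 : (-Pi.single i 1 : Fin N → ℤ) ≠ Pi.single i 1 := by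
    intro h; have := congrFun h i; simp at this
  rw [← Algebra.smul_def] at h2
  simp [zvar, h3] at h2

/-- `∂_{ij} f = (f - f|_{z_i ↔ z_j}) / (z_i - z_j)`. -/
def swapDiff {N : ℕ} (i j : Fin N) (hij : i ≠ j) : Laurent N →ₗ[ℂ] Laurent N :=
  divDiff (fun l => zvar (Equiv.swap i j l)) ((zvar i : Laurent N) - zvar j)
    (zvar_sub_zvar_ne_zero hij) (by
      intro l
      rcases eq_or_ne l i with rfl | hi
      · simp
      rcases eq_or_ne l j with rfl | hj
      · rw [Equiv.swap_apply_right]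
        exact dvd_sub_comm.1 dvd_rfl
      · simp [Equiv.swap_apply_of_ne_of_ne hi hj])

/-- `(f - f|_{z_i → r z_i⁻¹}) / (z_i - r z_i⁻¹)` for `r ≠ 0`. -/
def invDiff {N : ℕ} (i : Fin N) (r : ℂ) (hr : r ≠ 0) : Laurent N →ₗ[ℂ] Laurent N :=
  divDiff
    (Function.update zvar i
      (Units.map (algebraMap ℂ (Laurent N)).toMonoidHom (Units.mk0 r hr) * (zvar i)⁻¹))
    ((zvar i : Laurent N) - const N r * ((zvar i)⁻¹ : (Laurent N)ˣ))
    (zvar_sub_inv_ne_zero i r) (by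
      intro l
      rcases eq_or_ne l i with rfl | hi
      · rw [Function.update_self, Units.val_mul]
        exact dvd_rfl
      · simp [Function.update_of_ne hi])

variable {a b c d t : ℂ}

/-- `T_i = t^{1/2} - (t^{1/2} z_i - t^{-1/2} z_j) ∂_{ij}`, used for `j = i + 1`. -/
def heckeMid {N : ℕ} (p : NoumiParams a b c d t) (i j : Fin N) (hij : i ≠ j) :
    Module.End ℂ (Laurent N) :=
  p.sqrtT • LinearMap.id -
    LinearMap.mulLeft ℂ (const N p.sqrtT * zvar i - const N p.sqrtT⁻¹ * zvar j : Laurent N) ∘ₗ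
      swapDiff i j hij

/-- `T_0 = t₀^{1/2} - t₀^{-1/2} (z_i - a)(z_i - b) z_i⁻¹ ∂_0`, used for the first variable `z_i`;
here `∂_0 f = (f - f|_{z_i → q z_i⁻¹}) / (z_i - q z_i⁻¹)`. -/
def heckeFirst {N : ℕ} (p : NoumiParams a b c d t) (i : Fin N) : Module.End ℂ (Laurent N) :=
  p.sqrtT0 • LinearMap.id -
    p.sqrtT0⁻¹ • (LinearMap.mulLeft ℂ
      (((zvar i : Laurent N) - const N a) * (zvar i - const N b) * ((zvar i)⁻¹ : (Laurent N)ˣ)) ∘ₗ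
      invDiff i p.q p.q_ne_zero)

/-- `T_N = t_N^{1/2} + t_N^{-1/2} (c z_i - 1)(d z_i - 1) z_i⁻¹ ∂_N`, used for the last variable
`z_i`; here `∂_N f = (f - f|_{z_i → z_i⁻¹}) / (z_i - z_i⁻¹)`. -/
def heckeLast {N : ℕ} (p : NoumiParams a b c d t) (i : Fin N) : Module.End ℂ (Laurent N) :=
  p.sqrtTN • LinearMap.id +
    p.sqrtTN⁻¹ • (LinearMap.mulLeft ℂ
      ((const N c * (zvar i : Laurent N) - 1) * (const N d * zvar i - 1) *
        ((zvar i)⁻¹ : (Laurent N)ˣ)) ∘ₗ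
      invDiff i 1 one_ne_zero)

/-- The generators `T_0, T_1, …, T_N` in the Noumi representation, for `N ≥ 1`. (Nothing is
asserted about the values for `N = 0` or at `l > N`, which are never used.) -/
def heckeT {N : ℕ} (p : NoumiParams a b c d t) (l : ℕ) : Module.End ℂ (Laurent N) :=
  if hN : N = 0 then 1
  else if h0 : l = 0 then heckeFirst p ⟨0, by omega⟩
  else if hl : l < N then heckeMid p ⟨l - 1, by omega⟩ ⟨l, hl⟩ (by simp; omega)
  else heckeLast p ⟨N - 1, by omega⟩

/-- The Lusztig operators
`Y_i = (T_i ⋯ T_{N-1}) (T_N T_{N-1} ⋯ T_0) (T_1⁻¹ ⋯ T_{i-1}⁻¹)`, `1 ≤ i ≤ N`;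
the index `i : Fin N` below is this `i` minus one. -/
def lusztigY {N : ℕ} (p : NoumiParams a b c d t) (i : Fin N) : Module.End ℂ (Laurent N) :=
  ((List.range' (i + 1) (N - 1 - i)).map (heckeT p)).prod *
    ((List.range (N + 1)).reverse.map (heckeT p)).prod *
    ((List.range' 1 i).map fun l => Ring.inverse (heckeT p l)).prod

/-! ### Orders on exponents, spectrum, and the polynomials -/

/-- The partition `α⁺` in the orbit of `α` under signed permutations: the absolute values
`|α_i|` in weakly decreasing order. -/
def plusPart {N : ℕ} (α : Fin N → ℤ) : Fin N → ℤ :=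
  fun i => |α (Tuple.sort (fun j => -|α j|) i)|

/-- The dominance order `α ≤ β`. -/
def DomLE {N : ℕ} (α β : Fin N → ℤ) : Prop :=
  ∀ j, ∑ i ∈ Finset.Iic j, α i ≤ ∑ i ∈ Finset.Iic j, β i

/-- The order `α ⪯ β`: `α⁺ < β⁺` in the dominance order, or `α⁺ = β⁺` and `α ≤ β`. -/
def PrecEq {N : ℕ} (α β : Fin N → ℤ) : Prop :=
  (DomLE (plusPart α) (plusPart β) ∧ plusPart α ≠ plusPart β) ∨
    (plusPart α = plusPart β ∧ DomLE α β)

/-- The strict order `α ≺ β`. -/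
def Prec {N : ℕ} (α β : Fin N → ℤ) : Prop := PrecEq α β ∧ α ≠ β

/-- The position `|(w_α ρ)_i| ∈ {1, …, N}`, where `ρ = (1, 2, …, N)` and `w_α` is the shortest
signed permutation with `w_α α⁺ = α`. In `w_α`, the parts of `α` are ranked by decreasing absolute
value; among the parts with the same absolute value, the nonnegative ones come first, from left
to right, and then the negative ones, from right to left. The sign of `(w_α ρ)_i` is `-` exactly
if `α_i < 0`. -/
def absRho {N : ℕ} (α : Fin N → ℤ) (i : Fin N) : ℕ :=
  1 + #{j | |α i| < |α j| ∨ (|α j| = |α i| ∧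
    (α i < α j ∨ (α j = α i ∧ (if 0 ≤ α i then j < i else i < j))))}

/-- The eigenvalue `ω_i(α) = q^{α_i} ((q⁻¹abcd)^{1/2} t^{N - |(w_α ρ)_i|})^{sign (w_α ρ)_i}`,
where `(q⁻¹abcd)^{1/2} = t₀^{1/2} t_N^{1/2}`. -/
def omega {N : ℕ} (p : NoumiParams a b c d t) (α : Fin N → ℤ) (i : Fin N) : ℂ :=
  p.q ^ α i * (p.sqrtT0 * p.sqrtTN * t ^ (N - absRho α i)) ^ (if α i < 0 then (-1 : ℤ) else 1)

/-- `E` is a non-symmetric Koornwinder polynomial `E_α`: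
`E = z^α + ∑_{β ≺ α} c_β z^β` and `Y_i E = ω_i(α) E` for all `i`. -/
structure IsNonsymKoornwinder {N : ℕ} (p : NoumiParams a b c d t) (α : Fin N → ℤ)
    (E : Laurent N) : Prop where
  coeff_self : E.coeff α = 1
  triangular : ∀ β, E.coeff β ≠ 0 → β = α ∨ Prec β α
  eigen : ∀ i, lusztigY p i E = omega p α i • E

/-- The parameters are generic for `α`: the joint spectrum of `Y_1, …, Y_N` at `α` differs from
the one at every `β ≺ α`. -/
def GenericFor {N : ℕ} (p : NoumiParams a b c d t) (α : Fin N → ℤ) : Prop :=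
  ∀ β, Prec β α → ∃ i, omega p β i ≠ omega p α i

/-- The string `μ(k,m) = (-1, …, -1, 0, …, 0)` with `k` entries `-1` and `m` entries `0`. -/
def mu (k m : ℕ) : Fin (k + m) → ℤ := Fin.append (fun _ => -1) (fun _ => 0)

/-! ### The generating series `H` and the constant-term formula -/

/-- `(x;t)_n = ∏_{i=0}^{n-1} (1 - x t^i)`. -/
def poch (x t : ℂ) (n : ℕ) : ℂ := ∏ i ∈ range n, (1 - x * t ^ i)

/-- The multinomial coefficient
`(t;t)_n / ((t;t)_i (t;t)_j (t;t)_l (t;t)_{n-i-j-l})` with base `t`, for `i + j + l ≤ n`. -/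
def tMultinomial (t : ℂ) (n i j l : ℕ) : ℂ :=
  poch t t n / (poch t t i * poch t t j * poch t t l * poch t t (n - i - j - l))

/-- The coefficients `h_n(a,b,c,d)` with base `t`; the sum runs over `i + j + l ≤ n`. -/
def hCoeff (a b c d t : ℂ) (n : ℕ) : ℂ :=
  (poch (a * b * c * d) t n)⁻¹ *
    ∑ x ∈ (range (n + 1) ×ˢ range (n + 1) ×ˢ range (n + 1)) with x.1 + x.2.1 + x.2.2 ≤ n,
      tMultinomial t n x.1 x.2.1 x.2.2 * t ^ (x.1.choose 2 + x.2.1.choose 2) *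
        a ^ x.1 * b ^ x.2.1 * (-c) ^ (n - x.2.2) * (-d) ^ (x.1 + x.2.1 + x.2.2)

/-- The formal power series `H(w;a,b,c,d) = ∑_n h_n(a,b,c,d) wⁿ`. -/
def HSeries (a b c d t : ℂ) : PowerSeries ℂ := PowerSeries.mk (hCoeff a b c d t)

/-- The formal contour integral `∮₀ f(w) dw / (2πi w)`: the coefficient of `w⁰`. -/
def contourIntegral {R : Type} [CommRing R] (f : LaurentSeries R) : R := f.coeff 0

/-- The Laurent polynomial in `z_1, …, z_{k+m}`
`∮₀ H(w; a, b, tᵐc, tᵐd) ∏_{i=1}^k (w⁻¹ + z_i⁻¹) dw / (2πi w)`. -/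
def integralFormula (a b c d t : ℂ) (k m : ℕ) : Laurent (k + m) :=
  contourIntegral
    (HahnSeries.ofPowerSeries ℤ (Laurent (k + m))
        (PowerSeries.map (algebraMap ℂ (Laurent (k + m)))
          (HSeries a b (t ^ m * c) (t ^ m * d) t)) *
      ∏ i : Fin k, (HahnSeries.single (-1 : ℤ) (1 : Laurent (k + m)) +
        HahnSeries.C (((zvar (Fin.castAdd m i))⁻¹ : (Laurent (k + m))ˣ) : Laurent (k + m))))

/-- The three-term recursion, for `1 ≤ n ≤ M`, of a sequence `h_0, h_1, …`:
`(t^{n-1}ab - c⁻¹d⁻¹) h_n + (t^{n-1}(a+b) - (c⁻¹+d⁻¹)) h_{n-1} + (t^{n-1} - 1) h_{n-2} = 0`.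
It is written with `n + 1` for `n`; for `n = 0` the last coefficient is `t⁰ - 1 = 0`. -/
def ThreeTermRec (a b c d t : ℂ) (M : ℕ) (h : ℕ → ℂ) : Prop :=
  ∀ n < M, (t ^ n * a * b - c⁻¹ * d⁻¹) * h (n + 1) +
    (t ^ n * (a + b) - (c⁻¹ + d⁻¹)) * h n + (t ^ n - 1) * h (n - 1) = 0

/-- The recursion, for `0 ≤ n < M`, of the Al-Salam–Chihara polynomials `Q_n` at argument `x`,
with parameters `A, B` and base `t`:
`Q_{n+1} + ((A+B) tⁿ - 2x) Q_n + (1 - tⁿ)(1 - AB t^{n-1}) Q_{n-1} = 0`.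
For `n = 0` the last coefficient is `0`. -/
def AlSalamChiharaRec (x A B t : ℂ) (M : ℕ) (Q : ℕ → ℂ) : Prop :=
  ∀ n < M, Q (n + 1) + ((A + B) * t ^ n - 2 * x) * Q n +
    (1 - t ^ n) * (1 - A * B * t ^ (n - 1)) * Q (n - 1) = 0

end Koornwinder

end

noncomputable section

namespace Koornwinder

/-! ### Action of the generators on products -/

section Generators

variable {N : ℕ} {a b c d t : ℂ}

/-! Expanding the constant term gives `F = ∑ₙ hₙ e_{k-n}(z₁⁻¹,…,z_k⁻¹)` (`integralFormula_eq`),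
which is symmetric in `z₁,…,z_k` and free of the other variables. As `F` does not involve `q`,
independence of `q` follows from existence and uniqueness.

Existence. `T₀` sees `F` only through `1` and `z₁⁻¹`, and turns `z₁⁻¹` into a multiple of `z₁ -
(a+b)`. The operators `T₁,…,T_{k-1}` then carry `z₁` to `z_k`; on the generating product `∏ (v +
zᵢ⁻¹)` they act through `v ↦ tv`, so its coefficient of `vⁿ` acquires `tⁿ`. The three-term recursion
says exactly that the resulting coefficients, built from `a, b`, can be rewritten with `c'⁻¹, d'⁻¹`
(`descT_sum`). In that form the passage to `T_N` and back returns a multiple of `F`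
(`ascT_last_descT`); crossing the last `m` variables is what replaces `c, d` by `tᵐc, tᵐd`. Hence
`F` is an eigenvector of `Y₁`. The relation `Yᵢ = Tᵢ Yᵢ₊₁ Tᵢ` and the symmetry of `F` transport this
from `i` to `i+1` (`lusztigN_succ`), except across `i = k`, where `F` is not symmetric; there
`Y_{k+1}` is computed directly, and the recursion plays no role (`lusztigN_elemSum_self`).

Recursion. The generating series of `(abcd;t)ₙ hₙ / (t;t)ₙ` is a product of four `t`-exponentials.
It satisfies a first-order equation relating `w` and `tw`, whose coefficients are the recursion
(`gCoeff_rec`).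

Uniqueness. All exponents `β ≺ μ` have entries in `{-1,0,1}`. On such monomials each `Yᵢ` is
triangular for one integer height, with diagonal entry `ωᵢ(β)` (`lusztigY_mon`). If two candidates
differed, a monomial `z^β` of maximal height in their difference would have `ωᵢ(β) = ωᵢ(μ)` for all
`i`, against genericity. -/

theorem subst_zvar (u : Fin N → (Laurent N)ˣ) (l : Fin N) :
    subst u (zvar l : Laurent N) = u l := by
  have : (zvar l : Laurent N) = AddMonoidAlgebra.single (Pi.single l 1) 1 := rfl
  rw [this, subst_single, one_smul]
  congr 1
  rw [Finset.prod_eq_single l] <;> simp +contextual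

theorem subst_zvar_inv (u : Fin N → (Laurent N)ˣ) (l : Fin N) :
    subst u (((zvar l)⁻¹ : (Laurent N)ˣ) : Laurent N) = ((u l)⁻¹ : (Laurent N)ˣ) := by
  have h : Units.map (subst u : Laurent N →* Laurent N) (zvar l) = u l := by
    ext1
    exact subst_zvar u l
  rw [← h, ← map_inv]
  rfl

theorem subst_const (u : Fin N → (Laurent N)ˣ) (r : ℂ) :
    subst u (const N r) = const N r :=
  (subst u).commutes r

/-- The substitution exchanging `z_i` and `z_j`. -/
def swapHom (i j : Fin N) : Laurent N →ₐ[ℂ] Laurent N :=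
  subst fun l => zvar (Equiv.swap i j l)

theorem swapHom_single (i j : Fin N) (α : Fin N → ℤ) (r : ℂ) :
    swapHom i j (AddMonoidAlgebra.single α r) =
      AddMonoidAlgebra.single (α ∘ Equiv.swap i j) r := by
  rw [swapHom, subst_single]
  have h1 : (AddMonoidAlgebra.single (α ∘ Equiv.swap i j) r : Laurent N) =
      r • AddMonoidAlgebra.single (α ∘ Equiv.swap i j) 1 := by simp
  rw [h1, single_eq_prod]
  congr 2
  rw [← Equiv.prod_comp (Equiv.swap i j)]
  simp

theorem swapHom_swapHom (i j : Fin N) (f : Laurent N) : swapHom i j (swapHom i j f) = f := by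
  induction f using AddMonoidAlgebra.induction_linear with
  | zero => simp
  | add f g hf hg => simp [hf, hg]
  | single α r =>
    rw [swapHom_single, swapHom_single]
    congr 1
    ext l
    simp

/-- The substitution `z_i ↦ r z_i⁻¹`. -/
def invHom (i : Fin N) (r : ℂ) (hr : r ≠ 0) : Laurent N →ₐ[ℂ] Laurent N :=
  subst (Function.update zvar i
    (Units.map (algebraMap ℂ (Laurent N)).toMonoidHom (Units.mk0 r hr) * (zvar i)⁻¹))

theorem invHom_single_of_eq_zero {i : Fin N} (r : ℂ) (hr : r ≠ 0) {α : Fin N → ℤ} (h : α i = 0) :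
    invHom i r hr (AddMonoidAlgebra.single α 1) = AddMonoidAlgebra.single α 1 := by
  rw [invHom, subst_single, one_smul, single_eq_prod]
  congr 1
  refine prod_congr rfl fun l _ => ?_
  rcases eq_or_ne l i with rfl | hl
  · simp [h]
  · rw [Function.update_of_ne hl]

theorem swapHom_zvar (i j l : Fin N) :
    swapHom i j (zvar l : Laurent N) = zvar (Equiv.swap i j l) :=
  subst_zvar _ _

theorem swapHom_zvar_inv (i j l : Fin N) :
    swapHom i j (((zvar l)⁻¹ : (Laurent N)ˣ) : Laurent N) =
      ((zvar (Equiv.swap i j l))⁻¹ : (Laurent N)ˣ) :=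
  subst_zvar_inv _ _

theorem invHom_zvar_self (i : Fin N) (r : ℂ) (hr : r ≠ 0) :
    invHom i r hr (zvar i : Laurent N) = const N r * ((zvar i)⁻¹ : (Laurent N)ˣ) := by
  rw [invHom, subst_zvar, Function.update_self]
  rfl

theorem invHom_zvar_inv_self (i : Fin N) (r : ℂ) (hr : r ≠ 0) :
    invHom i r hr (((zvar i)⁻¹ : (Laurent N)ˣ) : Laurent N) = const N r⁻¹ * zvar i := by
  rw [invHom, subst_zvar_inv, Function.update_self, mul_inv, inv_inv]
  rfl

theorem invHom_zvar_inv_of_ne {i l : Fin N} (r : ℂ) (hr : r ≠ 0) (h : l ≠ i) :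
    invHom i r hr (((zvar l)⁻¹ : (Laurent N)ˣ) : Laurent N) = ((zvar l)⁻¹ : (Laurent N)ˣ) := by
  rw [invHom, subst_zvar_inv, Function.update_of_ne h]

theorem const_smul_eq (r : ℂ) (f : Laurent N) : r • f = const N r * f :=
  Algebra.smul_def r f

theorem const_mul_const_inv {r : ℂ} (hr : r ≠ 0) : const N r * const N r⁻¹ = 1 := by
  rw [← map_mul, mul_inv_cancel₀ hr, map_one]

theorem NoumiParams.sqrtT_ne_zero (p : NoumiParams a b c d t) (ht : t ≠ 0) : p.sqrtT ≠ 0 := by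
  intro h
  exact ht (by rw [← p.sqrtT_sq, h]; simp)

theorem NoumiParams.sqrtT0_ne_zero (p : NoumiParams a b c d t) (ha : a ≠ 0) (hb : b ≠ 0) :
    p.sqrtT0 ≠ 0 := by
  intro h
  have := p.sqrtT0_sq
  rw [h] at this
  have hq := p.q_ne_zero
  simp [ha, hb, hq] at this

theorem NoumiParams.sqrtTN_ne_zero (p : NoumiParams a b c d t) (hc : c ≠ 0) (hd : d ≠ 0) :
    p.sqrtTN ≠ 0 := by
  intro h
  have := p.sqrtTN_sq
  rw [h] at this
  simp [hc, hd] at this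

/-- Clears the denominator of the divided difference. Laurent polynomials form a domain, so
identities for `T_i` can be checked in this form and the factor `z_i - z_j` cancelled. -/
theorem mul_heckeMid (p : NoumiParams a b c d t) {i j : Fin N} (hij : i ≠ j) (f : Laurent N) :
    ((zvar i : Laurent N) - zvar j) * heckeMid p i j hij f =
      (const N p.sqrtT⁻¹ - const N p.sqrtT) * zvar j * f +
        (const N p.sqrtT * zvar i - const N p.sqrtT⁻¹ * zvar j) * swapHom i j f := by
  have h : ((zvar i : Laurent N) - zvar j) * swapDiff i j hij f = f - swapHom i j f :=
    mul_divDiff _ _ _ _ f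
  simp only [heckeMid, LinearMap.sub_apply, LinearMap.smul_apply, LinearMap.id_apply,
    LinearMap.comp_apply, LinearMap.mulLeft_apply, const_smul_eq]
  linear_combination (-(const N p.sqrtT * zvar i - const N p.sqrtT⁻¹ * zvar j) : Laurent N) * h

theorem heckeMid_eq_of (p : NoumiParams a b c d t) {i j : Fin N} (hij : i ≠ j) {f g : Laurent N}
    (h : ((zvar i : Laurent N) - zvar j) * g =
      (const N p.sqrtT⁻¹ - const N p.sqrtT) * zvar j * f +
        (const N p.sqrtT * zvar i - const N p.sqrtT⁻¹ * zvar j) * swapHom i j f) :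
    heckeMid p i j hij f = g := by
  apply mul_left_cancel₀ (zvar_sub_zvar_ne_zero hij)
  rw [mul_heckeMid, h]

theorem heckeMid_mul (p : NoumiParams a b c d t) {i j : Fin N} (hij : i ≠ j) {g : Laurent N}
    (hg : swapHom i j g = g) (f : Laurent N) :
    heckeMid p i j hij (g * f) = g * heckeMid p i j hij f := by
  apply heckeMid_eq_of
  rw [map_mul, hg]
  linear_combination g * mul_heckeMid p hij f

theorem heckeMid_of_fixed (p : NoumiParams a b c d t) {i j : Fin N} (hij : i ≠ j) {g : Laurent N}
    (hg : swapHom i j g = g) : heckeMid p i j hij g = const N p.sqrtT * g := by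
  apply heckeMid_eq_of
  rw [hg]
  ring

theorem heckeMid_heckeMid (p : NoumiParams a b c d t) (ht : t ≠ 0) {i j : Fin N} (hij : i ≠ j)
    (f : Laurent N) :
    heckeMid p i j hij (heckeMid p i j hij f) =
      (const N p.sqrtT - const N p.sqrtT⁻¹) * heckeMid p i j hij f + f := by
  have h0 := const_mul_const_inv (N := N) (p.sqrtT_ne_zero ht)
  have h1 := mul_heckeMid p hij f
  -- Exchanging the variables in the cleared formula expresses `s(T f)` through `f` and `s f`, which
  -- is what the second application of `T` needs.
  have h2 := congrArg (swapHom i j) h1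
  simp only [map_mul, map_add, map_sub, swapHom_zvar, Equiv.swap_apply_left,
    Equiv.swap_apply_right, swapHom_swapHom, AlgHom.commutes] at h2
  apply heckeMid_eq_of
  apply mul_left_cancel₀ (zvar_sub_zvar_ne_zero hij)
  linear_combination (((zvar i : Laurent N) - zvar j) * (const N p.sqrtT - const N p.sqrtT⁻¹) +
      (const N p.sqrtT - const N p.sqrtT⁻¹) * zvar j) * h1 +
    (const N p.sqrtT * zvar i - const N p.sqrtT⁻¹ * zvar j : Laurent N) * h2 +
    (-(zvar i - zvar j : Laurent N) ^ 2 * f) * h0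

theorem mul_heckeFirst (p : NoumiParams a b c d t) (i : Fin N) (f : Laurent N) :
    ((zvar i : Laurent N) - const N p.q * ((zvar i)⁻¹ : (Laurent N)ˣ)) * heckeFirst p i f =
      const N p.sqrtT0 * ((zvar i : Laurent N) - const N p.q * ((zvar i)⁻¹ : (Laurent N)ˣ)) * f -
      const N p.sqrtT0⁻¹ * (((zvar i : Laurent N) - const N a) * (zvar i - const N b) *
        ((zvar i)⁻¹ : (Laurent N)ˣ)) * (f - invHom i p.q p.q_ne_zero f) := by
  have h : ((zvar i : Laurent N) - const N p.q * ((zvar i)⁻¹ : (Laurent N)ˣ)) *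
      invDiff i p.q p.q_ne_zero f = f - invHom i p.q p.q_ne_zero f :=
    mul_divDiff _ _ _ _ f
  simp only [heckeFirst, LinearMap.sub_apply, LinearMap.smul_apply, LinearMap.id_apply,
    LinearMap.comp_apply, LinearMap.mulLeft_apply, const_smul_eq]
  linear_combination (-const N p.sqrtT0⁻¹ * (((zvar i : Laurent N) - const N a) *
    (zvar i - const N b) * ((zvar i)⁻¹ : (Laurent N)ˣ))) * h

theorem mul_heckeLast (p : NoumiParams a b c d t) (i : Fin N) (f : Laurent N) :
    ((zvar i : Laurent N) - const N 1 * ((zvar i)⁻¹ : (Laurent N)ˣ)) * heckeLast p i f =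
      const N p.sqrtTN * ((zvar i : Laurent N) - const N 1 * ((zvar i)⁻¹ : (Laurent N)ˣ)) * f +
      const N p.sqrtTN⁻¹ * ((const N c * (zvar i : Laurent N) - 1) * (const N d * zvar i - 1) *
        ((zvar i)⁻¹ : (Laurent N)ˣ)) * (f - invHom i 1 one_ne_zero f) := by
  have h : ((zvar i : Laurent N) - const N 1 * ((zvar i)⁻¹ : (Laurent N)ˣ)) *
      invDiff i 1 one_ne_zero f = f - invHom i 1 one_ne_zero f :=
    mul_divDiff _ _ _ _ f
  simp only [heckeLast, LinearMap.add_apply, LinearMap.smul_apply, LinearMap.id_apply,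
    LinearMap.comp_apply, LinearMap.mulLeft_apply, const_smul_eq]
  linear_combination (const N p.sqrtTN⁻¹ * ((const N c * (zvar i : Laurent N) - 1) *
    (const N d * zvar i - 1) * ((zvar i)⁻¹ : (Laurent N)ˣ))) * h

theorem heckeFirst_mul (p : NoumiParams a b c d t) (i : Fin N) {g : Laurent N}
    (hg : invHom i p.q p.q_ne_zero g = g) (f : Laurent N) :
    heckeFirst p i (g * f) = g * heckeFirst p i f := by
  apply mul_left_cancel₀ (zvar_sub_inv_ne_zero i p.q)
  rw [mul_heckeFirst, map_mul, hg]
  linear_combination -g * mul_heckeFirst p i f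

theorem heckeLast_mul (p : NoumiParams a b c d t) (i : Fin N) {g : Laurent N}
    (hg : invHom i 1 one_ne_zero g = g) (f : Laurent N) :
    heckeLast p i (g * f) = g * heckeLast p i f := by
  apply mul_left_cancel₀ (zvar_sub_inv_ne_zero i 1)
  rw [mul_heckeLast, map_mul, hg]
  linear_combination -g * mul_heckeLast p i f

theorem heckeFirst_of_fixed (p : NoumiParams a b c d t) (i : Fin N) {g : Laurent N}
    (hg : invHom i p.q p.q_ne_zero g = g) : heckeFirst p i g = const N p.sqrtT0 * g := by
  apply mul_left_cancel₀ (zvar_sub_inv_ne_zero i p.q)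
  rw [mul_heckeFirst, hg]
  ring

theorem heckeLast_of_fixed (p : NoumiParams a b c d t) (i : Fin N) {g : Laurent N}
    (hg : invHom i 1 one_ne_zero g = g) : heckeLast p i g = const N p.sqrtTN * g := by
  apply mul_left_cancel₀ (zvar_sub_inv_ne_zero i 1)
  rw [mul_heckeLast, hg]
  ring

theorem heckeFirst_zvar (p : NoumiParams a b c d t) (ha : a ≠ 0) (hb : b ≠ 0) (i : Fin N) :
    heckeFirst p i (zvar i : Laurent N) =
      const N (p.sqrtT0 - p.sqrtT0⁻¹) * zvar i +
      const N (p.q * p.sqrtT0) * ((zvar i)⁻¹ : (Laurent N)ˣ) +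
      const N (p.sqrtT0⁻¹ * (a + b)) := by
  have h1 : (zvar i : Laurent N) * ((zvar i)⁻¹ : (Laurent N)ˣ) = 1 := by simp
  have h2 : p.q * p.sqrtT0 = - p.sqrtT0⁻¹ * a * b := by
    have h0 := p.sqrtT0_ne_zero ha hb
    have hq := p.q_ne_zero
    have := p.sqrtT0_sq
    field_simp at this ⊢
    linear_combination this
  apply mul_left_cancel₀ (zvar_sub_inv_ne_zero i p.q)
  rw [mul_heckeFirst, invHom_zvar_self, h2]
  simp only [map_sub, map_mul, map_add, map_neg]
  linear_combination (-(zvar i - const N p.q * ((zvar i)⁻¹ : (Laurent N)ˣ) : Laurent N) *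
    const N p.sqrtT0⁻¹ * (zvar i - const N a - const N b)) * h1

/-- Since `∂₀ z⁻¹ = -q⁻¹`, the two multiples of `z⁻¹` cancel by `t₀ = -q⁻¹ab`, and only `z` and a
constant survive. -/
theorem heckeFirst_zvar_inv (p : NoumiParams a b c d t) (ha : a ≠ 0) (hb : b ≠ 0) (i : Fin N) :
    heckeFirst p i (((zvar i)⁻¹ : (Laurent N)ˣ) : Laurent N) =
      const N (p.q⁻¹ * p.sqrtT0⁻¹) * (zvar i - const N (a + b)) := by
  have h1 : (zvar i : Laurent N) * ((zvar i)⁻¹ : (Laurent N)ˣ) = 1 := by simp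
  have h2 : p.sqrtT0 = - p.q⁻¹ * p.sqrtT0⁻¹ * a * b := by
    have h0 := p.sqrtT0_ne_zero ha hb
    have hq := p.q_ne_zero
    have := p.sqrtT0_sq
    field_simp at this ⊢
    linear_combination this
  have h2' : const N p.sqrtT0 =
      - const N p.q⁻¹ * const N p.sqrtT0⁻¹ * const N a * const N b := by
    simp only [← map_mul, ← map_neg]
    rw [← h2]
  have h3 := const_mul_const_inv (N := N) p.q_ne_zero
  apply mul_left_cancel₀ (zvar_sub_inv_ne_zero i p.q)
  rw [mul_heckeFirst, invHom_zvar_inv_self]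
  simp only [map_mul, map_add]
  set z : Laurent N := (zvar i : Laurent N)
  set y : Laurent N := (((zvar i)⁻¹ : (Laurent N)ˣ) : Laurent N)
  linear_combination (y * (z - const N p.q * y)) * h2' +
    (const N p.q⁻¹ * const N p.sqrtT0⁻¹ * (z - const N a - const N b) *
      (z - const N p.q * y)) * h1 +
    const N p.sqrtT0⁻¹ * (z - const N a) * (z - const N b) * y * y * h3

/-- The mirror image at the other end: `∂_N z = 1`, and `t_N = -cd` removes the multiples of `z`. -/
theorem heckeLast_zvar (p : NoumiParams a b c d t) (hc : c ≠ 0) (hd : d ≠ 0) (i : Fin N) :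
    heckeLast p i (zvar i : Laurent N) =
      const N p.sqrtTN⁻¹ * (((zvar i)⁻¹ : (Laurent N)ˣ) - const N (c + d)) := by
  have h1 : (zvar i : Laurent N) * ((zvar i)⁻¹ : (Laurent N)ˣ) = 1 := by simp
  have h2 : p.sqrtTN = - p.sqrtTN⁻¹ * c * d := by
    have h0 := p.sqrtTN_ne_zero hc hd
    have := p.sqrtTN_sq
    field_simp
    linear_combination this
  have h2' : const N p.sqrtTN = - const N p.sqrtTN⁻¹ * const N c * const N d := by
    simp only [← map_mul, ← map_neg]
    rw [← h2]
  apply mul_left_cancel₀ (zvar_sub_inv_ne_zero i 1)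
  rw [mul_heckeLast, invHom_zvar_self]
  simp only [map_one, one_mul, map_add]
  set z : Laurent N := (zvar i : Laurent N)
  set y : Laurent N := (((zvar i)⁻¹ : (Laurent N)ˣ) : Laurent N)
  linear_combination ((z - y) * z) * h2' +
    (const N p.sqrtTN⁻¹ * (z - y) * (const N c * const N d * z - const N c - const N d)) * h1

theorem heckeLast_zvar_inv (p : NoumiParams a b c d t) (hc : c ≠ 0) (hd : d ≠ 0) (i : Fin N) :
    heckeLast p i (((zvar i)⁻¹ : (Laurent N)ˣ) : Laurent N) =
      const N (p.sqrtTN - p.sqrtTN⁻¹) * ((zvar i)⁻¹ : (Laurent N)ˣ) +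
      const N p.sqrtTN * zvar i + const N (p.sqrtTN⁻¹ * (c + d)) := by
  have h1 : (zvar i : Laurent N) * ((zvar i)⁻¹ : (Laurent N)ˣ) = 1 := by simp
  have h2 : p.sqrtTN = - p.sqrtTN⁻¹ * c * d := by
    have h0 := p.sqrtTN_ne_zero hc hd
    have := p.sqrtTN_sq
    field_simp
    linear_combination this
  have h2' : const N p.sqrtTN = - const N p.sqrtTN⁻¹ * const N c * const N d := by
    simp only [← map_mul, ← map_neg]
    rw [← h2]
  apply mul_left_cancel₀ (zvar_sub_inv_ne_zero i 1)
  rw [mul_heckeLast, invHom_zvar_inv_self]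
  simp only [map_one, one_mul, map_add, map_sub, map_mul, inv_one]
  set z : Laurent N := (zvar i : Laurent N)
  set y : Laurent N := (((zvar i)⁻¹ : (Laurent N)ˣ) : Laurent N)
  linear_combination (-(z - y) * z) * h2' -
    (const N p.sqrtTN⁻¹ * (z - y) * (const N c * const N d * z - const N c - const N d)) * h1

end Generators

/-! ### The generators with integer indices -/

section Indexed

variable {N : ℕ} {a b c d t : ℂ}

theorem const_mul (r s : ℂ) : const N (r * s) = const N r * const N s := map_mul _ r s

/-- The variable `z_{l+1}`, and `0` if there is none. -/
def zN (N l : ℕ) : Laurent N := if h : l < N then zvar ⟨l, h⟩ else 0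

/-- The inverse of the variable `z_{l+1}`, and `0` if there is none. -/
def yN (N l : ℕ) : Laurent N := if h : l < N then ((zvar ⟨l, h⟩)⁻¹ : (Laurent N)ˣ) else 0

theorem zN_mul_yN {l : ℕ} (h : l < N) : zN N l * yN N l = 1 := by
  simp [zN, yN, h]

/-- `f` is symmetric in `z_l` and `z_{l+1}`. -/
def MidFixed (l : ℕ) (f : Laurent N) : Prop :=
  ∀ h : l < N, swapHom ⟨l - 1, by omega⟩ ⟨l, h⟩ f = f

theorem MidFixed.mul {l : ℕ} {f g : Laurent N} (hf : MidFixed l f) (hg : MidFixed l g) :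
    MidFixed l (f * g) := fun h => by rw [map_mul, hf h, hg h]

theorem MidFixed.add {l : ℕ} {f g : Laurent N} (hf : MidFixed l f) (hg : MidFixed l g) :
    MidFixed l (f + g) := fun h => by rw [map_add, hf h, hg h]

theorem MidFixed.const (l : ℕ) (r : ℂ) : MidFixed l (const N r) := fun _ => subst_const _ _

theorem MidFixed.one (l : ℕ) : MidFixed l (1 : Laurent N) := fun _ => map_one _

theorem MidFixed.prod {l : ℕ} {ι : Type*} {s : Finset ι} {f : ι → Laurent N}
    (hf : ∀ i ∈ s, MidFixed l (f i)) : MidFixed l (∏ i ∈ s, f i) := fun h => by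
  rw [map_prod]
  exact prod_congr rfl fun i hi => hf i hi h

theorem midFixed_yN {l i : ℕ} (h1 : i ≠ l) (h2 : i + 1 ≠ l) : MidFixed l (yN N i) := by
  intro h
  by_cases hi : i < N
  · simp only [yN, hi, dif_pos, swapHom_zvar_inv]
    rw [Equiv.swap_apply_of_ne_of_ne] <;> simp [Fin.ext_iff] <;> omega
  · simp [yN, hi]

theorem midFixed_mul_yN {l : ℕ} (hl : 1 ≤ l) (v : ℂ) :
    MidFixed l ((const N v + yN N (l - 1)) * (const N v + yN N l)) := by
  intro h
  have h' : l - 1 < N := by omega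
  simp only [map_mul, map_add, AlgHom.commutes, yN, h, h', dif_pos, swapHom_zvar_inv,
    Equiv.swap_apply_left, Equiv.swap_apply_right]
  ring

theorem heckeT_zero (p : NoumiParams a b c d t) (hN : 0 < N) :
    (heckeT p 0 : Module.End ℂ (Laurent N)) = heckeFirst p ⟨0, hN⟩ := by
  rw [heckeT, dif_neg (by omega), dif_pos rfl]

theorem heckeT_mid (p : NoumiParams a b c d t) {l : ℕ} (hl : 1 ≤ l) (hN : l < N) :
    (heckeT p l : Module.End ℂ (Laurent N)) =
      heckeMid p ⟨l - 1, by omega⟩ ⟨l, hN⟩ (by simp; omega) := by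
  rw [heckeT, dif_neg (by omega), dif_neg (by omega), dif_pos hN]

theorem heckeT_last (p : NoumiParams a b c d t) (hN : 0 < N) :
    (heckeT p N : Module.End ℂ (Laurent N)) = heckeLast p ⟨N - 1, by omega⟩ := by
  rw [heckeT, dif_neg (by omega), dif_neg (by omega), dif_neg (by omega)]

theorem heckeT_mul (p : NoumiParams a b c d t) {l : ℕ} (hl : 1 ≤ l) (hN : l < N) {g : Laurent N}
    (hg : MidFixed l g) (f : Laurent N) : heckeT p l (g * f) = g * heckeT p l f := by
  rw [heckeT_mid p hl hN]
  exact heckeMid_mul p _ (hg hN) f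

theorem heckeT_of_fixed (p : NoumiParams a b c d t) {l : ℕ} (hl : 1 ≤ l) (hN : l < N)
    {g : Laurent N} (hg : MidFixed l g) : heckeT p l g = const N p.sqrtT * g := by
  rw [heckeT_mid p hl hN]
  exact heckeMid_of_fixed p _ (hg hN)

theorem heckeT_heckeT (p : NoumiParams a b c d t) (ht : t ≠ 0) {l : ℕ} (hl : 1 ≤ l) (hN : l < N)
    (f : Laurent N) :
    heckeT p l (heckeT p l f) =
      (const N p.sqrtT - const N p.sqrtT⁻¹) * heckeT p l f + f := by
  rw [heckeT_mid p hl hN]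
  exact heckeMid_heckeMid p ht _ f

/-- The favourable direction: inverse variables move left, and in `heckeT_zN` variables move right,
with a single term. The opposite moves leave an extra multiple of the original. -/
theorem heckeT_yN (p : NoumiParams a b c d t) {l : ℕ} (hl : 1 ≤ l) (hN : l < N) :
    heckeT p l (yN N l) = const N p.sqrtT⁻¹ * yN N (l - 1) := by
  have h' : l - 1 < N := by omega
  have h1 := zN_mul_yN hN
  have h2 := zN_mul_yN h'
  rw [heckeT_mid p hl hN]
  apply heckeMid_eq_of
  simp only [yN, zN, hN, h', dif_pos, swapHom_zvar_inv, Equiv.swap_apply_right] at h1 h2 ⊢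
  linear_combination (-(const N p.sqrtT⁻¹ - const N p.sqrtT)) * h1 +
    (const N p.sqrtT⁻¹ - const N p.sqrtT) * h2

theorem heckeT_yN_pred (p : NoumiParams a b c d t) {l : ℕ} (hl : 1 ≤ l) (hN : l < N) :
    heckeT p l (yN N (l - 1)) = const N p.sqrtT * yN N l +
      const N (p.sqrtT - p.sqrtT⁻¹) * yN N (l - 1) := by
  have h' : l - 1 < N := by omega
  have h1 := zN_mul_yN hN
  have h2 := zN_mul_yN h'
  rw [heckeT_mid p hl hN]
  apply heckeMid_eq_of
  simp only [yN, zN, hN, h', dif_pos, swapHom_zvar_inv, Equiv.swap_apply_left, map_sub] at h1 h2 ⊢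
  linear_combination (-(const N p.sqrtT - const N p.sqrtT⁻¹)) * h1 +
    (const N p.sqrtT - const N p.sqrtT⁻¹) * h2

theorem heckeT_zN (p : NoumiParams a b c d t) {l : ℕ} (hl : 1 ≤ l) (hN : l < N) :
    heckeT p l (zN N (l - 1)) = const N p.sqrtT⁻¹ * zN N l := by
  have h' : l - 1 < N := by omega
  rw [heckeT_mid p hl hN]
  apply heckeMid_eq_of
  simp only [zN, hN, h', dif_pos, swapHom_zvar, Equiv.swap_apply_left]
  ring

theorem heckeT_zN_succ (p : NoumiParams a b c d t) {l : ℕ} (hl : 1 ≤ l) (hN : l < N) :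
    heckeT p l (zN N l) = const N p.sqrtT * zN N (l - 1) +
      const N (p.sqrtT - p.sqrtT⁻¹) * zN N l := by
  have h' : l - 1 < N := by omega
  rw [heckeT_mid p hl hN]
  apply heckeMid_eq_of
  simp only [zN, hN, h', dif_pos, swapHom_zvar, Equiv.swap_apply_right, map_sub]
  ring

theorem heckeT_zN_mul_yN (p : NoumiParams a b c d t) {l : ℕ} (hl : 1 ≤ l) (hN : l < N) :
    heckeT p l (zN N (l - 1) * yN N l) = const N p.sqrtT⁻¹ * (zN N l * yN N (l - 1)) +
      const N (p.sqrtT⁻¹ - p.sqrtT) := by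
  have h' : l - 1 < N := by omega
  have h1 := zN_mul_yN hN
  have h2 := zN_mul_yN h'
  rw [heckeT_mid p hl hN]
  apply heckeMid_eq_of
  simp only [yN, zN, hN, h', dif_pos, swapHom_zvar_inv, Equiv.swap_apply_right, swapHom_zvar,
    Equiv.swap_apply_left, map_mul, map_sub] at h1 h2 ⊢
  linear_combination (-(const N p.sqrtT⁻¹ - const N p.sqrtT) *
      ((zvar ⟨l - 1, h'⟩ : (Laurent N)ˣ) : Laurent N)) * h1 +
    (const N p.sqrtT⁻¹ - const N p.sqrtT) *
      ((zvar ⟨l, hN⟩ : (Laurent N)ˣ) : Laurent N) * h2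

theorem heckeT_yN_mul_zN (p : NoumiParams a b c d t) {l : ℕ} (hl : 1 ≤ l) (hN : l < N) :
    heckeT p l (zN N l * yN N (l - 1)) = const N p.sqrtT * (zN N (l - 1) * yN N l) +
      const N (p.sqrtT - p.sqrtT⁻¹) * (zN N l * yN N (l - 1)) +
      const N (p.sqrtT - p.sqrtT⁻¹) := by
  have h' : l - 1 < N := by omega
  have h1 := zN_mul_yN hN
  have h2 := zN_mul_yN h'
  rw [heckeT_mid p hl hN]
  apply heckeMid_eq_of
  simp only [yN, zN, hN, h', dif_pos, swapHom_zvar_inv, Equiv.swap_apply_right, swapHom_zvar,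
    Equiv.swap_apply_left, map_mul, map_sub] at h1 h2 ⊢
  linear_combination (-(const N p.sqrtT - const N p.sqrtT⁻¹) *
      ((zvar ⟨l - 1, h'⟩ : (Laurent N)ˣ) : Laurent N)) * h1 +
    (const N p.sqrtT - const N p.sqrtT⁻¹) *
      ((zvar ⟨l, hN⟩ : (Laurent N)ˣ) : Laurent N) * h2

/-- The quadratic Hecke relation, read as an explicit right inverse; this identifies `Ring.inverse`
of the generator. -/
theorem heckeT_mul_sub (p : NoumiParams a b c d t) (ht : t ≠ 0) {l : ℕ} (hl : 1 ≤ l)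
    (hN : l < N) :
    (heckeT p l : Module.End ℂ (Laurent N)) * (heckeT p l - (p.sqrtT - p.sqrtT⁻¹) • 1) = 1 := by
  refine LinearMap.ext fun f => ?_
  simp only [Module.End.mul_apply, LinearMap.sub_apply, LinearMap.smul_apply,
    Module.End.one_apply, map_sub, map_smul, heckeT_heckeT p ht hl hN]
  simp only [const_smul_eq, map_sub]
  ring

theorem sub_mul_heckeT (p : NoumiParams a b c d t) (ht : t ≠ 0) {l : ℕ} (hl : 1 ≤ l)
    (hN : l < N) :
    (heckeT p l - (p.sqrtT - p.sqrtT⁻¹) • 1) * (heckeT p l : Module.End ℂ (Laurent N)) = 1 := by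
  have h := heckeT_mul_sub p ht hl hN
  rw [mul_sub, mul_smul_comm, mul_one] at h
  rw [sub_mul, smul_mul_assoc, one_mul, h]

theorem inverse_heckeT (p : NoumiParams a b c d t) (ht : t ≠ 0) {l : ℕ} (hl : 1 ≤ l)
    (hN : l < N) :
    Ring.inverse (heckeT p l : Module.End ℂ (Laurent N)) =
      heckeT p l - (p.sqrtT - p.sqrtT⁻¹) • 1 :=
  Ring.inverse_unit ⟨heckeT p l, _, heckeT_mul_sub p ht hl hN, sub_mul_heckeT p ht hl hN⟩

theorem inverse_heckeT_apply (p : NoumiParams a b c d t) (ht : t ≠ 0) {l : ℕ} (hl : 1 ≤ l)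
    (hN : l < N) (f : Laurent N) :
    Ring.inverse (heckeT p l : Module.End ℂ (Laurent N)) f =
      heckeT p l f - const N (p.sqrtT - p.sqrtT⁻¹) * f := by
  rw [inverse_heckeT p ht hl hN]
  simp [const_smul_eq]

theorem inverse_heckeT_heckeT (p : NoumiParams a b c d t) (ht : t ≠ 0) {l : ℕ} (hl : 1 ≤ l)
    (hN : l < N) (f : Laurent N) :
    Ring.inverse (heckeT p l : Module.End ℂ (Laurent N)) (heckeT p l f) = f := by
  rw [inverse_heckeT p ht hl hN, ← Module.End.mul_apply, sub_mul_heckeT p ht hl hN,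
    Module.End.one_apply]

/-! ### Products of consecutive generators -/

/-- `T_l T_{l+1} ⋯ T_{l+r-1}`. -/
def ascT (N : ℕ) (p : NoumiParams a b c d t) (l r : ℕ) : Module.End ℂ (Laurent N) :=
  ((List.range' l r).map (heckeT p)).prod

/-- `T_{l+r-1} ⋯ T_{l+1} T_l`. -/
def descT (N : ℕ) (p : NoumiParams a b c d t) (l r : ℕ) : Module.End ℂ (Laurent N) :=
  ((List.range' l r).reverse.map (heckeT p)).prod

/-- `T_l⁻¹ T_{l+1}⁻¹ ⋯ T_{l+r-1}⁻¹`. -/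
def ascInvT (N : ℕ) (p : NoumiParams a b c d t) (l r : ℕ) : Module.End ℂ (Laurent N) :=
  ((List.range' l r).map fun l => Ring.inverse (heckeT p l)).prod

theorem lusztigY_eq (p : NoumiParams a b c d t) (i : Fin N) :
    lusztigY p i = ascT N p (i + 1) (N - 1 - i) * descT N p 0 (N + 1) * ascInvT N p 1 i := by
  rw [lusztigY, List.range_eq_range']
  rfl

@[simp] theorem ascT_zero (p : NoumiParams a b c d t) (l : ℕ) : ascT N p l 0 = 1 := rfl

@[simp] theorem descT_zero (p : NoumiParams a b c d t) (l : ℕ) : descT N p l 0 = 1 := rfl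

@[simp] theorem ascInvT_zero (p : NoumiParams a b c d t) (l : ℕ) : ascInvT N p l 0 = 1 := rfl

theorem ascT_add (p : NoumiParams a b c d t) (l r r' : ℕ) :
    ascT N p l (r + r') = ascT N p l r * ascT N p (l + r) r' := by
  rw [ascT, ← List.range'_append_1, List.map_append, List.prod_append]
  rfl

theorem descT_add (p : NoumiParams a b c d t) (l r r' : ℕ) :
    descT N p l (r + r') = descT N p (l + r) r' * descT N p l r := by
  rw [descT, ← List.range'_append_1, List.reverse_append, List.map_append, List.prod_append]
  rfl

theorem ascInvT_add (p : NoumiParams a b c d t) (l r r' : ℕ) :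
    ascInvT N p l (r + r') = ascInvT N p l r * ascInvT N p (l + r) r' := by
  rw [ascInvT, ← List.range'_append_1, List.map_append, List.prod_append]
  rfl

@[simp] theorem ascT_one (p : NoumiParams a b c d t) (l : ℕ) : ascT N p l 1 = heckeT p l := by
  simp [ascT]

@[simp] theorem descT_one (p : NoumiParams a b c d t) (l : ℕ) : descT N p l 1 = heckeT p l := by
  simp [descT]

@[simp] theorem ascInvT_one (p : NoumiParams a b c d t) (l : ℕ) :
    ascInvT N p l 1 = Ring.inverse (heckeT p l) := by
  simp [ascInvT]

theorem ascInvT_descT (p : NoumiParams a b c d t) (ht : t ≠ 0) {l r : ℕ} (hl : 1 ≤ l)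
    (hN : l + r ≤ N) (f : Laurent N) : ascInvT N p l r (descT N p l r f) = f := by
  induction r with
  | zero => rfl
  | succ r ih =>
    rw [ascInvT_add, descT_add]
    simp only [Module.End.mul_apply, ascInvT_one, descT_one]
    rw [inverse_heckeT_heckeT p ht (by omega) (by omega), ih (by omega)]

theorem descT_mul (p : NoumiParams a b c d t) {l r : ℕ} (hl : 1 ≤ l) (hN : l + r ≤ N)
    {g : Laurent N} (hg : ∀ j, l ≤ j → j < l + r → MidFixed j g) (f : Laurent N) :
    descT N p l r (g * f) = g * descT N p l r f := by
  induction r with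
  | zero => rfl
  | succ r ih =>
    rw [descT_add]
    simp only [Module.End.mul_apply, descT_one]
    rw [ih (by omega) fun j h1 h2 => hg j h1 (by omega),
      heckeT_mul p (by omega) (by omega) (hg _ (by omega) (by omega))]

theorem ascT_mul (p : NoumiParams a b c d t) {l r : ℕ} (hl : 1 ≤ l) (hN : l + r ≤ N)
    {g : Laurent N} (hg : ∀ j, l ≤ j → j < l + r → MidFixed j g) (f : Laurent N) :
    ascT N p l r (g * f) = g * ascT N p l r f := by
  induction r generalizing f with
  | zero => rfl
  | succ r ih =>
    rw [ascT_add]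
    simp only [Module.End.mul_apply, ascT_one]
    rw [heckeT_mul p (by omega) (by omega) (hg _ (by omega) (by omega)),
      ih (by omega) fun j h1 h2 => hg j h1 (by omega)]

theorem descT_of_fixed (p : NoumiParams a b c d t) {l r : ℕ} (hl : 1 ≤ l) (hN : l + r ≤ N)
    {g : Laurent N} (hg : ∀ j, l ≤ j → j < l + r → MidFixed j g) :
    descT N p l r g = const N (p.sqrtT ^ r) * g := by
  induction r with
  | zero => simp
  | succ r ih =>
    rw [descT_add]
    simp only [Module.End.mul_apply, descT_one]
    rw [ih (by omega) fun j h1 h2 => hg j h1 (by omega),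
      heckeT_mul p (by omega) (by omega) (MidFixed.const _ _),
      heckeT_of_fixed p (by omega) (by omega) (hg _ (by omega) (by omega)), pow_succ, const_mul,
      mul_assoc]

theorem ascT_of_fixed (p : NoumiParams a b c d t) {l r : ℕ} (hl : 1 ≤ l) (hN : l + r ≤ N)
    {g : Laurent N} (hg : ∀ j, l ≤ j → j < l + r → MidFixed j g) :
    ascT N p l r g = const N (p.sqrtT ^ r) * g := by
  induction r with
  | zero => simp
  | succ r ih =>
    rw [ascT_add]
    simp only [Module.End.mul_apply, ascT_one]
    rw [heckeT_of_fixed p (by omega) (by omega) (hg _ (by omega) (by omega)),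
      ascT_mul p hl (by omega) (fun j _ _ => MidFixed.const _ _),
      ih (by omega) fun j h1 h2 => hg j h1 (by omega), pow_succ, const_mul]
    ring

theorem descT_zN (p : NoumiParams a b c d t) {l r : ℕ} (hl : 1 ≤ l) (hN : l + r ≤ N) :
    descT N p l r (zN N (l - 1)) = const N (p.sqrtT⁻¹ ^ r) * zN N (l - 1 + r) := by
  induction r with
  | zero => simp
  | succ r ih =>
    rw [descT_add]
    simp only [Module.End.mul_apply, descT_one]
    rw [ih (by omega), heckeT_mul p (by omega) (by omega) (MidFixed.const _ _),
      show l - 1 + r = l + r - 1 by omega, heckeT_zN p (by omega) (by omega),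
      show l - 1 + (r + 1) = l + r by omega, pow_succ, const_mul, mul_assoc]

theorem ascT_yN (p : NoumiParams a b c d t) {l r : ℕ} (hl : 1 ≤ l) (hN : l + r ≤ N) :
    ascT N p l r (yN N (l - 1 + r)) = const N (p.sqrtT⁻¹ ^ r) * yN N (l - 1) := by
  induction r with
  | zero => simp
  | succ r ih =>
    rw [ascT_add]
    simp only [Module.End.mul_apply, ascT_one]
    rw [show l - 1 + (r + 1) = l + r by omega, heckeT_yN p (by omega) (by omega),
      ascT_mul p hl (by omega) (fun j _ _ => MidFixed.const _ _),
      show l + r - 1 = l - 1 + r by omega, ih (by omega), pow_succ, const_mul]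
    ring

end Indexed

/-! ### The recursion for the coefficients of `H` -/

section Coefficients

theorem poch_succ (x t : ℂ) (n : ℕ) : poch x t (n + 1) = poch x t n * (1 - x * t ^ n) := by
  rw [poch, prod_range_succ, poch]

theorem poch_ne_zero {x t : ℂ} {n : ℕ} (h : ∀ i < n, x * t ^ i ≠ 1) : poch x t n ≠ 0 :=
  prod_ne_zero_iff.2 fun i hi => sub_ne_zero.2 (h i (mem_range.1 hi)).symm

theorem poch_self_ne_zero {t : ℂ} {k n : ℕ} (htk : ∀ j, 1 ≤ j → j ≤ k → t ^ j ≠ 1) (hn : n ≤ k) :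
    poch t t n ≠ 0 :=
  poch_ne_zero fun i hi => by
    rw [← pow_succ']
    exact htk _ (by omega) (by omega)

/-- The `t`-exponential series `∑ t^{n(n-1)/2} (xw)ⁿ / (t;t)_n`. -/
def expBig (t x : ℂ) : PowerSeries ℂ :=
  PowerSeries.mk fun n => t ^ n.choose 2 * x ^ n / poch t t n

/-- The `t`-exponential series `∑ (xw)ⁿ / (t;t)_n`. -/
def expSmall (t x : ℂ) : PowerSeries ℂ :=
  PowerSeries.mk fun n => x ^ n / poch t t n

/-- The functional equation `e(w) = (1 + xw) e(tw)`, from `(t;t)ₙ₊₁ = (t;t)ₙ (1 - tⁿ⁺¹)`. It is only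
claimed modulo `X^(k+1)`, because `(t;t)ₙ` may vanish for `n > k`. -/
theorem X_pow_dvd_expBig {t : ℂ} {k : ℕ} (htk : ∀ j, 1 ≤ j → j ≤ k → t ^ j ≠ 1) (x : ℂ) :
    (PowerSeries.X ^ (k + 1) : PowerSeries ℂ) ∣
      expBig t x - (1 + PowerSeries.C x * PowerSeries.X) * PowerSeries.rescale t (expBig t x) := by
  rw [PowerSeries.X_pow_dvd_iff]
  intro n hn
  rw [add_mul, one_mul, mul_assoc]
  rcases n with _ | n
  · simp only [map_sub, map_add, PowerSeries.coeff_C_mul, PowerSeries.coeff_zero_X_mul,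
      PowerSeries.coeff_rescale, pow_zero]
    ring
  · simp only [map_sub, map_add, PowerSeries.coeff_C_mul, PowerSeries.coeff_succ_X_mul,
      PowerSeries.coeff_rescale, expBig, PowerSeries.coeff_mk]
    have h1 := poch_self_ne_zero htk (n := n + 1) (by omega)
    rw [poch_succ] at h1 ⊢
    have h2 := left_ne_zero_of_mul h1
    have h3 := right_ne_zero_of_mul h1
    have h4 : (n + 1).choose 2 = n + n.choose 2 := by
      rw [Nat.choose_succ_succ' n 1, Nat.choose_one_right]
    rw [h4]
    field_simp
    ring

theorem X_pow_dvd_expSmall {t : ℂ} {k : ℕ} (htk : ∀ j, 1 ≤ j → j ≤ k → t ^ j ≠ 1) (x : ℂ) :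
    (PowerSeries.X ^ (k + 1) : PowerSeries ℂ) ∣
      (1 - PowerSeries.C x * PowerSeries.X) * expSmall t x -
        PowerSeries.rescale t (expSmall t x) := by
  rw [PowerSeries.X_pow_dvd_iff]
  intro n hn
  rw [sub_mul, one_mul, mul_assoc]
  rcases n with _ | n
  · simp only [map_sub, PowerSeries.coeff_C_mul, PowerSeries.coeff_zero_X_mul,
      PowerSeries.coeff_rescale, pow_zero]
    ring
  · simp only [map_sub, PowerSeries.coeff_C_mul, PowerSeries.coeff_succ_X_mul,
      PowerSeries.coeff_rescale, expSmall, PowerSeries.coeff_mk]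
    have h1 := poch_self_ne_zero htk (n := n + 1) (by omega)
    rw [poch_succ] at h1 ⊢
    have h2 := left_ne_zero_of_mul h1
    have h3 := right_ne_zero_of_mul h1
    field_simp
    ring

/-- The generating series of `(abcd;t)_n h_n(a,b,c,d) / (t;t)_n`. -/
def hProduct (a b c d t : ℂ) : PowerSeries ℂ :=
  expBig t (a * c * d) * (expBig t (b * c * d) * (expSmall t (-d) * expSmall t (-c)))

theorem X_pow_dvd_hProduct {t : ℂ} {k : ℕ} (htk : ∀ j, 1 ≤ j → j ≤ k → t ^ j ≠ 1)
    (a b c d : ℂ) :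
    (PowerSeries.X ^ (k + 1) : PowerSeries ℂ) ∣
      (1 - PowerSeries.C (-c) * PowerSeries.X) * (1 - PowerSeries.C (-d) * PowerSeries.X) *
        hProduct a b c d t -
      (1 + PowerSeries.C (a * c * d) * PowerSeries.X) *
        (1 + PowerSeries.C (b * c * d) * PowerSeries.X) *
        PowerSeries.rescale t (hProduct a b c d t) := by
  have h := dvd_mul_sub_mul (X_pow_dvd_expBig htk (a * c * d))
    (dvd_mul_sub_mul (X_pow_dvd_expBig htk (b * c * d))
      (dvd_mul_sub_mul (X_pow_dvd_expSmall htk (-d)) (X_pow_dvd_expSmall htk (-c))))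
  convert h using 1
  simp only [hProduct, map_mul]
  ring

/-- The index `l` belongs to the factor with `-d` and `n-i-j-l` to the one with `-c`. Writing `acd =
a(-c)(-d)`, and likewise for `bcd`, collects the exponents `n-l` and `i+j+l`. -/
theorem coeff_hProduct (a b c d t : ℂ) (n : ℕ) :
    poch t t n * PowerSeries.coeff n (hProduct a b c d t) =
      ∑ x ∈ (range (n + 1) ×ˢ range (n + 1) ×ˢ range (n + 1)) with x.1 + x.2.1 + x.2.2 ≤ n,
        tMultinomial t n x.1 x.2.1 x.2.2 * t ^ (x.1.choose 2 + x.2.1.choose 2) *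
          a ^ x.1 * b ^ x.2.1 * (-c) ^ (n - x.2.2) * (-d) ^ (x.1 + x.2.1 + x.2.2) := by
  simp only [hProduct, PowerSeries.coeff_mul, mul_sum]
  simp only [Finset.sum_sigma']
  refine Finset.sum_bij' (fun x _ => (x.1.1, x.2.1.1, x.2.2.1))
    (fun x _ => ⟨(x.1, n - x.1), (x.2.1, n - x.1 - x.2.1), (x.2.2, n - x.1 - x.2.1 - x.2.2)⟩)
    ?_ ?_ ?_ ?_ ?_
  · rintro ⟨⟨i, i'⟩, ⟨j, j'⟩, ⟨l, l'⟩⟩ h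
    simp only [mem_sigma, HasAntidiagonal.mem_antidiagonal] at h
    simp only [mem_filter, mem_product, mem_range]
    omega
  · rintro ⟨i, j, l⟩ h
    simp only [mem_filter, mem_product, mem_range] at h
    simp only [mem_sigma, HasAntidiagonal.mem_antidiagonal]
    omega
  · rintro ⟨⟨i, i'⟩, ⟨j, j'⟩, ⟨l, l'⟩⟩ h
    simp only [mem_sigma, HasAntidiagonal.mem_antidiagonal] at h
    obtain ⟨rfl, rfl, rfl⟩ := h
    simp
  · rintro ⟨i, j, l⟩ h
    rfl
  · rintro ⟨⟨i, i'⟩, ⟨j, j'⟩, ⟨l, r⟩⟩ h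
    simp only [mem_sigma, HasAntidiagonal.mem_antidiagonal] at h
    obtain ⟨rfl, rfl, rfl⟩ := h
    have e1 : i + (j + (l + r)) - i - j - l = r := by omega
    have e2 : i + (j + (l + r)) - l = i + j + r := by omega
    simp only [expBig, expSmall, PowerSeries.coeff_mk, tMultinomial, e1, e2]
    have e3 : a * c * d = a * (-c) * (-d) := by ring
    have e4 : b * c * d = b * (-c) * (-d) := by ring
    rw [e3, e4]
    generalize -c = c
    generalize -d = d
    simp only [div_eq_mul_inv, mul_inv]
    ring

/-- The rescaled coefficients `(abcd;t)_n h_n(a,b,c,d)`. -/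
def gCoeff (a b c d t : ℂ) (n : ℕ) : ℂ :=
  poch t t n * PowerSeries.coeff n (hProduct a b c d t)

theorem hCoeff_eq (a b c d t : ℂ) (n : ℕ) :
    hCoeff a b c d t n = (poch (a * b * c * d) t n)⁻¹ * gCoeff a b c d t n := by
  rw [hCoeff, gCoeff, coeff_hProduct]

theorem gCoeff_zero (a b c d t : ℂ) : gCoeff a b c d t 0 = 1 := by
  simp [gCoeff, hProduct, poch, expBig, expSmall, PowerSeries.coeff_mul]

theorem hCoeff_zero (a b c d t : ℂ) : hCoeff a b c d t 0 = 1 := by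
  simp [hCoeff_eq, gCoeff_zero, poch]

/-- Compares the coefficients of `wⁿ⁺¹` in `(1+cw)(1+dw)P(w) = (1+acdw)(1+bcdw)P(tw)` and multiplies
by `(t;t)ₙ`. -/
theorem gCoeff_rec {t : ℂ} {k : ℕ} (htk : ∀ j, 1 ≤ j → j ≤ k → t ^ j ≠ 1) (a b c d : ℂ) {n : ℕ}
    (hn : n < k) :
    gCoeff a b c d t (n + 1) + ((c + d) - c * d * (a + b) * t ^ n) * gCoeff a b c d t n +
      c * d * (1 - t ^ n) * (1 - a * b * c * d * t ^ (n - 1)) * gCoeff a b c d t (n - 1) = 0 := by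
  have h := PowerSeries.X_pow_dvd_iff.1 (X_pow_dvd_hProduct htk a b c d) (n + 1) (by omega)
  have key : ∀ (x y : ℂ) (f : PowerSeries ℂ),
      (1 + PowerSeries.C x * PowerSeries.X) * (1 + PowerSeries.C y * PowerSeries.X) * f =
        f + PowerSeries.C x * (PowerSeries.X * f) + PowerSeries.C y * (PowerSeries.X * f) +
          PowerSeries.C x * (PowerSeries.C y * (PowerSeries.X * (PowerSeries.X * f))) := by
    intro x y f
    ring
  have key' : ∀ (x y : ℂ) (f : PowerSeries ℂ),
      (1 - PowerSeries.C (-x) * PowerSeries.X) * (1 - PowerSeries.C (-y) * PowerSeries.X) * f =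
        (1 + PowerSeries.C x * PowerSeries.X) * (1 + PowerSeries.C y * PowerSeries.X) * f := by
    intro x y f
    simp only [map_neg]
    ring
  rw [key', key, key] at h
  -- For `n = 0` the series has no two-step term; the truncated index `n - 1 = 0` is harmless
  -- because its factor `1 - t⁰` vanishes.
  rcases n with _ | n
  · simp only [map_sub, map_add, PowerSeries.coeff_C_mul, PowerSeries.coeff_succ_X_mul,
      PowerSeries.coeff_rescale, PowerSeries.coeff_zero_X_mul] at h
    simp only [gCoeff, poch_succ]
    simp only [poch, range_zero, prod_empty]
    linear_combination h
  · simp only [map_sub, map_add, PowerSeries.coeff_C_mul, PowerSeries.coeff_succ_X_mul,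
      PowerSeries.coeff_rescale] at h
    simp only [gCoeff, poch_succ, Nat.add_sub_cancel]
    linear_combination (poch t t n * (1 - t * t ^ n)) * h

theorem hCoeff_threeTermRec {t : ℂ} {k : ℕ} (htk : ∀ j, 1 ≤ j → j ≤ k → t ^ j ≠ 1)
    {a b c d : ℂ} (hc : c ≠ 0) (hd : d ≠ 0) (hden : ∀ j < k, a * b * c * d * t ^ j ≠ 1) :
    ThreeTermRec a b c d t k (hCoeff a b c d t) := by
  intro n hn
  have h := gCoeff_rec htk a b c d hn
  have h1 : poch (a * b * c * d) t (n + 1) ≠ 0 := poch_ne_zero fun i hi => hden i (by omega)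
  have e : t ^ n * a * b - c⁻¹ * d⁻¹ = -(1 - a * b * c * d * t ^ n) * (c⁻¹ * d⁻¹) := by
    field_simp
    ring
  rw [e]
  simp only [hCoeff_eq]
  rcases n with _ | n
  · rw [poch_succ] at h1 ⊢
    have h2 := left_ne_zero_of_mul h1
    have h3 := right_ne_zero_of_mul h1
    simp only [pow_zero, sub_self, zero_mul, mul_zero, add_zero, mul_one, one_mul] at h h3 ⊢
    generalize 1 - a * b * c * d = x at h3 ⊢
    generalize poch (a * b * c * d) t 0 = w at h2 ⊢
    field_simp
    linear_combination (-1 : ℂ) * h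
  · rw [poch_succ, poch_succ] at h1 ⊢
    have h2 := left_ne_zero_of_mul (left_ne_zero_of_mul h1)
    have h3 := right_ne_zero_of_mul (left_ne_zero_of_mul h1)
    have h4 := right_ne_zero_of_mul h1
    simp only [Nat.add_sub_cancel] at h ⊢
    generalize 1 - a * b * c * d * t ^ n = x at h3 h ⊢
    generalize 1 - a * b * c * d * t ^ (n + 1) = y at h4 ⊢
    generalize poch (a * b * c * d) t n = w at h2 ⊢
    field_simp
    linear_combination (-1 : ℂ) * h

theorem threeTermRec_iff {t : ℂ} {k : ℕ} (htk : ∀ j, 1 ≤ j → j ≤ k → t ^ j ≠ 1)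
    {a b c d : ℂ} (hc : c ≠ 0) (hd : d ≠ 0) (hden : ∀ j < k, a * b * c * d * t ^ j ≠ 1)
    (h : ℕ → ℂ) :
    (h 0 = 1 ∧ ThreeTermRec a b c d t k h) ↔ ∀ n ≤ k, h n = hCoeff a b c d t n := by
  have hr := hCoeff_threeTermRec htk hc hd hden
  constructor
  · rintro ⟨h0, h1⟩ n
    induction n using Nat.strong_induction_on with
    | _ n ih =>
      intro hn
      rcases n with _ | n
      · rw [h0, hCoeff_zero]
      · have e1 := h1 n (by omega)
        rw [ih n (by omega) (by omega), ih (n - 1) (by omega) (by omega)] at e1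
        have e2 := hr n (by omega)
        -- The leading coefficient is `-(1 - abcd tⁿ)/(cd)`, so each step of the recursion
        -- determines the next term.
        have h3 : t ^ n * a * b - c⁻¹ * d⁻¹ ≠ 0 := by
          intro h3
          apply hden n (by omega)
          field_simp at h3
          linear_combination h3
        apply mul_left_cancel₀ h3
        linear_combination e1 - e2
  · intro hh
    refine ⟨by rw [hh 0 (by omega), hCoeff_zero], fun n hn => ?_⟩
    rw [hh (n + 1) (by omega), hh n (by omega), hh (n - 1) (by omega)]
    exact hr n hn

theorem alSalamChiharaRec_of_sq {t : ℂ} {k : ℕ} (htk : ∀ j, 1 ≤ j → j ≤ k → t ^ j ≠ 1)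
    {a b c d : ℂ} (hc : c ≠ 0) (hd : d ≠ 0) (hden : ∀ j < k, a * b * c * d * t ^ j ≠ 1)
    {s : ℂ} (hs : s ^ 2 = c * d) :
    AlSalamChiharaRec ((c + d) / (2 * s)) (s * a) (s * b) t k
      fun n => (-1) ^ n * (s ^ n)⁻¹ * poch (a * b * c * d) t n * hCoeff a b c d t n := by
  have hs0 : s ≠ 0 := by
    rintro rfl
    simp [hc, hd] at hs
  have hQ : ∀ n ≤ k, (-1) ^ n * (s ^ n)⁻¹ * poch (a * b * c * d) t n * hCoeff a b c d t n =
      (-1) ^ n * (s ^ n)⁻¹ * gCoeff a b c d t n := by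
    intro n hn
    have h1 : poch (a * b * c * d) t n ≠ 0 := poch_ne_zero fun i hi => hden i (by omega)
    rw [hCoeff_eq]
    field_simp
  intro n hn
  have h := gCoeff_rec htk a b c d hn
  have e : s * a * (s * b) = a * b * c * d := by linear_combination (a * b) * hs
  simp only [hQ n (by omega), hQ (n + 1) (by omega), hQ (n - 1) (by omega), e]
  have hu : s⁻¹ * s = 1 := inv_mul_cancel₀ hs0
  have e2 : 2 * ((c + d) / (2 * s)) = (c + d) * s⁻¹ := by field_simp
  rw [← hs] at h
  rw [e2]
  simp only [← inv_pow]
  generalize s⁻¹ = u at hu ⊢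
  rcases n with _ | n
  · linear_combination -u * h - (a + b) * s * gCoeff a b c d t 0 * hu
  · simp only [Nat.add_sub_cancel] at h ⊢
    linear_combination (-1) ^ n * u ^ (n + 2) * h +
      (a + b) * t ^ (n + 1) * (-1) ^ n * u ^ (n + 1) * s * gCoeff a b c d t (n + 1) * hu -
      (1 - t ^ (n + 1)) * (1 - a * b * c * d * t ^ n) * (-1) ^ n * u ^ n *
        gCoeff a b c d t n * (u * s + 1) * hu

end Coefficients

/-! ### Generating functions of elementary symmetric polynomials -/

section Generating

variable {N : ℕ} {a b c d t : ℂ}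

-- Turns an identity of generating functions, known for every complex value of the auxiliary
-- variable, into one for each coefficient. `L` is only `ℂ`-linear, so it is applied coefficientwise
-- to form `F`; `F` and `g` agree at infinitely many points of a domain.
open Polynomial in
theorem apply_coeff_of_eval (L : Module.End ℂ (Laurent N)) (f g : (Laurent N)[X])
    (h : ∀ v : ℂ, L (f.eval (const N v)) = g.eval (const N v)) (n : ℕ) :
    L (f.coeff n) = g.coeff n := by
  set F : (Laurent N)[X] := ∑ i ∈ range (f.natDegree + 1), monomial i (L (f.coeff i)) with hF
  have h1 : ∀ v : ℂ, F.eval (const N v) = g.eval (const N v) := by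
    intro v
    rw [← h, eval_eq_sum_range (p := f), map_sum, hF, eval_finsetSum]
    refine sum_congr rfl fun i _ => ?_
    rw [eval_monomial, ← map_pow, mul_comm, ← const_smul_eq, mul_comm (f.coeff i),
      ← const_smul_eq, map_smul]
  have h2 : F = g := by
    refine eq_of_infinite_eval_eq F g (Set.Infinite.mono (s := Set.range (algebraMap ℂ (Laurent N)))
      ?_ (Set.infinite_range_of_injective (algebraMap ℂ (Laurent N)).injective))
    rintro _ ⟨v, rfl⟩
    exact h1 v
  rw [← h2, hF, finsetSum_coeff]
  simp only [coeff_monomial]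
  rw [Finset.sum_ite_eq']
  split_ifs with hn
  · rfl
  · rw [coeff_eq_zero_of_natDegree_lt (by simpa using hn), map_zero]

/-- `∏_{l ≤ i < k} (X + z_{i+1}⁻¹)`. -/
def genY (N l k : ℕ) : Polynomial (Laurent N) :=
  ∏ i ∈ Ico l k, (Polynomial.X + Polynomial.C (yN N i))

/-- The elementary symmetric polynomial of degree `k - l - n` in `z_{i+1}⁻¹`, `l ≤ i < k`. -/
def elemY (N l k n : ℕ) : Laurent N := (genY N l k).coeff n

theorem eval_genY (l k : ℕ) (v : ℂ) :
    (genY N l k).eval (const N v) = ∏ i ∈ Ico l k, (const N v + yN N i) := by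
  simp [genY, Polynomial.eval_prod]

theorem natDegree_genY_le (l k : ℕ) : (genY N l k).natDegree ≤ k - l := by
  refine (Polynomial.natDegree_prod_le _ _).trans ?_
  simp

theorem elemY_eq_zero {l k n : ℕ} (h : k - l < n) : elemY N l k n = 0 :=
  Polynomial.coeff_eq_zero_of_natDegree_lt ((natDegree_genY_le l k).trans_lt h)

theorem algHom_elemY (σ : Laurent N →ₐ[ℂ] Laurent N) {l k : ℕ}
    (h : ∀ i, l ≤ i → i < k → σ (yN N i) = yN N i) (n : ℕ) :
    σ (elemY N l k n) = elemY N l k n := by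
  refine apply_coeff_of_eval σ.toLinearMap _ _ (fun v => ?_) n
  rw [eval_genY, AlgHom.toLinearMap_apply, map_prod]
  refine prod_congr rfl fun i hi => ?_
  rw [map_add, AlgHom.commutes, h i (mem_Ico.1 hi).1 (mem_Ico.1 hi).2]

theorem midFixed_elemY {j l k : ℕ} (h : j < l ∨ k < j) (n : ℕ) :
    MidFixed j (elemY N l k n) := fun hj =>
  algHom_elemY _ (fun i h1 h2 => midFixed_yN (by omega) (by omega) hj) n

theorem midFixed_elemY_of_lt {j l k : ℕ} (h1 : l < j) (h2 : j < k) (n : ℕ) :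
    MidFixed j (elemY N l k n) := fun hj => by
  refine apply_coeff_of_eval (swapHom _ _).toLinearMap _ _ (fun v => ?_) n
  rw [eval_genY, AlgHom.toLinearMap_apply,
    ← mul_prod_erase _ _ (mem_Ico.2 ⟨by omega, by omega⟩ : j - 1 ∈ Ico l k),
    ← mul_prod_erase _ _ (mem_erase.2 ⟨by omega, mem_Ico.2 ⟨by omega, by omega⟩⟩ :
      j ∈ (Ico l k).erase (j - 1)), ← mul_assoc]
  refine (MidFixed.mul (midFixed_mul_yN (by omega) v) (MidFixed.prod fun i hi => ?_)) hj
  simp only [mem_erase, mem_Ico] at hi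
  exact (MidFixed.const _ _).add (midFixed_yN (by omega) (by omega))

theorem const_pow (r : ℂ) (n : ℕ) : const N (r ^ n) = const N r ^ n := map_pow _ r n

theorem sqrtT_inv_mul (p : NoumiParams a b c d t) (ht : t ≠ 0) :
    const N p.sqrtT⁻¹ * const N t = const N p.sqrtT := by
  have h := p.sqrtT_ne_zero ht
  have h2 := p.sqrtT_sq
  rw [← const_mul]
  congr 1
  field_simp
  exact h2.symm

/-- Source of the rule `v ↦ tv`: constants are scaled by `t^{1/2}`, the inverse variable by
`t^{-1/2}`, and the common factor `t^{-1/2}` is pulled out. -/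
theorem heckeT_const_add_yN (p : NoumiParams a b c d t) (ht : t ≠ 0) {l : ℕ} (hl : 1 ≤ l)
    (hN : l < N) (v : ℂ) :
    heckeT p l (const N v + yN N l) =
      const N p.sqrtT⁻¹ * (const N (t * v) + yN N (l - 1)) := by
  rw [map_add, heckeT_yN p hl hN, heckeT_of_fixed p hl hN (MidFixed.const _ _), const_mul,
    ← sqrtT_inv_mul p ht]
  ring

theorem midFixed_prod {j l k : ℕ} (h : j < l ∨ k < j) (v : ℂ) :
    MidFixed j (∏ i ∈ Ico l k, (const N v + yN N i)) :=
  MidFixed.prod fun i hi => by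
    rw [mem_Ico] at hi
    exact (MidFixed.const _ _).add (midFixed_yN (by omega) (by omega))

/-- At each stage a single factor meets the next generator; all the others are symmetric for it and
pass through. -/
theorem descT_prod (p : NoumiParams a b c d t) (ht : t ≠ 0) {r j : ℕ} (hj : j ≤ r)
    (hN : r < N) (v : ℂ) :
    descT N p 1 j (∏ i ∈ Ico 1 (r + 1), (const N v + yN N i)) =
      const N (p.sqrtT⁻¹ ^ j) * ((∏ i ∈ Ico 0 j, (const N (t * v) + yN N i)) *
        ∏ i ∈ Ico (j + 1) (r + 1), (const N v + yN N i)) := by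
  induction j with
  | zero => simp
  | succ j ih =>
    rw [descT_add, Module.End.mul_apply, ih (by omega), descT_one, add_comm 1 j,
      Finset.prod_eq_prod_Ico_succ_bot (by omega : j + 1 < r + 1),
      Finset.prod_Ico_succ_top (Nat.zero_le j)]
    have e : const N (p.sqrtT⁻¹ ^ j) * ((∏ i ∈ Ico 0 j, (const N (t * v) + yN N i)) *
        ((const N v + yN N (j + 1)) * ∏ i ∈ Ico (j + 1 + 1) (r + 1), (const N v + yN N i))) =
        (const N (p.sqrtT⁻¹ ^ j) * ((∏ i ∈ Ico 0 j, (const N (t * v) + yN N i)) *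
          ∏ i ∈ Ico (j + 1 + 1) (r + 1), (const N v + yN N i))) *
        (const N v + yN N (j + 1)) := by ring
    rw [e, heckeT_mul p (by omega) (by omega) ((MidFixed.const _ _).mul
      ((midFixed_prod (by omega) _).mul (midFixed_prod (by omega) _))),
      heckeT_const_add_yN p ht (by omega) (by omega), pow_succ, const_mul (p.sqrtT⁻¹ ^ j), Nat.add_sub_cancel]
    ring

/-- The difference of the two products accumulates the constants created when a variable passes an
inverse variable. The factor `v` on the left avoids dividing that difference by `v`. -/
theorem descT_zN_mul_prod (p : NoumiParams a b c d t) (ht : t ≠ 0) {r j : ℕ} (hj : j ≤ r)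
    (hN : r < N) (v : ℂ) :
    descT N p 1 j (const N v * zN N 0 * ∏ i ∈ Ico 1 (r + 1), (const N v + yN N i)) =
      const N (p.sqrtT⁻¹ ^ j) *
        ((const N v * zN N j * (∏ i ∈ Ico 0 j, (const N v + yN N i)) +
          (∏ i ∈ Ico 0 j, (const N v + yN N i)) - ∏ i ∈ Ico 0 j, (const N (t * v) + yN N i)) *
        ∏ i ∈ Ico (j + 1) (r + 1), (const N v + yN N i)) := by
  induction j with
  | zero => simp
  | succ j ih =>
    rw [descT_add, Module.End.mul_apply, ih (by omega), descT_one, add_comm 1 j,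
      Finset.prod_eq_prod_Ico_succ_bot (by omega : j + 1 < r + 1),
      Finset.prod_Ico_succ_top (Nat.zero_le j), Finset.prod_Ico_succ_top (Nat.zero_le j)]
    have hU : MidFixed (j + 1) (∏ i ∈ Ico 0 j, (const N v + yN N i)) :=
      midFixed_prod (by omega) _
    have hW : MidFixed (j + 1) (∏ i ∈ Ico 0 j, (const N (t * v) + yN N i)) :=
      midFixed_prod (by omega) _
    have hR : MidFixed (j + 1) (∏ i ∈ Ico (j + 1 + 1) (r + 1), (const N v + yN N i)) :=
      midFixed_prod (by omega) _
    generalize (∏ i ∈ Ico 0 j, (const N v + yN N i)) = U at hU ⊢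
    generalize (∏ i ∈ Ico 0 j, (const N (t * v) + yN N i)) = W at hW ⊢
    generalize (∏ i ∈ Ico (j + 1 + 1) (r + 1), (const N v + yN N i)) = R at hR ⊢
    have e : const N (p.sqrtT⁻¹ ^ j) * ((const N v * zN N j * U + U - W) *
        ((const N v + yN N (j + 1)) * R)) =
        (const N (p.sqrtT⁻¹ ^ j) * const N v * U * R * const N v) * zN N j +
        (const N (p.sqrtT⁻¹ ^ j) * const N v * U * R) * (zN N j * yN N (j + 1)) +
        (const N (p.sqrtT⁻¹ ^ j) * (U + const N (-1) * W) * R) * (const N v + yN N (j + 1)) := by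
      simp only [map_neg, map_one]
      ring
    have hC := fun x => MidFixed.const (N := N) (j + 1) x
    have hz := heckeT_zN (N := N) p (l := j + 1) (by omega) (by omega)
    have hzy := heckeT_zN_mul_yN (N := N) p (l := j + 1) (by omega) (by omega)
    have hy := heckeT_const_add_yN (N := N) p ht (l := j + 1) (by omega) (by omega) v
    rw [Nat.add_sub_cancel] at hz hzy hy
    rw [e, map_add, map_add,
      heckeT_mul p (by omega) (by omega) (((((hC _).mul (hC _)).mul hU).mul hR).mul (hC _)),
      heckeT_mul p (by omega) (by omega) ((((hC _).mul (hC _)).mul hU).mul hR),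
      heckeT_mul p (by omega) (by omega) (((hC _).mul (hU.add ((hC _).mul hW))).mul hR),
      hz, hzy, hy, pow_succ, const_mul (p.sqrtT⁻¹ ^ j)]
    simp only [const_mul t v, map_sub, map_neg, map_one, ← sqrtT_inv_mul (N := N) p ht]
    ring

open Polynomial in
theorem descT_elemY (p : NoumiParams a b c d t) (ht : t ≠ 0) {r : ℕ} (hN : r < N) (n : ℕ) :
    descT N p 1 r (elemY N 1 (r + 1) n) =
      const N (p.sqrtT⁻¹ ^ r) * (const N (t ^ n) * elemY N 0 r n) := by
  have h := apply_coeff_of_eval (descT N p 1 r) (genY N 1 (r + 1))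
    (C (const N (p.sqrtT⁻¹ ^ r)) * (genY N 0 r).comp (C (const N t) * X)) (fun v => by
      rw [eval_genY, descT_prod p ht le_rfl hN]
      simp only [eval_mul, eval_C, eval_comp, eval_X, ← const_mul, eval_genY, Ico_self,
        prod_empty, mul_one]) n
  rw [elemY, h, coeff_C_mul, comp_C_mul_X_coeff, elemY, const_pow t]
  ring

-- The shift from `n` to `n+1` in the correction comes from the factor `v` in `descT_zN_mul_prod`;
-- the factor `1 - tⁿ⁺¹` comes from subtracting the product at `tv` from the one at `v`.
open Polynomial in
theorem descT_zN_mul_elemY (p : NoumiParams a b c d t) (ht : t ≠ 0) {r : ℕ} (hN : r < N)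
    (n : ℕ) :
    descT N p 1 r (zN N 0 * elemY N 1 (r + 1) n) =
      const N (p.sqrtT⁻¹ ^ r) * (zN N r * elemY N 0 r n +
        (1 - const N (t ^ (n + 1))) * elemY N 0 r (n + 1)) := by
  have h := apply_coeff_of_eval (descT N p 1 r) (X * (C (zN N 0) * genY N 1 (r + 1)))
    (C (const N (p.sqrtT⁻¹ ^ r)) * (X * (C (zN N r) * genY N 0 r) + genY N 0 r -
      (genY N 0 r).comp (C (const N t) * X))) (fun v => by
      rw [eval_mul, eval_mul, eval_genY, eval_X, eval_C, ← mul_assoc,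
        descT_zN_mul_prod p ht le_rfl hN]
      simp only [eval_mul, eval_add, eval_sub, eval_C, eval_comp, eval_X, ← const_mul, eval_genY,
        Ico_self, prod_empty, mul_one, mul_assoc]) (n + 1)
  rw [coeff_X_mul, coeff_C_mul, coeff_C_mul, coeff_sub, coeff_add, coeff_X_mul, coeff_C_mul,
    comp_C_mul_X_coeff] at h
  rw [elemY, h, elemY, elemY, const_pow t]
  ring

/-- `∑_n h_n e_{k-n}(z_1⁻¹, …, z_k⁻¹)`. -/
def elemSum (N k : ℕ) (h : ℕ → ℂ) : Laurent N :=
  ∑ n ∈ range (k + 1), const N (h n) * elemY N 0 k n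

theorem sum_coeff_X_add_C_mul (h : ℕ → ℂ) (y : Laurent N) (Q : Polynomial (Laurent N)) {r : ℕ}
    (hQ : Q.natDegree ≤ r) :
    ∑ n ∈ range (r + 1 + 1), const N (h n) *
      ((Polynomial.X + Polynomial.C y) * Q).coeff n =
    ∑ n ∈ range (r + 1), (const N (h (n + 1)) + const N (h n) * y) * Q.coeff n := by
  simp only [add_mul, Polynomial.coeff_add, Polynomial.coeff_C_mul, mul_add, sum_add_distrib]
  congr 1
  · rw [sum_range_succ']
    simp [Polynomial.coeff_X_mul]
  · rw [sum_range_succ, Polynomial.coeff_eq_zero_of_natDegree_lt (n := r + 1) (by omega)]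
    simp [mul_assoc]

/-- The sum has degree at most one in `z₁⁻¹`; isolating this variable reduces `T₀` to its values on
`1` and `z₁⁻¹`. The companion `elemSum_eq_last` isolates `z_k⁻¹` to recognise the sum again. -/
theorem elemSum_eq_first (r : ℕ) (h : ℕ → ℂ) :
    elemSum N (r + 1) h =
      ∑ n ∈ range (r + 1), (const N (h (n + 1)) + const N (h n) * yN N 0) *
        elemY N 1 (r + 1) n := by
  have e : genY N 0 (r + 1) = (Polynomial.X + Polynomial.C (yN N 0)) * genY N 1 (r + 1) := by
    rw [genY, Finset.prod_eq_prod_Ico_succ_bot (by omega)]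
    rfl
  simp only [elemSum, elemY, e]
  exact sum_coeff_X_add_C_mul h _ _ ((natDegree_genY_le _ _).trans (by omega))

theorem elemSum_eq_last (r : ℕ) (h : ℕ → ℂ) :
    elemSum N (r + 1) h =
      ∑ n ∈ range (r + 1), (const N (h (n + 1)) + const N (h n) * yN N r) *
        elemY N 0 r n := by
  have e : genY N 0 (r + 1) = (Polynomial.X + Polynomial.C (yN N r)) * genY N 0 r := by
    rw [genY, Finset.prod_Ico_succ_top (by omega), mul_comm]
    rfl
  simp only [elemSum, elemY, e]
  exact sum_coeff_X_add_C_mul h _ _ ((natDegree_genY_le _ _).trans (by omega))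

theorem midFixed_elemSum {j k : ℕ} (hj : 1 ≤ j) (hjk : j ≠ k) (h : ℕ → ℂ) :
    MidFixed j (elemSum N k h) := fun hN => by
  rw [elemSum, map_sum]
  refine sum_congr rfl fun n _ => ?_
  refine MidFixed.mul (MidFixed.const _ _) ?_ hN
  rcases lt_or_gt_of_ne hjk with h1 | h1
  · exact midFixed_elemY_of_lt (by omega) h1 n
  · exact midFixed_elemY (by omega) n

end Generating

/-! ### The eigenfunction property -/

section Eigenfunction

variable {N : ℕ} {a b c d t : ℂ}

theorem const_add (r s : ℂ) : const N (r + s) = const N r + const N s := map_add _ r s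

theorem const_sub (r s : ℂ) : const N (r - s) = const N r - const N s := map_sub _ r s

theorem map_const_mul (L : Module.End ℂ (Laurent N)) (x : ℂ) (f : Laurent N) :
    L (const N x * f) = const N x * L f := by
  rw [← const_smul_eq, map_smul, const_smul_eq]

theorem invHom_yN_of_ne {l i : ℕ} (hl : l < N) (r : ℂ) (hr : r ≠ 0) (h : i ≠ l) :
    invHom ⟨l, hl⟩ r hr (yN N i) = yN N i := by
  by_cases hi : i < N
  · simp only [yN, hi, dif_pos]
    exact invHom_zvar_inv_of_ne r hr (by simpa [Fin.ext_iff] using h)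
  · simp [yN, hi]

theorem heckeT_zero_elemSum (p : NoumiParams a b c d t) (ha : a ≠ 0) (hb : b ≠ 0) {r : ℕ}
    (hN : r < N) (h : ℕ → ℂ) :
    heckeT p 0 (elemSum N (r + 1) h) = const N (p.q⁻¹ * p.sqrtT0⁻¹) *
      ∑ n ∈ range (r + 1), (const N (h n) * (zN N 0 * elemY N 1 (r + 1) n) +
        const N (-(a * b) * h (n + 1) - (a + b) * h n) * elemY N 1 (r + 1) n) := by
  have h0 : 0 < N := by omega
  have h2 : p.sqrtT0 = p.q⁻¹ * p.sqrtT0⁻¹ * (-(a * b)) := by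
    have h0 := p.sqrtT0_ne_zero ha hb
    have hq := p.q_ne_zero
    have := p.sqrtT0_sq
    field_simp at this ⊢
    linear_combination this
  have h2' : const N p.sqrtT0 = const N (p.q⁻¹ * p.sqrtT0⁻¹) * const N (-(a * b)) := by
    rw [← const_mul, ← h2]
  rw [elemSum_eq_first, map_sum, mul_sum, heckeT_zero p h0]
  refine sum_congr rfl fun n _ => ?_
  have he : invHom ⟨0, h0⟩ p.q p.q_ne_zero (elemY N 1 (r + 1) n) = elemY N 1 (r + 1) n :=
    algHom_elemY _ (fun i h1 _ => invHom_yN_of_ne h0 _ _ (by omega)) n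
  generalize elemY N 1 (r + 1) n = e at he ⊢
  have h3 := heckeFirst_zvar_inv p ha hb (⟨0, h0⟩ : Fin N)
  have e1 : (const N (h (n + 1)) + const N (h n) * yN N 0) * e =
      const N (h (n + 1)) * e + const N (h n) * (e * yN N 0) := by ring
  rw [e1, map_add, map_const_mul, map_const_mul, heckeFirst_mul p _ he, heckeFirst_of_fixed p _ he,
    show yN N 0 = (((zvar ⟨0, h0⟩)⁻¹ : (Laurent N)ˣ) : Laurent N) by simp [yN, h0], h3,
    show zN N 0 = ((zvar ⟨0, h0⟩ : (Laurent N)ˣ) : Laurent N) by simp [zN, h0], h2']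
  simp only [map_sub, map_add, const_mul (-(a * b)), const_mul (a + b)]
  ring

/-- The one place where the recursion enters the eigenvalue computation: it exchanges `a, b` for
`c'⁻¹, d'⁻¹`. -/
theorem descT_sum (p : NoumiParams a b c d t) (ht : t ≠ 0) {r : ℕ} (hN : r < N) {c' d' : ℂ}
    {h : ℕ → ℂ} (hh : ThreeTermRec a b c' d' t (r + 1) h) :
    descT N p 1 r (∑ n ∈ range (r + 1), (const N (h n) * (zN N 0 * elemY N 1 (r + 1) n) +
        const N (-(a * b) * h (n + 1) - (a + b) * h n) * elemY N 1 (r + 1) n)) =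
      const N (p.sqrtT⁻¹ ^ r) * ∑ n ∈ range (r + 1), (const N (h n) * zN N r +
        const N (-(c'⁻¹ * d'⁻¹) * h (n + 1) - (c'⁻¹ + d'⁻¹) * h n)) * elemY N 0 r n := by
  -- Shift of summation index: the top term vanishes by degree, the new bottom term because `1 - t⁰
  -- = 0`.
  have key : ∑ n ∈ range (r + 1), const N (h n) *
      ((1 - const N (t ^ (n + 1))) * elemY N 0 r (n + 1)) =
      ∑ n ∈ range (r + 1), const N (h (n - 1)) * ((1 - const N (t ^ n)) * elemY N 0 r n) := by
    rw [sum_range_succ, elemY_eq_zero (by omega : r - 0 < r + 1), sum_range_succ']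
    simp
  have step : ∀ n, descT N p 1 r (const N (h n) * (zN N 0 * elemY N 1 (r + 1) n) +
        const N (-(a * b) * h (n + 1) - (a + b) * h n) * elemY N 1 (r + 1) n) =
      const N (p.sqrtT⁻¹ ^ r) * ((const N (h n) * zN N r * elemY N 0 r n +
        const N (-(a * b) * h (n + 1) - (a + b) * h n) * (const N (t ^ n) * elemY N 0 r n)) +
        const N (h n) * ((1 - const N (t ^ (n + 1))) * elemY N 0 r (n + 1))) := by
    intro n
    rw [map_add, map_const_mul, map_const_mul, descT_elemY p ht hN, descT_zN_mul_elemY p ht hN]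
    ring
  rw [map_sum, sum_congr rfl fun n _ => step n, ← mul_sum, sum_add_distrib, key,
    ← sum_add_distrib]
  congr 1
  refine sum_congr rfl fun n hn => ?_
  have e : -(c'⁻¹ * d'⁻¹) * h (n + 1) - (c'⁻¹ + d'⁻¹) * h n =
      (-(a * b) * h (n + 1) - (a + b) * h n) * t ^ n + h (n - 1) * (1 - t ^ n) := by
    linear_combination hh n (mem_range.1 hn)
  rw [e, const_add, const_mul _ (t ^ n), const_mul (h (n - 1)), const_sub 1 (t ^ n),
    show const N 1 = (1 : Laurent N) from map_one _]
  ring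

/-- The variable gains `t^{-m/2}` on the way out, and its inverse the same on the way back, hence
`t^{-m}`; a constant gains `tᵐ` in total. The constant `-(c+d)x` born at `T_N` gains and loses
`t^{m/2}`. -/
theorem ascT_last_descT (p : NoumiParams a b c d t) (ht : t ≠ 0) (hc : c ≠ 0) (hd : d ≠ 0)
    {r m : ℕ} (hN : N = r + 1 + m) (x y : ℂ) (n : ℕ) :
    ascT N p (r + 1) m (heckeT p N (descT N p (r + 1) m
      ((const N x * zN N r + const N y) * elemY N 0 r n))) =
    (const N (p.sqrtTN⁻¹ * (t ^ m)⁻¹ * x) * yN N r +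
      const N (p.sqrtTN * t ^ m * y - p.sqrtTN⁻¹ * (c + d) * x)) * elemY N 0 r n := by
  have hl : N - 1 < N := by omega
  have he : ∀ j, r + 1 ≤ j → j < r + 1 + m → MidFixed j (elemY N 0 r n) :=
    fun j h1 _ => midFixed_elemY (by omega) n
  have hL : invHom ⟨N - 1, hl⟩ 1 one_ne_zero (elemY N 0 r n) = elemY N 0 r n :=
    algHom_elemY _ (fun i _ h2 => invHom_yN_of_ne hl _ _ (by omega)) n
  have hL1 : invHom ⟨N - 1, hl⟩ 1 one_ne_zero (1 : Laurent N) = 1 := map_one _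
  generalize elemY N 0 r n = e at he hL ⊢
  have e1 : (const N x * zN N r + const N y) * e =
      const N x * (e * zN N r) + const N y * (e * 1) := by ring
  have hz := descT_zN (N := N) p (l := r + 1) (r := m) (by omega) (by omega)
  have hy := ascT_yN (N := N) p (l := r + 1) (r := m) (by omega) (by omega)
  rw [Nat.add_sub_cancel, show r + m = N - 1 by omega] at hz hy
  have h1 := descT_of_fixed (N := N) p (l := r + 1) (r := m) (by omega) (by omega)
    (g := 1) (fun j _ _ => MidFixed.one j)
  have h1' := ascT_of_fixed (N := N) p (l := r + 1) (r := m) (by omega) (by omega)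
    (g := 1) (fun j _ _ => MidFixed.one j)
  have hlast := heckeLast_zvar p hc hd (⟨N - 1, hl⟩ : Fin N)
  rw [← show zN N (N - 1) = ((zvar ⟨N - 1, hl⟩ : (Laurent N)ˣ) : Laurent N) by simp [zN, hl],
    ← show yN N (N - 1) = (((zvar ⟨N - 1, hl⟩)⁻¹ : (Laurent N)ˣ) : Laurent N) by simp [yN, hl]]
    at hlast
  rw [e1, map_add, map_const_mul, map_const_mul, descT_mul p (by omega) (by omega) he,
    descT_mul p (by omega) (by omega) he, hz, h1, heckeT_last p (by omega), map_add,
    map_const_mul, map_const_mul, heckeLast_mul p _ hL, heckeLast_mul p _ hL, map_const_mul,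
    map_const_mul, heckeLast_of_fixed p _ hL1, hlast,
    show e * (const N (p.sqrtT⁻¹ ^ m) * (const N p.sqrtTN⁻¹ * (yN N (N - 1) - const N (c + d)))) =
      const N (p.sqrtT⁻¹ ^ m * p.sqrtTN⁻¹) * (e * yN N (N - 1)) +
        const N (-(p.sqrtT⁻¹ ^ m * p.sqrtTN⁻¹ * (c + d))) * (e * 1) by
      simp only [const_mul, map_neg]; ring,
    show e * (const N (p.sqrtT ^ m) * (const N p.sqrtTN * 1)) =
      const N (p.sqrtT ^ m * p.sqrtTN) * (e * 1) by simp only [const_mul]; ring]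
  simp only [map_add, map_const_mul, ascT_mul p (l := r + 1) (r := m) (by omega) (by omega) he,
    hy, h1']
  have hs := p.sqrtT_ne_zero ht
  have e2 : p.sqrtTN⁻¹ * (t ^ m)⁻¹ * x = x * (p.sqrtT⁻¹ ^ m * p.sqrtTN⁻¹) * p.sqrtT⁻¹ ^ m := by
    have : t ^ m = p.sqrtT ^ m * p.sqrtT ^ m := by
      rw [← mul_pow, ← sq, p.sqrtT_sq]
    rw [this]
    simp only [inv_pow, mul_inv]
    ring
  have e3 : p.sqrtTN * t ^ m * y - p.sqrtTN⁻¹ * (c + d) * x =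
      x * (-(p.sqrtT⁻¹ ^ m * p.sqrtTN⁻¹ * (c + d))) * p.sqrtT ^ m +
        y * (p.sqrtT ^ m * p.sqrtTN) * p.sqrtT ^ m := by
    have h3 : t ^ m = p.sqrtT ^ m * p.sqrtT ^ m := by
      rw [← mul_pow, ← sq, p.sqrtT_sq]
    have h4 : p.sqrtT⁻¹ ^ m * p.sqrtT ^ m = 1 := by
      rw [← mul_pow, inv_mul_cancel₀ hs, one_pow]
    rw [h3]
    linear_combination (p.sqrtTN⁻¹ * (c + d) * x) * h4
  rw [e2, e3]
  generalize p.sqrtT⁻¹ ^ m = w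
  simp only [const_mul, map_add, map_neg]
  ring

/-- `Y_{i+1}` for an integer index `i`. -/
def lusztigN (N : ℕ) (p : NoumiParams a b c d t) (i : ℕ) : Module.End ℂ (Laurent N) :=
  ascT N p (i + 1) (N - 1 - i) * descT N p 0 (N + 1) * ascInvT N p 1 i

theorem inverse_heckeT_of_fixed (p : NoumiParams a b c d t) (ht : t ≠ 0) {l : ℕ} (hl : 1 ≤ l)
    (hN : l < N) {f : Laurent N} (hf : MidFixed l f) :
    Ring.inverse (heckeT p l : Module.End ℂ (Laurent N)) f = const N p.sqrtT⁻¹ * f := by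
  rw [inverse_heckeT_apply p ht hl hN, heckeT_of_fixed p hl hN hf, const_sub]
  ring

/-- In 1-based indexing `T_j Y_{j+1} = Y_j T_j⁻¹`. On a symmetric polynomial `T_j⁻¹` is `t^{-1/2}`,
and it is used twice. -/
theorem lusztigN_succ (p : NoumiParams a b c d t) (ht : t ≠ 0) {i : ℕ} (hi : i + 1 < N)
    {f : Laurent N} (hf : MidFixed (i + 1) f) {x : ℂ}
    (h : lusztigN N p i f = const N x * f) :
    lusztigN N p (i + 1) f = const N (t⁻¹ * x) * f := by
  have h1 : heckeT p (i + 1) (lusztigN N p (i + 1) f) =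
      const N p.sqrtT⁻¹ * (const N x * f) := by
    rw [← h, ← map_const_mul, ← inverse_heckeT_of_fixed p ht (by omega) hi hf, lusztigN, lusztigN,
      ascInvT_add, show N - 1 - i = 1 + (N - 1 - (i + 1)) by omega, ascT_add p (i + 1)]
    simp only [Module.End.mul_apply, ascT_one, ascInvT_one, add_comm 1 i]
  have hs := p.sqrtT_ne_zero ht
  have e : t⁻¹ * x = p.sqrtT⁻¹ * x * p.sqrtT⁻¹ := by
    have h2 := p.sqrtT_sq
    field_simp
    rw [h2, mul_comm]
  rw [← inverse_heckeT_heckeT p ht (by omega) hi (lusztigN N p (i + 1) f), h1, map_const_mul,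
    map_const_mul, inverse_heckeT_of_fixed p ht (by omega) hi hf, e]
  simp only [const_mul]
  ring

theorem lusztigN_zero_elemSum (p : NoumiParams a b c d t) (ha : a ≠ 0) (hb : b ≠ 0) (hc : c ≠ 0)
    (hd : d ≠ 0) (ht : t ≠ 0) {r m : ℕ} (hN : N = r + 1 + m) {h : ℕ → ℂ}
    (hh : ThreeTermRec a b (t ^ m * c) (t ^ m * d) t (r + 1) h) :
    lusztigN N p 0 (elemSum N (r + 1) h) =
      const N (p.q⁻¹ * (p.sqrtT0 * p.sqrtTN * t ^ m)⁻¹) * elemSum N (r + 1) h := by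
  have e1 : descT N p 0 (N + 1) =
      heckeT p N * (descT N p (r + 1) m * (descT N p 1 r * heckeT p 0)) := by
    rw [show N + 1 = 1 + r + m + 1 by omega, descT_add, descT_add, descT_add]
    simp only [descT_one, zero_add, add_comm 1 r, ← hN]
  have e2 : ascT N p 1 (N - 1) = ascT N p 1 r * ascT N p (r + 1) m := by
    rw [show N - 1 = r + m by omega, ascT_add, add_comm 1 r]
  rw [lusztigN, e1, zero_add, Nat.sub_zero, e2, ascInvT_zero, mul_one]
  simp only [Module.End.mul_apply]
  rw [heckeT_zero_elemSum p ha hb (by omega), map_const_mul, descT_sum p ht (by omega) hh]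
  simp only [map_const_mul, map_sum, ascT_last_descT p ht hc hd hN]
  have hTN := p.sqrtTN_ne_zero hc hd
  have hTN2 : p.sqrtTN = -(p.sqrtTN⁻¹ * (c * d)) := by
    have := p.sqrtTN_sq
    field_simp
    linear_combination this
  have e3 : ∑ n ∈ range (r + 1), (const N (p.sqrtTN⁻¹ * (t ^ m)⁻¹ * h n) * yN N r +
      const N (p.sqrtTN * t ^ m * (-((t ^ m * c)⁻¹ * (t ^ m * d)⁻¹) * h (n + 1) -
        ((t ^ m * c)⁻¹ + (t ^ m * d)⁻¹) * h n) - p.sqrtTN⁻¹ * (c + d) * h n)) * elemY N 0 r n =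
      const N (p.sqrtTN⁻¹ * (t ^ m)⁻¹) * elemSum N (r + 1) h := by
    rw [elemSum_eq_last, mul_sum]
    refine sum_congr rfl fun n _ => ?_
    -- By `t_N = -cd` the terms in `h n` cancel. The powers of `t` balance exactly because the
    -- recursion is taken with `tᵐc` and `tᵐd`.
    have e4 : p.sqrtTN * t ^ m * (-((t ^ m * c)⁻¹ * (t ^ m * d)⁻¹) * h (n + 1) -
        ((t ^ m * c)⁻¹ + (t ^ m * d)⁻¹) * h n) - p.sqrtTN⁻¹ * (c + d) * h n =
        p.sqrtTN⁻¹ * (t ^ m)⁻¹ * h (n + 1) := by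
      rw [hTN2]
      simp only [inv_neg, mul_inv, inv_inv]
      field_simp
      linear_combination (h (n + 1) + (c + d) * t ^ m * h n) * p.sqrtTN_sq
    rw [e4]
    simp only [const_mul]
    ring
  have hF : ascT N p 1 r (elemSum N (r + 1) h) =
      const N (p.sqrtT ^ r) * elemSum N (r + 1) h :=
    ascT_of_fixed p le_rfl (by omega) fun j h1 h2 => midFixed_elemSum h1 (by omega) h
  have hs : p.sqrtT⁻¹ ^ r * p.sqrtT ^ r = 1 := by
    rw [← mul_pow, inv_mul_cancel₀ (p.sqrtT_ne_zero ht), one_pow]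
  rw [← map_sum, e3, map_const_mul, hF]
  simp only [← mul_assoc, ← const_mul]
  congr 2
  rw [mul_inv, mul_inv]
  linear_combination (p.q⁻¹ * p.sqrtT0⁻¹ * p.sqrtTN⁻¹ * (t ^ m)⁻¹) * hs

theorem lusztigN_elemSum_of_lt (p : NoumiParams a b c d t) (ha : a ≠ 0) (hb : b ≠ 0)
    (hc : c ≠ 0) (hd : d ≠ 0) (ht : t ≠ 0) {k m i : ℕ} (hN : N = k + m) {h : ℕ → ℂ}
    (hh : ThreeTermRec a b (t ^ m * c) (t ^ m * d) t k h) (hi : i < k) :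
    lusztigN N p i (elemSum N k h) =
      const N (p.q⁻¹ * (p.sqrtT0 * p.sqrtTN * t ^ (m + i))⁻¹) * elemSum N k h := by
  induction i with
  | zero =>
    obtain ⟨r, rfl⟩ : ∃ r, k = r + 1 := ⟨k - 1, by omega⟩
    exact lusztigN_zero_elemSum p ha hb hc hd ht hN hh
  | succ i ih =>
    rw [lusztigN_succ p ht (by omega) (midFixed_elemSum (by omega) (by omega) h)
      (ih (by omega)), ← add_assoc, pow_succ, mul_inv, mul_inv, mul_inv]
    congr 2
    ring

/-- Undoing `T_k ⋯ T₁` moves the polynomial to `z₂,…,z_{k+1}`, where `T₀` is a scalar; moving back,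
it is free of `z_{k+1},…,z_N`, so the remaining generators are scalars too. Any coefficients `h`
will do. -/
theorem lusztigN_elemSum_self (p : NoumiParams a b c d t) (ht : t ≠ 0)
    {k m : ℕ} (hN : N = k + (m + 1)) (h : ℕ → ℂ) :
    lusztigN N p k (elemSum N k h) =
      const N (p.sqrtT0 * p.sqrtTN * t ^ m) * elemSum N k h := by
  have h0 : 0 < N := by omega
  have hl : N - 1 < N := by omega
  have e1 : descT N p 0 (N + 1) =
      heckeT p N * (descT N p (k + 1) m * (descT N p 1 k * heckeT p 0)) := by
    rw [show N + 1 = 1 + k + m + 1 by omega, descT_add, descT_add, descT_add]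
    simp only [descT_one, zero_add, add_comm 1 k, show k + 1 + m = N by omega]
  have hs := p.sqrtT_ne_zero ht
  -- The coefficients invert the factor `t^{-k/2} tⁿ` of `descT_elemY`.
  set G : Laurent N := ∑ n ∈ range (k + 1),
    const N (h n * (p.sqrtT ^ k * (t ^ n)⁻¹)) * elemY N 1 (k + 1) n with hG
  have hG1 : descT N p 1 k G = elemSum N k h := by
    rw [hG, map_sum, elemSum]
    refine sum_congr rfl fun n _ => ?_
    rw [map_const_mul, descT_elemY p ht (by omega)]
    simp only [← mul_assoc, ← const_mul]
    congr 2
    have htn : t ^ n ≠ 0 := pow_ne_zero _ ht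
    rw [inv_pow]
    field_simp
  have hG2 : ascInvT N p 1 k (elemSum N k h) = G := by
    rw [← hG1, ascInvT_descT p ht le_rfl (by omega)]
  have hG3 : heckeT p 0 G = const N p.sqrtT0 * G := by
    rw [heckeT_zero p h0]
    apply heckeFirst_of_fixed
    rw [hG, map_sum]
    refine sum_congr rfl fun n _ => ?_
    rw [map_mul, AlgHom.commutes,
      algHom_elemY _ (fun i h1 _ => invHom_yN_of_ne h0 _ _ (by omega)) n]
  have hF : heckeT p N (elemSum N k h) = const N p.sqrtTN * elemSum N k h := by
    rw [heckeT_last p h0]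
    apply heckeLast_of_fixed
    rw [elemSum, map_sum]
    refine sum_congr rfl fun n _ => ?_
    rw [map_mul, AlgHom.commutes,
      algHom_elemY _ (fun i _ h2 => invHom_yN_of_ne hl _ _ (by omega)) n]
  have hfix : ∀ j, k + 1 ≤ j → j < k + 1 + m → MidFixed j (elemSum N k h) :=
    fun j h1 _ => midFixed_elemSum (by omega) (by omega) h
  rw [lusztigN, e1, show N - 1 - k = m by omega]
  simp only [Module.End.mul_apply]
  rw [hG2, hG3, map_const_mul, hG1, map_const_mul,
    descT_of_fixed p (by omega) (by omega) hfix, map_const_mul, map_const_mul, map_const_mul, hF,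
    map_const_mul, map_const_mul, ascT_of_fixed p (by omega) (by omega) hfix]
  simp only [← mul_assoc, ← const_mul]
  congr 2
  have h3 : t ^ m = p.sqrtT ^ m * p.sqrtT ^ m := by
    rw [← mul_pow, ← sq, p.sqrtT_sq]
  rw [h3]
  ring

theorem lusztigN_elemSum_of_le (p : NoumiParams a b c d t) (ht : t ≠ 0)
    {k j m : ℕ} (hN : N = k + j + (m + 1)) (h : ℕ → ℂ) :
    lusztigN N p (k + j) (elemSum N k h) =
      const N (p.sqrtT0 * p.sqrtTN * t ^ m) * elemSum N k h := by
  induction j generalizing m with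
  | zero => exact lusztigN_elemSum_self p ht hN h
  | succ j ih =>
    rw [← add_assoc, lusztigN_succ p ht (by omega) (midFixed_elemSum (by omega) (by omega) h)
      (ih (m := m + 1) (by omega))]
    congr 2
    rw [pow_succ]
    field_simp

end Eigenfunction

/-! ### The constant term as a sum of elementary symmetric polynomials -/

section ConstantTerm

/-- The product over `i` is `genY` evaluated at `w⁻¹`; its term in `w⁻ⁿ` pairs with `hₙ wⁿ` in the
coefficient of `w⁰`. -/
theorem integralFormula_eq (a b c d t : ℂ) (k m : ℕ) :
    integralFormula a b c d t k m =
      elemSum (k + m) k (hCoeff a b (t ^ m * c) (t ^ m * d) t) := by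
  set R := Laurent (k + m)
  let φ : Polynomial R →+* LaurentSeries R :=
    Polynomial.eval₂RingHom HahnSeries.C (HahnSeries.single (-1 : ℤ) (1 : R))
  have h1 : ∏ i : Fin k, (HahnSeries.single (-1 : ℤ) (1 : R) +
      HahnSeries.C (((zvar (Fin.castAdd m i))⁻¹ : Rˣ) : R)) = φ (genY (k + m) 0 k) := by
    rw [genY, map_prod, ← range_eq_Ico, ← Fin.prod_univ_eq_prod_range
      (fun i => φ (Polynomial.X + Polynomial.C (yN (k + m) i))) k]
    refine prod_congr rfl fun i _ => ?_
    have hi : (i : ℕ) < k + m := by omega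
    simp only [φ, Polynomial.coe_eval₂RingHom, Polynomial.eval₂_add, Polynomial.eval₂_X,
      Polynomial.eval₂_C, yN, hi, dif_pos]
    rfl
  have h2 : genY (k + m) 0 k = ∑ n ∈ range (k + 1),
      Polynomial.C (elemY (k + m) 0 k n) * Polynomial.X ^ n :=
    Polynomial.as_sum_range_C_mul_X_pow' _
      (Nat.lt_succ_of_le (natDegree_genY_le (N := k + m) 0 k))
  rw [integralFormula, contourIntegral, h1, h2, map_sum, mul_sum, HahnSeries.coeff_sum, elemSum]
  refine sum_congr rfl fun n _ => ?_
  have h3 : φ (Polynomial.C (elemY (k + m) 0 k n) * Polynomial.X ^ n) =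
      HahnSeries.single (-(n : ℤ)) (elemY (k + m) 0 k n) := by
    simp only [φ, Polynomial.coe_eval₂RingHom, Polynomial.eval₂_mul, Polynomial.eval₂_C,
      Polynomial.eval₂_X_pow, HahnSeries.single_pow, HahnSeries.C_apply,
      HahnSeries.single_mul_single]
    simp
  rw [h3, show (0 : ℤ) = (n : ℤ) + -(n : ℤ) by ring, HahnSeries.coeff_mul_single_add,
    HahnSeries.ofPowerSeries_apply_coeff, PowerSeries.coeff_map, HSeries, PowerSeries.coeff_mk]

end ConstantTerm

/-! ### Monomial expansion of the elementary symmetric sum -/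

section Coefficients

variable {N : ℕ}

/-- The exponent of `∏_{i ∈ S} z_{i+1}⁻¹`. -/
def negInd (N : ℕ) (S : Finset ℕ) : Fin N → ℤ := fun l => if (l : ℕ) ∈ S then -1 else 0

theorem prod_yN (S : Finset ℕ) (hS : ∀ i ∈ S, i < N) :
    ∏ i ∈ S, yN N i = AddMonoidAlgebra.single (negInd N S) 1 := by
  induction S using Finset.induction_on with
  | empty =>
    rw [prod_empty, AddMonoidAlgebra.one_def]
    congr 1
  | insert i S hi ih =>
    have hiN := hS i (mem_insert_self i S)
    rw [prod_insert hi, ih fun j hj => hS j (mem_insert_of_mem hj)]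
    have e : yN N i = AddMonoidAlgebra.single (-Pi.single ⟨i, hiN⟩ 1) 1 := by
      simp only [yN, hiN, dif_pos]
      rfl
    rw [e, AddMonoidAlgebra.single_mul_single, one_mul]
    congr 1
    ext l
    simp only [negInd, Pi.add_apply, Pi.neg_apply, Pi.single_apply, mem_insert, Fin.ext_iff]
    by_cases h : (l : ℕ) = i
    · simp [h, hi]
    · simp [h]

theorem elemY_eq_sum {k n : ℕ} (hk : k ≤ N) (hn : n ≤ k) :
    elemY N 0 k n = ∑ S ∈ powersetCard (k - n) (Ico 0 k),
      AddMonoidAlgebra.single (negInd N S) 1 := by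
  rw [elemY, genY, prod_X_add_C_coeff _ _ (by simpa using hn), Nat.card_Ico, Nat.sub_zero]
  refine sum_congr rfl fun S hS => prod_yN S fun i hi => ?_
  have := mem_Ico.1 ((mem_powersetCard.1 hS).1 hi)
  omega

theorem negInd_inj {k : ℕ} (hk : k ≤ N) {S S' : Finset ℕ} (hS : S ⊆ Ico 0 k) (hS' : S' ⊆ Ico 0 k)
    (h : negInd N S = negInd N S') : S = S' := by
  ext i
  by_cases hi : i < N
  · have := congrFun h ⟨i, hi⟩
    simp only [negInd] at this
    split_ifs at this <;> simp_all
  · have h1 : i ∉ S := fun h' => by have := mem_Ico.1 (hS h'); omega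
    have h2 : i ∉ S' := fun h' => by have := mem_Ico.1 (hS' h'); omega
    simp [h1, h2]

theorem coeff_elemSum {k : ℕ} (hk : k ≤ N) (h : ℕ → ℂ) (β : Fin N → ℤ) :
    (elemSum N k h).coeff β = ∑ n ∈ range (k + 1), h n *
      ∑ S ∈ powersetCard (k - n) (Ico 0 k), if negInd N S = β then 1 else 0 := by
  classical
  rw [elemSum]
  simp only [← const_smul_eq]
  rw [AddMonoidAlgebra.coeff_sum, Finsupp.finsetSum_apply]
  refine sum_congr rfl fun n hn => ?_
  rw [elemY_eq_sum hk (by simpa [Nat.lt_succ_iff] using hn), AddMonoidAlgebra.coeff_smul,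
    Finsupp.smul_apply, AddMonoidAlgebra.coeff_sum, Finsupp.finsetSum_apply, smul_eq_mul]
  congr 1
  refine sum_congr rfl fun S _ => ?_
  rw [AddMonoidAlgebra.coeff_single, Finsupp.single_apply]

/-- Only `n = 0` contributes a subset of full size `k`, so the coefficient is `h 0`. -/
theorem coeff_elemSum_self {k : ℕ} (hk : k ≤ N) {h : ℕ → ℂ} (h0 : h 0 = 1) :
    (elemSum N k h).coeff (negInd N (Ico 0 k)) = 1 := by
  rw [coeff_elemSum hk, sum_range_succ', sum_eq_zero, zero_add, h0, one_mul, Nat.sub_zero]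
  · have : powersetCard k (Ico 0 k) = {Ico 0 k} := by
      have h := powersetCard_self (Ico 0 k)
      rwa [Nat.card_Ico, Nat.sub_zero] at h
    rw [this, sum_singleton, if_pos rfl]
  · intro n hn
    rw [sum_eq_zero, mul_zero]
    intro S hS
    rw [if_neg]
    intro h1
    obtain ⟨h2, h3⟩ := mem_powersetCard.1 hS
    rw [negInd_inj hk h2 subset_rfl h1, Nat.card_Ico] at h3
    rw [mem_range] at hn
    omega

theorem exists_of_coeff_elemSum_ne_zero {k : ℕ} (hk : k ≤ N) {h : ℕ → ℂ} {β : Fin N → ℤ}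
    (hβ : (elemSum N k h).coeff β ≠ 0) : ∃ S ⊆ Ico 0 k, β = negInd N S := by
  rw [coeff_elemSum hk] at hβ
  obtain ⟨n, -, hn⟩ := exists_ne_zero_of_sum_ne_zero hβ
  obtain ⟨S, hS, hS'⟩ := exists_ne_zero_of_sum_ne_zero (right_ne_zero_of_mul hn)
  refine ⟨S, (mem_powersetCard.1 hS).1, ?_⟩
  by_contra hne
  exact hS' (if_neg fun h => hne h.symm)

theorem mu_eq_negInd (k m : ℕ) : mu k m = negInd (k + m) (Ico 0 k) := by
  ext i
  refine Fin.addCases (fun i => ?_) (fun i => ?_) i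
  · simp [mu, negInd]
  · simp [mu, negInd]

end Coefficients

/-! ### The order on exponents -/

section Order

variable {N : ℕ}

theorem plusPart_antitone (α : Fin N → ℤ) : Antitone (plusPart α) := by
  intro i j hij
  have := Tuple.monotone_sort (fun j => -|α j|) hij
  simpa [plusPart] using this

/-- A decreasing sequence of zeros and ones is determined by its number of ones, and sorting
preserves that number. -/
theorem plusPart_eq_ite {α : Fin N → ℤ} (hα : ∀ j, |α j| ≤ 1) (i : Fin N) :
    plusPart α i = if (i : ℕ) < #{j | α j ≠ 0} then 1 else 0 := by
  have hval : ∀ i, plusPart α i = 0 ∨ plusPart α i = 1 := by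
    intro i
    have h1 := hα (Tuple.sort (fun j => -|α j|) i)
    have h2 := abs_nonneg (α (Tuple.sort (fun j => -|α j|) i))
    simp only [plusPart]
    omega
  have hcard : #{j | α j ≠ 0} = #{j | plusPart α j ≠ 0} := by
    symm
    refine Finset.card_equiv (Tuple.sort (fun j => -|α j|)) fun j => ?_
    simp [plusPart]
  rw [hcard]
  have hanti := plusPart_antitone α
  rcases hval i with h | h
  · rw [h, if_neg]
    rw [not_lt]
    refine (card_le_card (t := Iio i) fun j hj => ?_).trans (by simp)
    simp only [mem_filter, mem_univ, true_and] at hj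
    rw [mem_Iio]
    by_contra hij
    have := hanti (not_lt.1 hij)
    rcases hval j with h' | h' <;> omega
  · rw [h, if_pos]
    refine lt_of_lt_of_le (b := #(Iic i)) (by simp) (card_le_card fun j hj => ?_)
    simp only [mem_filter, mem_univ, true_and]
    have := hanti (mem_Iic.1 hj)
    rcases hval j with h' | h' <;> omega

theorem abs_le_plusPart_zero (α : Fin N → ℤ) (hN : 0 < N) (j : Fin N) :
    |α j| ≤ plusPart α ⟨0, hN⟩ := by
  have h := plusPart_antitone α (show (⟨0, hN⟩ : Fin N) ≤
    (Tuple.sort (fun j => -|α j|)).symm j from Nat.zero_le _)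
  simpa [plusPart] using h

/-- The first entry of `α⁺` is the largest absolute value, and dominance at the first index compares
these. Uniqueness therefore only has to deal with letters in `{-1,0,1}`. -/
theorem abs_le_one_of_prec {α β : Fin N → ℤ} (hα : ∀ j, |α j| ≤ 1) (h : Prec β α) (j : Fin N) :
    |β j| ≤ 1 := by
  have hN : 0 < N := j.pos
  have h1 : plusPart β ⟨0, hN⟩ ≤ plusPart α ⟨0, hN⟩ := by
    rcases h.1 with h | h
    · have h0 : Iic (⟨0, hN⟩ : Fin N) = {⟨0, hN⟩} := by
        ext i
        simp [Fin.le_def, Fin.ext_iff]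
      simpa [h0] using h.1 ⟨0, hN⟩
    · rw [h.1]
  exact (abs_le_plusPart_zero β hN j).trans (h1.trans (hα _))

theorem card_negInd {k : ℕ} (hk : k ≤ N) {S : Finset ℕ} (hS : S ⊆ Ico 0 k) :
    #{j : Fin N | negInd N S j ≠ 0} = #S := by
  refine Finset.card_nbij (fun j => (j : ℕ)) ?_ ?_ ?_
  · intro j hj
    simpa [negInd] using hj
  · intro i _ j _ h
    exact Fin.ext h
  · intro i hi
    have := mem_Ico.1 (hS hi)
    exact ⟨⟨i, by omega⟩, by simpa [negInd] using hi, rfl⟩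

theorem abs_negInd_le (S : Finset ℕ) (j : Fin N) : |negInd N S j| ≤ 1 := by
  simp only [negInd]
  split_ifs <;> simp

theorem prec_negInd {k : ℕ} (hk : k ≤ N) {S : Finset ℕ} (hS : S ⊆ Ico 0 k) (hne : S ≠ Ico 0 k) :
    Prec (negInd N S) (negInd N (Ico 0 k)) := by
  have hlt : #S < k := by
    have := card_lt_card (hS.ssubset_of_ne hne)
    rwa [Nat.card_Ico, Nat.sub_zero] at this
  have h1 : ∀ i : Fin N, plusPart (negInd N S) i = if (i : ℕ) < #S then 1 else 0 := fun i => by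
    rw [plusPart_eq_ite (abs_negInd_le S), card_negInd hk hS]
  have h2 : ∀ i : Fin N, plusPart (negInd N (Ico 0 k)) i = if (i : ℕ) < k then 1 else 0 :=
    fun i => by
      rw [plusPart_eq_ite (abs_negInd_le _), card_negInd hk subset_rfl, Nat.card_Ico, Nat.sub_zero]
  refine ⟨Or.inl ⟨fun j => sum_le_sum fun i _ => ?_, fun h => ?_⟩, fun h => ?_⟩
  · rw [h1, h2]
    split_ifs <;> omega
  · have := congrFun h ⟨#S, by omega⟩
    rw [h1, h2] at this
    simp [hlt] at this
  · exact hne (negInd_inj hk hS subset_rfl h)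

end Order

/-! ### The spectrum at the string -/

section Spectrum

variable {a b c d t : ℂ}

theorem mu_apply_of_lt {k m : ℕ} {i : Fin (k + m)} (hi : (i : ℕ) < k) : mu k m i = -1 := by
  simp [mu_eq_negInd, negInd, hi]

theorem mu_apply_of_le {k m : ℕ} {i : Fin (k + m)} (hi : k ≤ (i : ℕ)) : mu k m i = 0 := by
  simp [mu_eq_negInd, negInd, hi]

/-- Negative letters are ranked from right to left, so exactly those strictly between `i` and `k`
come ahead. -/
theorem absRho_mu_of_lt {k m : ℕ} {i : Fin (k + m)} (hi : (i : ℕ) < k) :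
    absRho (mu k m) i = k - i := by
  have h : #{j | |mu k m i| < |mu k m j| ∨ (|mu k m j| = |mu k m i| ∧
      (mu k m i < mu k m j ∨ (mu k m j = mu k m i ∧ (if 0 ≤ mu k m i then j < i else i < j))))} =
      #(Ico ((i : ℕ) + 1) k) := by
    refine Finset.card_nbij (fun j => (j : ℕ)) ?_ ?_ ?_
    · intro j hj
      simp only [mem_coe, mem_filter, mem_univ, true_and, mu_apply_of_lt hi] at hj
      simp only [mem_coe, mem_Ico]
      by_cases hjk : (j : ℕ) < k
      · simp only [mu_apply_of_lt hjk] at hj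
        norm_num at hj
        rw [Fin.lt_def] at hj
        omega
      · simp [mu_apply_of_le (not_lt.1 hjk)] at hj
    · intro i _ j _ h
      exact Fin.ext h
    · intro j hj
      have hj' := mem_Ico.1 hj
      refine ⟨⟨j, by omega⟩, ?_, rfl⟩
      have hjk : ((⟨j, by omega⟩ : Fin (k + m)) : ℕ) < k := hj'.2
      simp only [mem_coe, mem_filter, mem_univ, true_and, mu_apply_of_lt hi, mu_apply_of_lt hjk]
      norm_num
      rw [Fin.lt_def]
      exact hj'.1
  rw [absRho, h, Nat.card_Ico]
  omega

theorem absRho_mu_of_le {k m : ℕ} {i : Fin (k + m)} (hi : k ≤ (i : ℕ)) :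
    absRho (mu k m) i = i + 1 := by
  have h : #{j | |mu k m i| < |mu k m j| ∨ (|mu k m j| = |mu k m i| ∧
      (mu k m i < mu k m j ∨ (mu k m j = mu k m i ∧ (if 0 ≤ mu k m i then j < i else i < j))))} =
      #(Iio i) := by
    congr 1
    ext j
    simp only [mem_filter, mem_univ, true_and, mu_apply_of_le hi, mem_Iio]
    by_cases hjk : (j : ℕ) < k
    · simp only [mu_apply_of_lt hjk]
      norm_num
      rw [Fin.lt_def]
      omega
    · simp [mu_apply_of_le (not_lt.1 hjk)]
  rw [absRho, h, Fin.card_Iio]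
  omega

theorem isNonsymKoornwinder_integralFormula {k m : ℕ} (p : NoumiParams a b c d t) (ha : a ≠ 0)
    (hb : b ≠ 0) (hc : c ≠ 0) (hd : d ≠ 0) (ht : t ≠ 0)
    (hh : ThreeTermRec a b (t ^ m * c) (t ^ m * d) t k
      (hCoeff a b (t ^ m * c) (t ^ m * d) t)) :
    IsNonsymKoornwinder p (mu k m) (integralFormula a b c d t k m) := by
  rw [integralFormula_eq]
  refine ⟨?_, fun β hβ => ?_, fun i => ?_⟩
  · rw [mu_eq_negInd]
    exact coeff_elemSum_self (by omega) (hCoeff_zero _ _ _ _ _)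
  · obtain ⟨S, hS, rfl⟩ := exists_of_coeff_elemSum_ne_zero (by omega) hβ
    rw [mu_eq_negInd]
    by_cases hne : S = Ico 0 k
    · exact Or.inl (by rw [hne])
    · exact Or.inr (prec_negInd (by omega) hS hne)
  · rw [lusztigY_eq, const_smul_eq]
    change lusztigN (k + m) p i _ = _
    by_cases hi : (i : ℕ) < k
    · rw [lusztigN_elemSum_of_lt p ha hb hc hd ht rfl hh hi, omega, mu_apply_of_lt hi,
        absRho_mu_of_lt hi, show k + m - (k - i) = m + i by omega]
      simp
    · obtain ⟨j, hj⟩ := Nat.exists_eq_add_of_le (not_lt.1 hi)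
      have h1 : k + m = k + j + ((k + m - (i + 1)) + 1) := by omega
      rw [hj, lusztigN_elemSum_of_le p ht h1, omega, mu_apply_of_le (not_lt.1 hi),
        absRho_mu_of_le (not_lt.1 hi)]
      simp

end Spectrum

/-! ### The generators on monomials with exponents in `{-1, 0, 1}` -/

section Words

variable {n : ℕ} {a b c d t : ℂ}

/-- The monomial `z^α`. -/
def mon {N : ℕ} (α : Fin N → ℤ) : Laurent N := AddMonoidAlgebra.single α 1

theorem mon_add {N : ℕ} (α β : Fin N → ℤ) : mon (α + β) = mon α * mon β := by
  simp [mon, AddMonoidAlgebra.single_mul_single]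

/-- `z_{l+1}^A` for `A ∈ {-1, 0, 1}`. -/
def letterPow (N l : ℕ) (A : ℤ) : Laurent N := if A = 1 then zN N l else if A = -1 then yN N l else 1

@[simp] theorem letterPow_zero (N l : ℕ) : letterPow N l 0 = 1 := by simp [letterPow]

@[simp] theorem letterPow_one (N l : ℕ) : letterPow N l 1 = zN N l := by simp [letterPow]

@[simp] theorem letterPow_neg_one (N l : ℕ) : letterPow N l (-1) = yN N l := by simp [letterPow]

theorem eq_of_abs_le_one {A : ℤ} (h : |A| ≤ 1) : A = -1 ∨ A = 0 ∨ A = 1 := by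
  rw [abs_le] at h
  omega

theorem mon_single {N : ℕ} (l : Fin N) {A : ℤ} (hA : |A| ≤ 1) :
    mon (Pi.single l A) = letterPow N l A := by
  rcases eq_of_abs_le_one hA with rfl | rfl | rfl
  · rw [letterPow_neg_one, yN, dif_pos l.2, Pi.single_neg]
    rfl
  · simp [mon, AddMonoidAlgebra.one_def]
  · rw [letterPow_one, zN, dif_pos l.2]
    rfl

theorem mon_insertNth (l : Fin (n + 1)) {A : ℤ} (hA : |A| ≤ 1) (o : Fin n → ℤ) :
    mon (l.insertNth A o : Fin (n + 1) → ℤ) =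
      mon (l.insertNth 0 o : Fin (n + 1) → ℤ) * letterPow (n + 1) l A := by
  rw [← mon_single l hA, ← mon_add]
  congr 1
  ext j
  refine Fin.succAboveCases l ?_ (fun j => ?_) j
  · simp
  · simp [Fin.succAbove_ne]

/-- Two readings of one word: either of two neighbouring letters may be regarded as the
distinguished one. -/
theorem insertNth_castSucc (q : Fin n) (u : ℤ) (o : Fin n → ℤ) :
    (q.castSucc.insertNth u o : Fin (n + 1) → ℤ) =
      q.succ.insertNth (o q) (Function.update o q u) := by
  ext l
  refine Fin.succAboveCases q.succ ?_ (fun j => ?_) l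
  · have h := Fin.insertNth_apply_succAbove (α := fun _ => ℤ) q.castSucc u o q
    rw [Fin.succAbove_castSucc_self] at h
    rw [h, Fin.insertNth_apply_same]
  · rw [Fin.insertNth_apply_succAbove]
    rcases eq_or_ne j q with rfl | h
    · rw [Fin.succAbove_succ_self]
      simp
    · have : q.succ.succAbove j = q.castSucc.succAbove j := by
        have : (j : ℕ) ≠ q := fun h' => h (Fin.ext h')
        simp only [Fin.succAbove, Fin.lt_def, Fin.val_castSucc, Fin.val_succ]
        split_ifs <;> first | rfl | omega
      rw [this, Fin.insertNth_apply_succAbove, Function.update_of_ne h]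

/-- The monomial with exponents `A`, `B` at the positions `q`, `q + 1`, and the entries of `o`
other than `o q` at the remaining positions. -/
def pairMon (q : Fin n) (A B : ℤ) (o : Fin n → ℤ) : Laurent (n + 1) :=
  mon (q.castSucc.insertNth A (Function.update o q B) : Fin (n + 1) → ℤ)

theorem mon_insertNth_castSucc (q : Fin n) (u : ℤ) (o : Fin n → ℤ) :
    mon (q.castSucc.insertNth u o : Fin (n + 1) → ℤ) = pairMon q u (o q) o := by
  simp [pairMon]

theorem mon_insertNth_succ (q : Fin n) (u : ℤ) (o : Fin n → ℤ) :
    mon (q.succ.insertNth u o : Fin (n + 1) → ℤ) = pairMon q (o q) u o := by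
  rw [pairMon, insertNth_castSucc]
  simp

theorem pairMon_eq (q : Fin n) {A B : ℤ} (hA : |A| ≤ 1) (hB : |B| ≤ 1) (o : Fin n → ℤ) :
    pairMon q A B o =
      pairMon q 0 0 o * (letterPow (n + 1) q A * letterPow (n + 1) (q + 1) B) := by
  rw [pairMon, mon_insertNth _ hA, insertNth_castSucc, mon_insertNth _ (by simpa using hB),
    pairMon, insertNth_castSucc]
  simp only [Function.update_self, Function.update_idem, Fin.val_castSucc, Fin.val_succ]
  ring

theorem midFixed_pairMon (q : Fin n) (o : Fin n → ℤ) :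
    MidFixed ((q : ℕ) + 1) (pairMon q 0 0 o) := by
  intro h
  rw [pairMon, mon, swapHom_single]
  congr 1
  set x : Fin (n + 1) → ℤ := q.castSucc.insertNth 0 (Function.update o q 0) with hx
  have e1 : (⟨(q : ℕ) + 1 - 1, by omega⟩ : Fin (n + 1)) = q.castSucc := Fin.ext (by simp)
  have e2 : (⟨(q : ℕ) + 1, h⟩ : Fin (n + 1)) = q.succ := rfl
  have h1 : x q.castSucc = 0 := by rw [hx, Fin.insertNth_apply_same]
  have h2 : x q.succ = 0 := by
    rw [hx, insertNth_castSucc]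
    simp
  rw [e1, e2]
  ext l
  rw [Function.comp_apply, Equiv.swap_apply_def]
  split_ifs with h3 h4
  · rw [h3, h1, h2]
  · rw [h4, h1, h2]
  · rfl

/-- The rest of the word is symmetric in the two variables and factors out, leaving nine cases. A
term with both letters erased arises only from two nonzero letters, which is why it has smaller
height. -/
theorem heckeT_pairMon (p : NoumiParams a b c d t) (q : Fin n) {A B : ℤ} (hA : |A| ≤ 1)
    (hB : |B| ≤ 1) (o : Fin n → ℤ) :
    ∃ κ₀ : ℂ, heckeT p (q + 1) (pairMon q A B o) =
        (if B < A then p.sqrtT⁻¹ else p.sqrtT) • pairMon q B A o +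
          (if A < B then p.sqrtT - p.sqrtT⁻¹ else 0) • pairMon q A B o + κ₀ • pairMon q 0 0 o ∧
      (κ₀ ≠ 0 → |A| = 1 ∧ |B| = 1) := by
  have hN : (q : ℕ) + 1 < n + 1 := by omega
  have hl : 1 ≤ (q : ℕ) + 1 := by omega
  have hf := midFixed_pairMon q o
  have h1 := heckeT_yN p hl hN
  have h2 := heckeT_yN_pred p hl hN
  have h3 := heckeT_zN p hl hN
  have h4 := heckeT_zN_succ p hl hN
  have h5 := heckeT_zN_mul_yN p hl hN
  have h6 := heckeT_yN_mul_zN p hl hN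
  have h7 := heckeT_of_fixed p hl hN (MidFixed.one (N := n + 1) (q + 1))
  have hsym : ∀ f, MidFixed ((q : ℕ) + 1) f → heckeT p (q + 1) f = const (n + 1) p.sqrtT * f :=
    fun f hf => heckeT_of_fixed p hl hN hf
  have hy : MidFixed ((q : ℕ) + 1) (yN (n + 1) q * yN (n + 1) (q + 1)) := by
    simpa using midFixed_mul_yN (N := n + 1) hl 0
  have hz : MidFixed ((q : ℕ) + 1) (zN (n + 1) q * zN (n + 1) (q + 1)) := by
    intro h'
    have h'' : (q : ℕ) < n + 1 := by omega
    simp only [map_mul, zN, h', h'', dif_pos, swapHom_zvar, Nat.add_sub_cancel,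
      Equiv.swap_apply_left, Equiv.swap_apply_right]
    ring
  rw [Nat.add_sub_cancel] at h1 h2 h3 h4 h5 h6
  rw [pairMon_eq q hA hB, pairMon_eq q hB hA, heckeT_mul p hl hN hf]
  generalize pairMon q 0 0 o = R
  rcases eq_of_abs_le_one hA with rfl | rfl | rfl <;>
    rcases eq_of_abs_le_one hB with rfl | rfl | rfl
  · refine ⟨0, ?_, by simp⟩
    simp only [letterPow_neg_one, hsym _ hy, const_smul_eq, map_zero]
    norm_num
    ring
  · refine ⟨0, ?_, by simp⟩
    simp only [letterPow_neg_one, letterPow_zero, mul_one, h2, const_smul_eq, map_zero]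
    norm_num
    ring
  · refine ⟨p.sqrtT - p.sqrtT⁻¹, ?_, by simp⟩
    simp only [letterPow_neg_one, letterPow_one, mul_comm (yN (n + 1) q), h6, const_smul_eq]
    norm_num
    ring
  · refine ⟨0, ?_, by simp⟩
    simp only [letterPow_neg_one, letterPow_zero, one_mul, h1, const_smul_eq, map_zero]
    norm_num
    ring
  · refine ⟨0, ?_, by simp⟩
    simp only [letterPow_zero, one_mul, h7, const_smul_eq, map_zero]
    norm_num
    ring
  · refine ⟨0, ?_, by simp⟩
    simp only [letterPow_one, letterPow_zero, one_mul, h4, const_smul_eq, map_zero]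
    norm_num
    ring
  · refine ⟨p.sqrtT⁻¹ - p.sqrtT, ?_, by simp⟩
    simp only [letterPow_neg_one, letterPow_one, h5, const_smul_eq]
    norm_num
    ring
  · refine ⟨0, ?_, by simp⟩
    simp only [letterPow_one, letterPow_zero, mul_one, h3, const_smul_eq, map_zero]
    norm_num
    ring
  · refine ⟨0, ?_, by simp⟩
    simp only [letterPow_one, hsym _ hz, const_smul_eq, map_zero]
    norm_num
    ring

theorem inverse_heckeT_pairMon (p : NoumiParams a b c d t) (ht : t ≠ 0) (q : Fin n) {A B : ℤ}
    (hA : |A| ≤ 1) (hB : |B| ≤ 1) (o : Fin n → ℤ) :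
    ∃ κ₀ : ℂ, Ring.inverse (heckeT p (q + 1) : Module.End ℂ (Laurent (n + 1)))
          (pairMon q A B o) =
        (if A < B then p.sqrtT else p.sqrtT⁻¹) • pairMon q B A o +
          (if B < A then p.sqrtT⁻¹ - p.sqrtT else 0) • pairMon q A B o + κ₀ • pairMon q 0 0 o ∧
      (κ₀ ≠ 0 → |A| = 1 ∧ |B| = 1) := by
  obtain ⟨κ₀, h, h0⟩ := heckeT_pairMon p q hA hB o
  refine ⟨κ₀, ?_, h0⟩
  rw [inverse_heckeT_apply p ht (by omega) (by omega), h, ← const_smul_eq]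
  rcases lt_trichotomy A B with h1 | rfl | h1
  · simp only [h1, h1.not_gt, if_true, if_false]
    module
  · simp only [lt_irrefl, if_false]
    module
  · simp only [h1, h1.not_gt, if_true, if_false]
    module

theorem heckeT_zero_mon (p : NoumiParams a b c d t) (ha : a ≠ 0) (hb : b ≠ 0) {u : ℤ}
    (hu : |u| ≤ 1) (o : Fin n → ℤ) :
    ∃ κ₀ : ℂ, heckeT p 0 (mon ((0 : Fin (n + 1)).insertNth u o : Fin (n + 1) → ℤ)) =
        (if u = 0 then p.sqrtT0 else if u = 1 then p.q * p.sqrtT0 else p.q⁻¹ * p.sqrtT0⁻¹) •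
          mon ((0 : Fin (n + 1)).insertNth (-u) o : Fin (n + 1) → ℤ) +
        (if u = 1 then p.sqrtT0 - p.sqrtT0⁻¹ else 0) •
          mon ((0 : Fin (n + 1)).insertNth 1 o : Fin (n + 1) → ℤ) +
        κ₀ • mon ((0 : Fin (n + 1)).insertNth 0 o : Fin (n + 1) → ℤ) ∧
      (κ₀ ≠ 0 → |u| = 1) := by
  have hR : invHom (0 : Fin (n + 1)) p.q p.q_ne_zero
      (mon ((0 : Fin (n + 1)).insertNth 0 o : Fin (n + 1) → ℤ)) =
      mon ((0 : Fin (n + 1)).insertNth 0 o : Fin (n + 1) → ℤ) :=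
    invHom_single_of_eq_zero _ _ (by rw [Fin.insertNth_apply_same])
  have h0 : 0 < n + 1 := by omega
  have h1 := heckeFirst_zvar p ha hb (0 : Fin (n + 1))
  have h2 := heckeFirst_zvar_inv p ha hb (0 : Fin (n + 1))
  have ey : (((zvar (0 : Fin (n + 1)))⁻¹ : (Laurent (n + 1))ˣ) : Laurent (n + 1)) =
    yN (n + 1) 0 := by simp [yN]
  have ez : ((zvar (0 : Fin (n + 1)) : (Laurent (n + 1))ˣ) : Laurent (n + 1)) =
    zN (n + 1) 0 := by simp [zN]
  have h3 := heckeFirst_of_fixed p (0 : Fin (n + 1)) (g := 1) (map_one _)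
  rw [ey, ez] at h1 h2
  rw [mon_insertNth 0 hu, mon_insertNth 0 (A := -u) (by rwa [abs_neg]), mon_insertNth 0 (A := 1) (by simp),
    heckeT_zero p h0]
  change ∃ κ₀ : ℂ, heckeFirst p 0 _ = _ ∧ _
  rw [heckeFirst_mul p 0 hR]
  generalize mon ((0 : Fin (n + 1)).insertNth 0 o : Fin (n + 1) → ℤ) = R
  rw [Fin.val_zero]
  rcases eq_of_abs_le_one hu with rfl | rfl | rfl
  · refine ⟨-(p.q⁻¹ * p.sqrtT0⁻¹ * (a + b)), ?_, by simp⟩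
    simp only [letterPow_neg_one, h2, neg_neg, letterPow_one, Int.reduceEq, Int.reduceNeg,
      reduceIte, const_smul_eq, const_mul, const_add, map_neg, map_zero]
    ring
  · refine ⟨0, ?_, by simp⟩
    simp only [letterPow_zero, h3, neg_zero, const_smul_eq]
    norm_num
    ring
  · refine ⟨p.sqrtT0⁻¹ * (a + b), ?_, by simp⟩
    simp only [letterPow_neg_one, h1, letterPow_one, Int.reduceEq, Int.reduceNeg,
      reduceIte, const_smul_eq, const_mul, const_add, const_sub]
    ring

/-- The input carries `-u` because the distinguished letter reaches the right end after `T₀` has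
inverted it; `T_N` restores the sign. -/
theorem heckeT_last_mon (p : NoumiParams a b c d t) (hc : c ≠ 0) (hd : d ≠ 0) {u : ℤ}
    (hu : |u| ≤ 1) (o : Fin n → ℤ) :
    ∃ κ₀ : ℂ, heckeT p (n + 1) (mon ((Fin.last n).insertNth (-u) o : Fin (n + 1) → ℤ)) =
        (if u = -1 then p.sqrtTN⁻¹ else p.sqrtTN) •
          mon ((Fin.last n).insertNth u o : Fin (n + 1) → ℤ) +
        (if u = 1 then p.sqrtTN - p.sqrtTN⁻¹ else 0) •
          mon ((Fin.last n).insertNth (-1) o : Fin (n + 1) → ℤ) +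
        κ₀ • mon ((Fin.last n).insertNth 0 o : Fin (n + 1) → ℤ) ∧
      (κ₀ ≠ 0 → |u| = 1) := by
  have hR : invHom (Fin.last n) 1 one_ne_zero
      (mon ((Fin.last n).insertNth 0 o : Fin (n + 1) → ℤ)) =
      mon ((Fin.last n).insertNth 0 o : Fin (n + 1) → ℤ) :=
    invHom_single_of_eq_zero _ _ (by rw [Fin.insertNth_apply_same])
  have h1 := heckeLast_zvar p hc hd (Fin.last n)
  have h2 := heckeLast_zvar_inv p hc hd (Fin.last n)
  have ey : (((zvar (Fin.last n))⁻¹ : (Laurent (n + 1))ˣ) : Laurent (n + 1)) =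
    yN (n + 1) n := by simp [yN, Fin.last]
  have ez : ((zvar (Fin.last n) : (Laurent (n + 1))ˣ) : Laurent (n + 1)) =
    zN (n + 1) n := by simp [zN, Fin.last]
  have h3 := heckeLast_of_fixed p (Fin.last n) (g := 1) (map_one _)
  rw [ey, ez] at h1 h2
  rw [mon_insertNth _ hu, mon_insertNth _ (A := -u) (by rwa [abs_neg]),
    mon_insertNth _ (A := -1) (by simp), heckeT_last p (by omega)]
  change ∃ κ₀ : ℂ, heckeLast p (Fin.last n) _ = _ ∧ _
  rw [heckeLast_mul p _ hR]
  generalize mon ((Fin.last n).insertNth 0 o : Fin (n + 1) → ℤ) = R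
  rw [Fin.val_last]
  rcases eq_of_abs_le_one hu with rfl | rfl | rfl
  · refine ⟨-(p.sqrtTN⁻¹ * (c + d)), ?_, by simp⟩
    simp only [letterPow_neg_one, h1, neg_neg, letterPow_one, Int.reduceEq, Int.reduceNeg,
      reduceIte, const_smul_eq, const_mul, const_add, map_neg, map_zero]
    ring
  · refine ⟨0, ?_, by simp⟩
    simp only [letterPow_zero, h3, neg_zero, const_smul_eq]
    norm_num
    ring
  · refine ⟨p.sqrtTN⁻¹ * (c + d), ?_, by simp⟩
    simp only [letterPow_neg_one, h2, letterPow_one, Int.reduceEq, Int.reduceNeg,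
      reduceIte, const_smul_eq, const_mul, const_add, const_sub]
    ring

end Words

/-! ### Triangularity of the operators `Y_i` -/

section Triangularity

variable {n : ℕ} {a b c d t : ℂ}

/-- A linear height of a word, with distinguished letter `u` and remaining letters `o`. -/
def height (M w : ℤ) (co : Fin n → ℤ) (u : ℤ) (o : Fin n → ℤ) : ℤ :=
  M * (|u| + ∑ q, |o q|) + w * u + ∑ q, co q * o q

/-- All letters lie in `{-1, 0, 1}`. -/
def IsWord (u : ℤ) (o : Fin n → ℤ) : Prop := |u| ≤ 1 ∧ ∀ q, |o q| ≤ 1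

/-- The span of the words of height less than `ν`, where the distinguished letter is placed at
position `r` with the sign `σ`. -/
def lowerSpan (M w : ℤ) (co : Fin n → ℤ) (r : Fin (n + 1)) (σ ν : ℤ) :
    Submodule ℂ (Laurent (n + 1)) :=
  Submodule.span ℂ {f | ∃ u o, IsWord u o ∧ height M w co u o < ν ∧
    f = mon (r.insertNth (σ * u) o : Fin (n + 1) → ℤ)}

/-- `L` carries the distinguished letter from position `r` with sign `σ` to position `r'` with
sign `σ'`, and multiplies a word by `κ`, up to words of smaller height. -/
def Step (M w : ℤ) (co : Fin n → ℤ) (L : Module.End ℂ (Laurent (n + 1))) (r : Fin (n + 1)) (σ : ℤ)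
    (r' : Fin (n + 1)) (σ' : ℤ) (κ : ℤ → (Fin n → ℤ) → ℂ) : Prop :=
  ∀ u o, IsWord u o → L (mon (r.insertNth (σ * u) o : Fin (n + 1) → ℤ)) -
    κ u o • mon (r'.insertNth (σ' * u) o : Fin (n + 1) → ℤ) ∈
      lowerSpan M w co r' σ' (height M w co u o)

variable {M w : ℤ} {co : Fin n → ℤ}

theorem lowerSpan_mono {r : Fin (n + 1)} {σ ν ν' : ℤ} (h : ν ≤ ν') :
    lowerSpan M w co r σ ν ≤ lowerSpan M w co r σ ν' :=
  Submodule.span_mono fun _ ⟨u, o, h1, h2, h3⟩ => ⟨u, o, h1, h2.trans_le h, h3⟩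

theorem mon_mem_lowerSpan {r : Fin (n + 1)} {σ ν u : ℤ} {o : Fin n → ℤ} (h : IsWord u o)
    (hν : height M w co u o < ν) :
    mon (r.insertNth (σ * u) o : Fin (n + 1) → ℤ) ∈ lowerSpan M w co r σ ν :=
  Submodule.subset_span ⟨u, o, h, hν, rfl⟩

theorem smul_mem_of_ne_zero {V : Submodule ℂ (Laurent (n + 1))} {κ : ℂ} {f : Laurent (n + 1)}
    (h : κ ≠ 0 → f ∈ V) : κ • f ∈ V := by
  by_cases hκ : κ = 0
  · simp [hκ]
  · exact V.smul_mem _ (h hκ)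

theorem Step.map_mem {L : Module.End ℂ (Laurent (n + 1))} {r r' : Fin (n + 1)} {σ σ' : ℤ}
    {κ : ℤ → (Fin n → ℤ) → ℂ} (h : Step M w co L r σ r' σ' κ) {ν : ℤ} {f : Laurent (n + 1)}
    (hf : f ∈ lowerSpan M w co r σ ν) : L f ∈ lowerSpan M w co r' σ' ν := by
  induction hf using Submodule.span_induction with
  | mem f hf =>
    obtain ⟨u, o, h1, h2, rfl⟩ := hf
    have h3 := lowerSpan_mono h2.le (h u o h1)
    have h4 := Submodule.smul_mem _ (κ u o)
      (mon_mem_lowerSpan (M := M) (w := w) (co := co) (r := r') (σ := σ') h1 h2)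
    simpa using add_mem h3 h4
  | zero => simp
  | add f g _ _ hf hg =>
    rw [map_add]
    exact add_mem hf hg
  | smul x f _ hf =>
    rw [map_smul]
    exact Submodule.smul_mem _ _ hf

/-- Height depends on the word `(u, o)`, not on where the distinguished letter currently stands, so
errors stay lower along the path and leading coefficients multiply. -/
theorem Step.comp {L L' : Module.End ℂ (Laurent (n + 1))} {r r' r'' : Fin (n + 1)}
    {σ σ' σ'' : ℤ} {κ κ' : ℤ → (Fin n → ℤ) → ℂ} (h' : Step M w co L' r' σ' r'' σ'' κ')
    (h : Step M w co L r σ r' σ' κ) :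
    Step M w co (L' * L) r σ r'' σ'' (fun u o => κ u o * κ' u o) := by
  intro u o ho
  have h1 := h'.map_mem (h u o ho)
  have h2 := Submodule.smul_mem _ (κ u o) (h' u o ho)
  have h3 := add_mem h1 h2
  rw [map_sub, map_smul, smul_sub, smul_smul, sub_add_sub_cancel] at h3
  exact h3

theorem Step.one (r : Fin (n + 1)) (σ : ℤ) : Step M w co 1 r σ r σ (fun _ _ => 1) := by
  intro u o _
  simp

theorem Step.congr {L : Module.End ℂ (Laurent (n + 1))} {r r' : Fin (n + 1)} {σ σ' : ℤ}
    {κ κ' : ℤ → (Fin n → ℤ) → ℂ} (h : Step M w co L r σ r' σ' κ) (hκ : ∀ u o, κ u o = κ' u o) :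
    Step M w co L r σ r' σ' κ' := by
  have : κ = κ' := funext fun u => funext fun o => hκ u o
  rwa [← this]

theorem height_update (u u' : ℤ) (o : Fin n → ℤ) (q : Fin n) (C : ℤ) :
    height M w co u' (Function.update o q C) = height M w co u o +
      M * (|u'| + |C| - |u| - |o q|) + w * (u' - u) + co q * (C - o q) := by
  have h1 : ∑ j, |Function.update o q C j| = ∑ j, |o j| + |C| - |o q| := by
    rw [← add_sum_erase _ _ (mem_univ q), ← add_sum_erase univ (fun j => |o j|) (mem_univ q),
      Function.update_self, sum_congr rfl fun j hj => by
        rw [Function.update_of_ne (ne_of_mem_erase hj)]]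
    ring
  have h2 : ∑ j, co j * Function.update o q C j = ∑ j, co j * o j + co q * (C - o q) := by
    rw [← add_sum_erase _ _ (mem_univ q), ← add_sum_erase univ (fun j => co j * o j) (mem_univ q),
      Function.update_self, sum_congr rfl fun j hj => by
        rw [Function.update_of_ne (ne_of_mem_erase hj)]]
    ring
  rw [height, height, h1, h2]
  ring

theorem height_update_left (u u' : ℤ) (o : Fin n → ℤ) :
    height M w co u' o = height M w co u o + M * (|u'| - |u|) + w * (u' - u) := by
  rw [height, height]
  ring

theorem IsWord.update {u u' : ℤ} {o : Fin n → ℤ} (h : IsWord u o) (hu : |u'| ≤ 1) (q : Fin n)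
    {C : ℤ} (hC : |C| ≤ 1) : IsWord u' (Function.update o q C) := by
  refine ⟨hu, fun j => ?_⟩
  rcases eq_or_ne j q with rfl | hj
  · simpa using hC
  · rw [Function.update_of_ne hj]
    exact h.2 j

theorem pairMon_update (q : Fin n) (A B C : ℤ) (o : Fin n → ℤ) :
    pairMon q A B (Function.update o q C) = pairMon q A B o := by
  simp [pairMon]

theorem pairMon_eq_castSucc (q : Fin n) (A B : ℤ) (o : Fin n → ℤ) :
    pairMon q A B o = mon (q.castSucc.insertNth A (Function.update o q B) : Fin (n + 1) → ℤ) :=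
  rfl

theorem pairMon_eq_succ (q : Fin n) (A B : ℤ) (o : Fin n → ℤ) :
    pairMon q A B o = mon (q.succ.insertNth B (Function.update o q A) : Fin (n + 1) → ℤ) := by
  rw [mon_insertNth_succ, pairMon_update, Function.update_self]

theorem height_update_zero_lt (hw : |w| < M) {q : Fin n} (hq : |co q| < M) {u : ℤ}
    {o : Fin n → ℤ} (hu : |u| = 1) (ho : |o q| = 1) :
    height M w co 0 (Function.update o q 0) < height M w co u o := by
  rw [height_update u, hu, ho, abs_zero]
  rw [abs_lt] at hw hq
  rcases (abs_eq zero_le_one).1 hu with rfl | rfl <;>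
    rcases (abs_eq zero_le_one).1 ho with h | h <;> rw [h] <;> linarith

/-- The unmoved term occurs only if `-u < o q`. Reading it as a moved letter replaces `(u, o q)` by
`(-o q, -u)`, lowering the height by `(w + co q)(u + o q) > 0`. -/
theorem step_right (p : NoumiParams a b c d t) (q : Fin n) (hw0 : 0 < w) (hwM : |w| < M)
    (hq0 : 0 < co q) (hqM : |co q| < M) :
    Step M w co (heckeT p (q + 1)) q.castSucc (-1) q.succ (-1)
      (fun u o => if o q < -u then p.sqrtT⁻¹ else p.sqrtT) := by
  intro u o ho
  have hA : |-1 * u| ≤ 1 := by simpa using ho.1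
  obtain ⟨κ₀, h, h0⟩ := heckeT_pairMon p q hA (ho.2 q) o
  rw [mon_insertNth_castSucc, mon_insertNth_succ, h, neg_one_mul, add_assoc, add_sub_cancel_left]
  refine add_mem (smul_mem_of_ne_zero fun h1 => ?_) (smul_mem_of_ne_zero fun h1 => ?_)
  · have hlt : -u < o q := by
      by_contra h2
      exact h1 (if_neg h2)
    rw [pairMon_eq_succ, show o q = -1 * -o q by ring]
    refine mon_mem_lowerSpan (ho.update (by simpa using ho.2 q) q (by simpa using ho.1)) ?_
    rw [height_update u, abs_neg, abs_neg]
    nlinarith [mul_pos (add_pos hw0 hq0) (sub_pos.2 hlt)]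
  · rw [pairMon_eq_succ, show (0 : ℤ) = -1 * 0 by ring]
    refine mon_mem_lowerSpan (ho.update (by simp) q (by simp)) ?_
    exact height_update_zero_lt hwM hqM (by simpa using (h0 h1).1) (h0 h1).2

/-- Here the error exchanges `u` and `o q` and occurs only for `o q < u`; the height drops since the
distinguished weight is larger. In `step_left`, with inverse generators, both inequalities are
reversed. -/
theorem step_back (p : NoumiParams a b c d t) (q : Fin n) (hwM : |w| < M)
    (hqM : |co q| < M) (hq : co q < w) :
    Step M w co (heckeT p (q + 1)) q.succ 1 q.castSucc 1
      (fun u o => if u < o q then p.sqrtT⁻¹ else p.sqrtT) := by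
  intro u o ho
  obtain ⟨κ₀, h, h0⟩ := heckeT_pairMon p q (ho.2 q) ho.1 o
  rw [one_mul, mon_insertNth_castSucc, mon_insertNth_succ, h, add_assoc, add_sub_cancel_left]
  refine add_mem (smul_mem_of_ne_zero fun h1 => ?_) (smul_mem_of_ne_zero fun h1 => ?_)
  · have hlt : o q < u := by
      by_contra h2
      exact h1 (if_neg h2)
    rw [pairMon_eq_castSucc, ← one_mul (o q)]
    refine mon_mem_lowerSpan (ho.update (ho.2 q) q ho.1) ?_
    rw [height_update u]
    nlinarith [mul_pos (sub_pos.2 hq) (sub_pos.2 hlt)]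
  · rw [pairMon_eq_castSucc]
    refine mon_mem_lowerSpan (u := 0) (ho.update (by simp) q (by simp)) ?_
    exact height_update_zero_lt hwM hqM (h0 h1).2 (h0 h1).1

theorem step_left (p : NoumiParams a b c d t) (ht : t ≠ 0) (q : Fin n) (hwM : |w| < M)
    (hqM : |co q| < M) (hq : w < co q) :
    Step M w co (Ring.inverse (heckeT p (q + 1))) q.succ 1 q.castSucc 1
      (fun u o => if o q < u then p.sqrtT else p.sqrtT⁻¹) := by
  intro u o ho
  obtain ⟨κ₀, h, h0⟩ := inverse_heckeT_pairMon p ht q (ho.2 q) ho.1 o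
  rw [one_mul, mon_insertNth_castSucc, mon_insertNth_succ, h, add_assoc, add_sub_cancel_left]
  refine add_mem (smul_mem_of_ne_zero fun h1 => ?_) (smul_mem_of_ne_zero fun h1 => ?_)
  · have hlt : u < o q := by
      by_contra h2
      exact h1 (if_neg h2)
    rw [pairMon_eq_castSucc, ← one_mul (o q)]
    refine mon_mem_lowerSpan (ho.update (ho.2 q) q ho.1) ?_
    rw [height_update u]
    nlinarith [mul_pos (sub_pos.2 hq) (sub_pos.2 hlt)]
  · rw [pairMon_eq_castSucc]
    refine mon_mem_lowerSpan (u := 0) (ho.update (by simp) q (by simp)) ?_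
    exact height_update_zero_lt hwM hqM (h0 h1).2 (h0 h1).1

theorem height_zero_lt (hwM : |w| < M) {u : ℤ} (hu : |u| = 1) (o : Fin n → ℤ) :
    height M w co 0 o < height M w co u o := by
  rw [height_update_left u, hu, abs_zero]
  rw [abs_lt] at hwM
  rcases (abs_eq zero_le_one).1 hu with rfl | rfl <;> linarith

/-- For `u = 1` the uninverted term reads as the letter `-1` with sign `-1`, which costs `2w` in
height. -/
theorem step_first (p : NoumiParams a b c d t) (ha : a ≠ 0) (hb : b ≠ 0) (hw0 : 0 < w)
    (hwM : |w| < M) :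
    Step M w co (heckeT p 0) 0 1 0 (-1) (fun u _ => if u = 0 then p.sqrtT0 else
      if u = 1 then p.q * p.sqrtT0 else p.q⁻¹ * p.sqrtT0⁻¹) := by
  intro u o ho
  obtain ⟨κ₀, h, h0⟩ := heckeT_zero_mon p ha hb ho.1 o
  rw [one_mul, neg_one_mul, h, add_assoc, add_sub_cancel_left]
  refine add_mem (smul_mem_of_ne_zero fun h1 => ?_) (smul_mem_of_ne_zero fun h1 => ?_)
  · have hu : u = 1 := by
      by_contra h2
      exact h1 (if_neg h2)
    rw [show (1 : ℤ) = -1 * -1 by ring]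
    refine mon_mem_lowerSpan ⟨by simp, ho.2⟩ ?_
    rw [height_update_left u, hu]
    norm_num
    linarith
  · rw [show (0 : ℤ) = -1 * 0 by ring]
    exact mon_mem_lowerSpan ⟨by simp, ho.2⟩ (height_zero_lt hwM (h0 h1) o)

theorem step_last (p : NoumiParams a b c d t) (hc : c ≠ 0) (hd : d ≠ 0) (hw0 : 0 < w)
    (hwM : |w| < M) :
    Step M w co (heckeT p (n + 1)) (Fin.last n) (-1) (Fin.last n) 1
      (fun u _ => if u = -1 then p.sqrtTN⁻¹ else p.sqrtTN) := by
  intro u o ho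
  obtain ⟨κ₀, h, h0⟩ := heckeT_last_mon p hc hd ho.1 o
  rw [one_mul, neg_one_mul, h, add_assoc, add_sub_cancel_left]
  refine add_mem (smul_mem_of_ne_zero fun h1 => ?_) (smul_mem_of_ne_zero fun h1 => ?_)
  · have hu : u = 1 := by
      by_contra h2
      exact h1 (if_neg h2)
    rw [← one_mul (-1 : ℤ)]
    refine mon_mem_lowerSpan ⟨by simp, ho.2⟩ ?_
    rw [height_update_left u, hu]
    norm_num
    linarith
  · rw [← mul_zero (1 : ℤ)]
    exact mon_mem_lowerSpan ⟨by simp, ho.2⟩ (height_zero_lt hwM (h0 h1) o)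

theorem prod_ite_succ (P Q : Fin n → Prop) [DecidablePred P] [DecidablePred Q] (j : Fin n)
    (hPQ : ∀ q, Q q ↔ (P q ∨ q = j)) (hj : ¬ P j) (f : Fin n → ℂ) :
    (∏ q, if Q q then f q else 1) = (∏ q, if P q then f q else 1) * f j := by
  rw [← mul_prod_erase _ _ (mem_univ j), ← mul_prod_erase univ (fun q => if P q then f q else 1)
    (mem_univ j), if_pos ((hPQ j).2 (Or.inr rfl)), if_neg hj, one_mul, mul_comm]
  congr 1
  refine prod_congr rfl fun q hq => ?_
  simp [hPQ, ne_of_mem_erase hq]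

theorem step_ascInvT (p : NoumiParams a b c d t) (ht : t ≠ 0) (hwM : |w| < M)
    (hqM : ∀ q, |co q| < M) {j : ℕ} (hj : j < n + 1) (hq : ∀ q : Fin n, (q : ℕ) < j → w < co q) :
    Step M w co (ascInvT (n + 1) p 1 j) ⟨j, hj⟩ 1 0 1
      (fun u o => ∏ q : Fin n, if (q : ℕ) < j then
        (if o q < u then p.sqrtT else p.sqrtT⁻¹) else 1) := by
  induction j with
  | zero => exact (Step.one _ _).congr (by simp)
  | succ j ih =>
    have h1 := ih (by omega) fun q h => hq q (by omega)
    have h2 := step_left (M := M) p ht (⟨j, by omega⟩ : Fin n) hwM (hqM _) (hq _ (by simp))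
    rw [ascInvT_add, ascInvT_one, add_comm 1 j]
    refine (h1.comp h2).congr fun u o => ?_
    rw [prod_ite_succ (fun q : Fin n => (q : ℕ) < j) (fun q : Fin n => (q : ℕ) < j + 1)
      ⟨j, by omega⟩ (fun q => by simp [Fin.ext_iff]; omega) (by simp), mul_comm]

theorem step_descT (p : NoumiParams a b c d t) (hw0 : 0 < w) (hwM : |w| < M)
    (hq0 : ∀ q, 0 < co q) (hqM : ∀ q, |co q| < M) {j : ℕ} (hj : j < n + 1) :
    Step M w co (descT (n + 1) p 1 j) 0 (-1) ⟨j, hj⟩ (-1)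
      (fun u o => ∏ q : Fin n, if (q : ℕ) < j then
        (if o q < -u then p.sqrtT⁻¹ else p.sqrtT) else 1) := by
  induction j with
  | zero => exact (Step.one _ _).congr (by simp)
  | succ j ih =>
    have h1 := ih (by omega)
    have h2 := step_right (M := M) p (⟨j, by omega⟩ : Fin n) hw0 hwM (hq0 _) (hqM _)
    rw [descT_add, descT_one, add_comm 1 j]
    refine (h2.comp h1).congr fun u o => ?_
    rw [prod_ite_succ (fun q : Fin n => (q : ℕ) < j) (fun q : Fin n => (q : ℕ) < j + 1)
      ⟨j, by omega⟩ (fun q => by simp [Fin.ext_iff]; omega) (by simp)]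

theorem step_ascT (p : NoumiParams a b c d t) (hwM : |w| < M) (hqM : ∀ q, |co q| < M) {i r : ℕ}
    (hr : i + r < n + 1) (hq : ∀ q : Fin n, i ≤ (q : ℕ) → co q < w) :
    Step M w co (ascT (n + 1) p (i + 1) r) ⟨i + r, hr⟩ 1 ⟨i, by omega⟩ 1
      (fun u o => ∏ q : Fin n, if i ≤ (q : ℕ) ∧ (q : ℕ) < i + r then
        (if u < o q then p.sqrtT⁻¹ else p.sqrtT) else 1) := by
  induction r with
  | zero =>
    refine (Step.one _ _).congr fun u o => (prod_eq_one fun q _ => if_neg ?_).symm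
    omega
  | succ r ih =>
    have h1 := ih (by omega)
    have h2 := step_back (M := M) p (⟨i + r, by omega⟩ : Fin n) hwM (hqM _)
      (hq _ (by simp))
    rw [ascT_add, ascT_one, add_right_comm i 1 r]
    refine (h1.comp h2).congr fun u o => ?_
    rw [prod_ite_succ (fun q : Fin n => i ≤ (q : ℕ) ∧ (q : ℕ) < i + r)
      (fun q : Fin n => i ≤ (q : ℕ) ∧ (q : ℕ) < i + (r + 1))
      ⟨i + r, by omega⟩ (fun q => by simp [Fin.ext_iff]; omega) (by simp), mul_comm]

/-- The diagonal coefficient of `Y_i`, as a product over the letters other than the `i`th. -/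
def diagCoeff (p : NoumiParams a b c d t) (i : Fin (n + 1)) (u : ℤ) (o : Fin n → ℤ) : ℂ :=
  (if u = 0 then p.sqrtT0 * p.sqrtTN else if u = 1 then p.q * p.sqrtT0 * p.sqrtTN
    else p.q⁻¹ * p.sqrtT0⁻¹ * p.sqrtTN⁻¹) *
  ∏ q : Fin n, (if (q : ℕ) < i then (if o q < u then p.sqrtT else p.sqrtT⁻¹) else
      if u < o q then p.sqrtT⁻¹ else p.sqrtT) * (if o q < -u then p.sqrtT⁻¹ else p.sqrtT)

/-- `Y_i` takes the distinguished letter on a round trip: left to the first place, inverted by `T₀`,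
right to the last place, inverted by `T_N`, and back to `i`. Weights decreasing along the word make
every leg triangular. -/
theorem step_lusztigY (p : NoumiParams a b c d t) (ha : a ≠ 0) (hb : b ≠ 0) (hc : c ≠ 0)
    (hd : d ≠ 0) (ht : t ≠ 0) (hw0 : 0 < w) (hwM : |w| < M)
    (hq0 : ∀ q, 0 < co q) (hqM : ∀ q, |co q| < M) (i : Fin (n + 1))
    (hl : ∀ q : Fin n, (q : ℕ) < i → w < co q) (hr : ∀ q : Fin n, (i : ℕ) ≤ q → co q < w)
    {u : ℤ} {o : Fin n → ℤ} (ho : IsWord u o) :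
    lusztigY p i (mon (i.insertNth u o : Fin (n + 1) → ℤ)) -
      diagCoeff p i u o • mon (i.insertNth u o : Fin (n + 1) → ℤ) ∈
        lowerSpan M w co i 1 (height M w co u o) := by
  have hi := i.2
  have h1 := step_ascInvT (M := M) p ht hwM hqM i.2 hl
  have h2 := step_first (M := M) (w := w) (co := co) p ha hb hw0 hwM
  have h3 := step_descT (M := M) p hw0 hwM hq0 hqM (Nat.lt_succ_self n)
  have h4 := step_last (M := M) (w := w) (co := co) p hc hd hw0 hwM
  have h5 := step_ascT (M := M) (r := n - i) p hwM hqM (by omega) hr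
  have e5 : (⟨(i : ℕ) + (n - i), by omega⟩ : Fin (n + 1)) = Fin.last n :=
    Fin.ext (by simp; omega)
  rw [e5] at h5
  have e : lusztigY p i = ascT (n + 1) p (i + 1) (n - i) *
      (heckeT p (n + 1) * (descT (n + 1) p 1 n * (heckeT p 0 * ascInvT (n + 1) p 1 i))) := by
    rw [lusztigY_eq, Nat.add_sub_cancel, show n + 1 + 1 = 1 + n + 1 by omega, descT_add, descT_add]
    simp only [descT_one, zero_add, add_comm 1 n, mul_assoc]
  have h := h5.comp (h4.comp (h3.comp (h2.comp h1))) u o ho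
  rw [← e, one_mul] at h
  convert h using 3
  rw [diagCoeff, prod_mul_distrib]
  have e1 : (∏ q : Fin n, if (q : ℕ) < i then (if o q < u then p.sqrtT else p.sqrtT⁻¹) else
      if u < o q then p.sqrtT⁻¹ else p.sqrtT) =
      (∏ q : Fin n, if (q : ℕ) < i then (if o q < u then p.sqrtT else p.sqrtT⁻¹) else 1) *
      ∏ q : Fin n, if (i : ℕ) ≤ q ∧ (q : ℕ) < i + (n - i) then
        (if u < o q then p.sqrtT⁻¹ else p.sqrtT) else 1 := by
    rw [← prod_mul_distrib]
    refine prod_congr rfl fun q _ => ?_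
    have hq := q.2
    by_cases hqi : (q : ℕ) < i
    · have h' : ¬((i : ℕ) ≤ q ∧ (q : ℕ) < i + (n - i)) := by omega
      rw [if_pos hqi, if_pos hqi, if_neg h', mul_one]
    · have h' : (i : ℕ) ≤ q ∧ (q : ℕ) < i + (n - i) := by omega
      rw [if_neg hqi, if_neg hqi, if_pos h', one_mul]
  have e2 : (∏ q : Fin n, if (q : ℕ) < n then (if o q < -u then p.sqrtT⁻¹ else p.sqrtT) else 1) =
      ∏ q : Fin n, if o q < -u then p.sqrtT⁻¹ else p.sqrtT :=
    prod_congr rfl fun q _ => if_pos q.2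
  beta_reduce
  rw [e1, e2]
  have e3 : (if u = 0 then p.sqrtT0 * p.sqrtTN else if u = 1 then p.q * p.sqrtT0 * p.sqrtTN
      else p.q⁻¹ * p.sqrtT0⁻¹ * p.sqrtTN⁻¹) = (if u = 0 then p.sqrtT0 else
      if u = 1 then p.q * p.sqrtT0 else p.q⁻¹ * p.sqrtT0⁻¹) *
      (if u = -1 then p.sqrtTN⁻¹ else p.sqrtTN) := by
    rcases eq_of_abs_le_one ho.1 with rfl | rfl | rfl <;> norm_num
  rw [e3]
  ring

end Triangularity

/-! ### The spectrum and uniqueness -/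

section Uniqueness

variable {n : ℕ} {a b c d t : ℂ}

/-- The exponent counts the other letters not ranked ahead of the `i`th, so the power splits into
one factor per letter, to be matched with `diagCoeff`. -/
theorem pow_sub_absRho (t : ℂ) (β : Fin (n + 1) → ℤ) (i : Fin (n + 1)) :
    t ^ (n + 1 - absRho β i) = ∏ q : Fin n,
      if |β i| < |β (i.succAbove q)| ∨ (|β (i.succAbove q)| = |β i| ∧
        (β i < β (i.succAbove q) ∨ (β (i.succAbove q) = β i ∧
          (if 0 ≤ β i then i.succAbove q < i else i < i.succAbove q)))) then 1 else t := by
  set P : Fin (n + 1) → Prop := fun j => |β i| < |β j| ∨ (|β j| = |β i| ∧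
    (β i < β j ∨ (β j = β i ∧ (if 0 ≤ β i then j < i else i < j)))) with hP
  have hPi : ¬ P i := by
    simp [hP]
  have h1 : #{j | P j} = #{q : Fin n | P (i.succAbove q)} := by
    rw [card_filter, card_filter, Fin.sum_univ_succAbove _ i, if_neg hPi, zero_add]
  have h2 : n + 1 - absRho β i = #{q : Fin n | ¬ P (i.succAbove q)} := by
    have h3 := card_filter_add_card_filter_not (s := (univ : Finset (Fin n)))
      (fun q => P (i.succAbove q))
    rw [card_univ, Fintype.card_fin] at h3
    change n + 1 - (1 + #{j | P j}) = _
    omega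
  rw [h2, prod_ite, prod_const_one, one_mul, prod_const]

theorem diagCoeff_eq_omega (p : NoumiParams a b c d t) (ht : t ≠ 0) {β : Fin (n + 1) → ℤ}
    (hβ : ∀ j, |β j| ≤ 1) (i : Fin (n + 1)) :
    diagCoeff p i (β i) (fun q => β (i.succAbove q)) = omega p β i := by
  have hs := p.sqrtT_ne_zero ht
  have hss : p.sqrtT * p.sqrtT = t := by rw [← sq, p.sqrtT_sq]
  have hss' : p.sqrtT⁻¹ * p.sqrtT⁻¹ = t⁻¹ := by rw [← mul_inv, hss]
  have hs1 : p.sqrtT * p.sqrtT⁻¹ = 1 := mul_inv_cancel₀ hs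
  have hs2 : p.sqrtT⁻¹ * p.sqrtT = 1 := inv_mul_cancel₀ hs
  have hlt : ∀ q : Fin n, i.succAbove q < i ↔ (q : ℕ) < i := fun q => by
    rw [Fin.succAbove_lt_iff_castSucc_lt, Fin.lt_def, Fin.val_castSucc]
  have hgt : ∀ q : Fin n, i < i.succAbove q ↔ ¬ (q : ℕ) < i := fun q => by
    rw [← hlt, not_lt]
    exact ⟨le_of_lt, fun h => lt_of_le_of_ne h (Fin.succAbove_ne i q).symm⟩
  rw [omega, pow_sub_absRho, diagCoeff]
  rcases eq_of_abs_le_one (hβ i) with hi | hi | hi <;> simp only [hi]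
  · rw [if_neg (by norm_num), if_neg (by norm_num), if_pos (by norm_num), zpow_neg_one,
      zpow_neg_one, mul_inv, mul_inv, ← prod_inv_distrib, ← mul_assoc, ← mul_assoc]
    congr 1
    refine prod_congr rfl fun q _ => ?_
    simp only [hlt, hgt]
    by_cases hq : (q : ℕ) < i <;>
      rcases eq_of_abs_le_one (hβ (i.succAbove q)) with h | h | h <;>
      simp only [h, hq] <;> norm_num [hss, hss', hs1, hs2]
  · rw [if_pos trivial, if_neg (lt_irrefl _), zpow_zero, zpow_one, one_mul]
    congr 1
    refine prod_congr rfl fun q _ => ?_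
    simp only [hlt, hgt]
    by_cases hq : (q : ℕ) < i <;>
      rcases eq_of_abs_le_one (hβ (i.succAbove q)) with h | h | h <;>
      simp only [h, hq] <;> norm_num [hss, hss', hs1, hs2]
  · rw [if_pos trivial, if_neg (show ¬ (1 : ℤ) < 0 by norm_num), zpow_one, zpow_one, ← mul_assoc,
      ← mul_assoc]
    congr 1
    refine prod_congr rfl fun q _ => ?_
    simp only [hlt, hgt]
    by_cases hq : (q : ℕ) < i <;>
      rcases eq_of_abs_le_one (hβ (i.succAbove q)) with h | h | h <;>
      simp only [h, hq] <;> norm_num [hss, hss', hs1, hs2]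

/-- A height function for which the operators `Y_i` are triangular on words. -/
def wordHeight {N : ℕ} (β : Fin N → ℤ) : ℤ :=
  (N + 1) * ∑ j, |β j| + ∑ j : Fin N, (N - j) * β j

theorem lusztigY_mon {N : ℕ} (p : NoumiParams a b c d t) (ha : a ≠ 0) (hb : b ≠ 0) (hc : c ≠ 0)
    (hd : d ≠ 0) (ht : t ≠ 0) {β : Fin N → ℤ} (hβ : ∀ j, |β j| ≤ 1) (i : Fin N) :
    lusztigY p i (mon β) - omega p β i • mon β ∈
      Submodule.span ℂ {f | ∃ γ : Fin N → ℤ, wordHeight γ < wordHeight β ∧ f = mon γ} := by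
  obtain ⟨n, rfl⟩ : ∃ n, N = n + 1 := ⟨N - 1, by have := i.pos; omega⟩
  -- The weights are `N, N-1, …, 1` from left to right: positive, strictly decreasing and below `M =
  -- N + 1`. They do not depend on `i`, so one height serves every `Y_i`.
  set M : ℤ := ((n + 1 : ℕ) : ℤ) + 1
  set w : ℤ := ((n + 1 : ℕ) : ℤ) - i
  set co : Fin n → ℤ := fun q => ((n + 1 : ℕ) : ℤ) - i.succAbove q
  have hM : ∀ j : Fin (n + 1), |((n + 1 : ℕ) : ℤ) - j| < M := fun j => by
    have := j.2
    rw [abs_lt]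
    omega
  have h0 : ∀ j : Fin (n + 1), 0 < ((n + 1 : ℕ) : ℤ) - j := fun j => by
    have := j.2
    omega
  have hheight : ∀ (u : ℤ) (o : Fin n → ℤ),
      height M w co u o = wordHeight (i.insertNth u o : Fin (n + 1) → ℤ) := by
    intro u o
    rw [height, wordHeight, Fin.sum_univ_succAbove _ i, Fin.sum_univ_succAbove _ i]
    simp only [Fin.insertNth_apply_same, Fin.insertNth_apply_succAbove]
    ring
  have hl : ∀ q : Fin n, (q : ℕ) < i → w < co q := fun q hq => by
    have : i.succAbove q < i := by
      rwa [Fin.succAbove_lt_iff_castSucc_lt, Fin.lt_def, Fin.val_castSucc]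
    rw [Fin.lt_def] at this
    simp only [w, co]
    omega
  have hr : ∀ q : Fin n, (i : ℕ) ≤ q → co q < w := fun q hq => by
    have : i < i.succAbove q := by
      rwa [Fin.lt_succAbove_iff_le_castSucc, Fin.le_def, Fin.val_castSucc]
    rw [Fin.lt_def] at this
    simp only [w, co]
    omega
  have hins : (i.insertNth (β i) (fun q => β (i.succAbove q)) : Fin (n + 1) → ℤ) = β :=
    Fin.insertNth_self_removeNth i β
  have h := step_lusztigY (M := M) (w := w) (co := co) p ha hb hc hd ht (h0 i) (hM i)
    (fun q => h0 _) (fun q => hM _) i hl hr (u := β i) (o := fun q => β (i.succAbove q))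
    ⟨hβ i, fun q => hβ _⟩
  rw [hheight, hins, diagCoeff_eq_omega p ht hβ] at h
  refine Submodule.span_mono ?_ h
  rintro f ⟨u, o, -, h1, rfl⟩
  refine ⟨_, ?_, rfl⟩
  rwa [one_mul, ← hheight]

theorem eq_of_isNonsymKoornwinder {N : ℕ} (p : NoumiParams a b c d t) (ha : a ≠ 0) (hb : b ≠ 0)
    (hc : c ≠ 0) (hd : d ≠ 0) (ht : t ≠ 0) {α : Fin N → ℤ} (hα : ∀ j, |α j| ≤ 1)
    (hgen : GenericFor p α) {E F : Laurent N} (hE : IsNonsymKoornwinder p α E)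
    (hF : IsNonsymKoornwinder p α F) : E = F := by
  by_contra hne
  set D : Laurent N := E - F with hD
  have hcoeff : ∀ β, D.coeff β = E.coeff β - F.coeff β := fun β => by
    rw [hD, AddMonoidAlgebra.coeff_sub, Finsupp.sub_apply]
  have hprec : ∀ β, D.coeff β ≠ 0 → Prec β α := by
    intro β hβ
    rw [hcoeff] at hβ
    have hβα : β ≠ α := by
      rintro rfl
      rw [hE.coeff_self, hF.coeff_self, sub_self] at hβ
      exact hβ rfl
    by_cases h : E.coeff β = 0
    · exact (hF.triangular β fun h' => hβ (by rw [h, h', sub_self])).resolve_left hβα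
    · exact (hE.triangular β h).resolve_left hβα
  have hsupp : D.coeff.support.Nonempty := by
    rw [Finsupp.support_nonempty_iff]
    intro h
    exact hne (sub_eq_zero.1 (AddMonoidAlgebra.coeff_injective h))
  -- No lower term of any `Y_i z^γ` with `γ` in the support can reach maximal height, so the
  -- coefficient at `β` sees only the diagonal.
  obtain ⟨β, hβ, hmax⟩ := exists_max_image D.coeff.support wordHeight hsupp
  rw [Finsupp.mem_support_iff] at hβ
  obtain ⟨i, hi⟩ := hgen β (hprec β hβ)
  apply hi
  have h1 : lusztigY p i D = omega p α i • D := by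
    rw [hD, map_sub, hE.eigen, hF.eigen, smul_sub]
  have h2 : D = ∑ γ ∈ D.coeff.support, D.coeff γ • mon γ := by
    apply AddMonoidAlgebra.coeff_injective
    ext γ
    rw [AddMonoidAlgebra.coeff_sum, Finsupp.finsetSum_apply]
    simp [mon, Finsupp.single_apply]
  have h3 : ∀ γ ∈ D.coeff.support, (lusztigY p i (mon γ)).coeff β =
      omega p γ i * (mon γ : Laurent N).coeff β := by
    intro γ hγ
    have h4 := lusztigY_mon p ha hb hc hd ht
      (abs_le_one_of_prec hα (hprec γ (Finsupp.mem_support_iff.1 hγ))) i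
    have h5 : ∀ f ∈ Submodule.span ℂ
        {f : Laurent N | ∃ δ : Fin N → ℤ, wordHeight δ < wordHeight γ ∧ f = mon δ},
        f.coeff β = 0 := by
      intro f hf
      induction hf using Submodule.span_induction with
      | mem f hf =>
        obtain ⟨δ, hδ, rfl⟩ := hf
        have : δ ≠ β := by
          rintro rfl
          exact absurd (hmax γ hγ) (not_le.2 hδ)
        simp [mon, this]
      | zero => simp
      | add f g _ _ hf hg => simp [hf, hg]
      | smul x f _ hf => simp [hf]
    have h6 := h5 _ h4
    rw [AddMonoidAlgebra.coeff_sub, Finsupp.sub_apply, AddMonoidAlgebra.coeff_smul,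
      Finsupp.smul_apply, smul_eq_mul, sub_eq_zero] at h6
    exact h6
  have h7 : (lusztigY p i D).coeff β = omega p β i * D.coeff β := by
    conv_lhs => rw [h2]
    rw [map_sum, AddMonoidAlgebra.coeff_sum, Finsupp.finsetSum_apply,
      sum_eq_single β]
    · rw [map_smul, AddMonoidAlgebra.coeff_smul, Finsupp.smul_apply,
        h3 β (Finsupp.mem_support_iff.2 hβ)]
      simp [mon]
      ring
    · intro γ hγ hne
      rw [map_smul, AddMonoidAlgebra.coeff_smul, Finsupp.smul_apply, h3 γ hγ]
      simp [mon, hne]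
    · intro h
      exact absurd (Finsupp.mem_support_iff.2 hβ) h
  rw [h1, AddMonoidAlgebra.coeff_smul, Finsupp.smul_apply, smul_eq_mul] at h7
  exact (mul_right_cancel₀ hβ h7).symm

end Uniqueness

end Koornwinder

end

theorem mainTheorem2 (k m : ℕ) (a b c d t : ℂ)
    (ha : a ≠ 0) (hb : b ≠ 0) (hc : c ≠ 0) (hd : d ≠ 0) (ht : t ≠ 0)
    (htk : ∀ j, 1 ≤ j → j ≤ k → t ^ j ≠ 1)
    (hden : ∀ j, j < k → a * b * c * d * t ^ (2 * m + j) ≠ 1) :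
    -- for every `q`, the integral formula is a non-symmetric Koornwinder polynomial
    (∀ p : Koornwinder.NoumiParams a b c d t,
      Koornwinder.IsNonsymKoornwinder p (Koornwinder.mu k m)
        (Koornwinder.integralFormula a b c d t k m)) ∧
    -- for generic parameters it is the only one
    (∀ p : Koornwinder.NoumiParams a b c d t,
      Koornwinder.GenericFor p (Koornwinder.mu k m) →
      ∀ E, Koornwinder.IsNonsymKoornwinder p (Koornwinder.mu k m) E →
        E = Koornwinder.integralFormula a b c d t k m) ∧
    -- independence of `q`
    (∀ p p' : Koornwinder.NoumiParams a b c d t,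
      Koornwinder.GenericFor p (Koornwinder.mu k m) →
      Koornwinder.GenericFor p' (Koornwinder.mu k m) →
      ∀ E E', Koornwinder.IsNonsymKoornwinder p (Koornwinder.mu k m) E →
        Koornwinder.IsNonsymKoornwinder p' (Koornwinder.mu k m) E' → E = E') ∧
    -- the coefficients are characterised by the initial value and the three-term recursion
    (∀ h : ℕ → ℂ,
      (h 0 = 1 ∧ Koornwinder.ThreeTermRec a b (t ^ m * c) (t ^ m * d) t k h) ↔
        ∀ n ≤ k, h n = Koornwinder.hCoeff a b (t ^ m * c) (t ^ m * d) t n) ∧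
    -- after renormalisation, this is the Al-Salam–Chihara recursion
    (∀ s : ℂ, s ^ 2 = (t ^ m * c) * (t ^ m * d) →
      Koornwinder.AlSalamChiharaRec ((t ^ m * c + t ^ m * d) / (2 * s)) (s * a) (s * b) t k
        fun n => (-1) ^ n * (s ^ n)⁻¹ *
          Koornwinder.poch (a * b * (t ^ m * c) * (t ^ m * d)) t n *
          Koornwinder.hCoeff a b (t ^ m * c) (t ^ m * d) t n) := by
  have hc' : t ^ m * c ≠ 0 := mul_ne_zero (pow_ne_zero m ht) hc
  have hd' : t ^ m * d ≠ 0 := mul_ne_zero (pow_ne_zero m ht) hd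
  -- The two factors `tᵐ` give `t^{2m}`: the hypothesis is the nonvanishing of the denominators
  -- `(abc'd';t)ₙ` for `n ≤ k`.
  have hden' : ∀ j < k, a * b * (t ^ m * c) * (t ^ m * d) * t ^ j ≠ 1 := fun j hj h =>
    hden j hj (by rw [← h]; ring)
  have hrec := Koornwinder.hCoeff_threeTermRec htk hc' hd' hden'
  have hF : ∀ p : Koornwinder.NoumiParams a b c d t,
      Koornwinder.IsNonsymKoornwinder p (Koornwinder.mu k m)
        (Koornwinder.integralFormula a b c d t k m) := fun p =>
    Koornwinder.isNonsymKoornwinder_integralFormula p ha hb hc hd ht hrec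
  have hmu : ∀ j, |Koornwinder.mu k m j| ≤ 1 := by
    rw [Koornwinder.mu_eq_negInd]
    exact Koornwinder.abs_negInd_le _
  have huniq : ∀ p : Koornwinder.NoumiParams a b c d t,
      Koornwinder.GenericFor p (Koornwinder.mu k m) →
      ∀ E, Koornwinder.IsNonsymKoornwinder p (Koornwinder.mu k m) E →
        E = Koornwinder.integralFormula a b c d t k m := fun p hp E hE =>
    Koornwinder.eq_of_isNonsymKoornwinder p ha hb hc hd ht hmu hp hE (hF p)
  exact ⟨hF, huniq,
    fun p p' hp hp' E E' hE hE' => (huniq p hp E hE).trans (huniq p' hp' E' hE').symm,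
    fun h => Koornwinder.threeTermRec_iff htk hc' hd' hden' h,
    fun s hs => Koornwinder.alSalamChiharaRec_of_sq htk hc' hd' hden' hs⟩
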